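/- Let $S$ be a sensitivity function on the closed right half plane which has a Weierstrass factorization $$S(s)=g(s)\prod_{j}(s-p_j)^{d_j}c_j(s)$$ of the following kind. The (finitely or infinitely many) points $p_j$ with $\operatorname{Re}p_j>0$ are the open right half plane poles of the loop transfer function $L=1/S-1$, with orders $d_j>0$ (not necessarily integers; powers are principal). There are a set $E\subset i\mathbb R$ with finitely many points in every bounded set and an open set $U\supseteq\{\operatorname{Re}s\ge 0\}\setminus E$ such that $g$ is holomorphic on $U$ without zeros in the open right half plane, the convergence factors $c_j$ are holomorphic and zero-free on $U$, and on every compact $K\subset U$ one has $|(s-p_j)^{d_j}c_j(s)-1|\le u_j$ with $\sum_j u_j<\infty$; the factorization of $S$ holds on $\{\operatorname{Re}s\ge 0\}\setminus E$. Thus the $p_j$ can have limit points only in $E$, and if they have none then $E=\varnothing$ is allowed. At every $q\in E$ suppose that $\omega\mapsto\log|S(i\omega)|$ is integrable near $\omega = q/i$ and that $$\lim_{\epsilon\to0^+}\int_{|s-q|=\epsilon,\ \operatorname{Re}s\ge0}\bigl|\log|S(s)|\bigr|\,|ds|=0 .$$ For $R>0$ let $\gamma_R$ be the semicircle $|s|=R$,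 $\operatorname{Re}s\ge0$, traversed counterclockwise from $-iR$ to $iR$; let $\log S$ on $\gamma_R$ be a holomorphic branch along $\gamma_R$ (i.e. a function $f$ holomorphic near $\gamma_R$ with $|e^f|=|S|$ at the points near $\gamma_R$ with $\operatorname{Re}s\ge0$; its additive imaginary constant is immaterial below). Suppose that the real limit $$A=\lim_{R\to\infty}\operatorname{Re}\Bigl(2i\int_{\gamma_R}\log S(s)\,ds\Bigr)$$ exists, where $R$ runs over the radii for which $\gamma_R$ contains no zero of $S$ and $\pm iR\notin E$. It is not assumed that $A=0$. Then $\log|S(i\omega)|^2$ is integrable on every interval $[-R,R]$, and the Bode integral $I(S)=\lim_{R\to\infty}\int_{-R}^{R}\log|S(i\omega)|^2\,d\omega$ satisfies $$I(S)=4\pi\sum_j d_j\operatorname{Re}(p_j)-\lim_{R\to\infty}\operatorname{Re}\Bigl(2i\int_{\gamma_R}\log S(s)\,ds\Bigr)$$ if $\sum_j d_j\operatorname{Re}(p_j)<\infty$, and $I(S)=+\infty$ if this sum diverges. -/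

import Mathlib

open Filter Topology MeasureTheory

namespace BodeSensitivity

/-- The factor `(s - p) ^ d * c s` belonging to a right half plane pole `p` of order `d > 0` of the
open loop (a zero of the sensitivity function). The power is the principal one, whose branch cut is
the horizontal ray going left from `p`; `c` is a convergence factor. -/
noncomputable def factor (p : ℂ) (d : ℝ) (c : ℂ → ℂ) (s : ℂ) : ℂ :=
  (s - p) ^ (d : ℂ) * c s

/-- `S = g * ∏ j, (s - p j) ^ d j` on the closed right half plane, in the sense of Weierstrass.

* `p j` are the open right half plane poles of the loop transfer function `L = 1 / S - 1`, and
  `d j > 0`, not necessarily an integer, is the order of `p j`.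
* `c j` are the zero-free convergence factors without which an infinite product
  `∏ j, (s - p j) ^ d j` with integer orders diverges (they may be `1` where it converges).
* `g` is holomorphic, without zeros in the open right half plane (zeros of `g` on the
  imaginary axis are allowed); as `S` is closed-loop stable, it is holomorphic on the right.
* The product converges normally on the compact subsets of `U`.
* `U` is an open set that contains the closed right half plane except for a locally finite set of
  points `y * I`, `y ∈ E`, of the imaginary axis. By normal convergence, the `p j` can accumulate
  only at these points. If the `p j` have no limit point, one may take `E = ∅`. -/
structure IsWeierstrassFactorization {ι : Type*} (S g : ℂ → ℂ) (p : ι → ℂ) (d : ι → ℝ)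
    (c : ι → ℂ → ℂ) (E : Set ℝ) (U : Set ℂ) : Prop where
  isOpen : IsOpen U
  locallyFinite : ∀ R : ℝ, (E ∩ Set.Icc (-R) R).Finite
  subset : ∀ s : ℂ, 0 ≤ s.re → (∀ y ∈ E, s ≠ (y : ℂ) * Complex.I) → s ∈ U
  pole_re_pos : ∀ j, 0 < (p j).re
  order_pos : ∀ j, 0 < d j
  holomorphic : DifferentiableOn ℂ g U
  ne_zero : ∀ s : ℂ, 0 < s.re → g s ≠ 0
  factor_holomorphic : ∀ j, DifferentiableOn ℂ (c j) U
  factor_ne_zero : ∀ j, ∀ s ∈ U, c j s ≠ 0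
  normal_convergence : ∀ K ⊆ U, IsCompact K → ∃ u : ι → ℝ, Summable u ∧
    ∀ j, ∀ s ∈ K, ‖factor (p j) (d j) (c j) s - 1‖ ≤ u j
  eq_prod : ∀ s : ℂ, 0 ≤ s.re → (∀ y ∈ E, s ≠ (y : ℂ) * Complex.I) →
    S s = g s * ∏' j, factor (p j) (d j) (c j) s

/-- Regularity of `log |S|` at a boundary point `y * I`: it is integrable along the imaginary axis
near the point, and the integral of `|log |S||` with respect to arc length over the semicircle of
radius `ε` around the point, in the right half plane, tends to `0` with `ε`. -/
def LogRegularAt (S : ℂ → ℂ) (y : ℝ) : Prop :=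
  IntegrableAtFilter (fun w : ℝ => Real.log ‖S ((w : ℂ) * Complex.I)‖) (𝓝 y) ∧
  Tendsto (fun ε : ℝ => ∫ θ in (-(Real.pi / 2))..(Real.pi / 2),
      |Real.log ‖S (circleMap ((y : ℂ) * Complex.I) ε θ)‖| * ε) (𝓝[>] 0) (𝓝 0)

/-- The Bode integral over the frequencies `|w| ≤ R`. -/
noncomputable def truncatedBodeIntegral (S : ℂ → ℂ) (R : ℝ) : ℝ :=
  ∫ w in (-R)..R, Real.log (‖S ((w : ℂ) * Complex.I)‖ ^ 2)

/-- The Bode integral `∫ log |S (i w)| ^ 2 dw` over the real line converges, as the limit of the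
integrals over `[-R, R]`, to the value `J`. -/
def HasBodeIntegral (S : ℂ → ℂ) (J : ℝ) : Prop :=
  Tendsto (truncatedBodeIntegral S) atTop (𝓝 J)

/-- The closed semicircle of radius `R` around `0` in the right half plane. -/
def arc (R : ℝ) : Set ℂ := {s | ‖s‖ = R ∧ 0 ≤ s.re}

/-- The radii whose arc carries no zero of `S` and does not end at an exceptional point. -/
def admissibleRadii (S : ℂ → ℂ) (E : Set ℝ) : Set ℝ :=
  {R | 0 < R ∧ R ∉ E ∧ -R ∉ E ∧ ∀ s ∈ arc R, S s ≠ 0}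

/-- `f` is a holomorphic branch of `log S` along the arc of radius `R`. For orders that are not
integers `S` is determined only up to a unimodular constant upon continuation across a cut, so that
only `|exp f| = |S|` is asked for. Where `S` is holomorphic this means that `f` is a branch of
`log S` up to an additive imaginary constant. -/
def IsLogBranch (S : ℂ → ℂ) (R : ℝ) (f : ℂ → ℂ) : Prop :=
  ∃ V : Set ℂ, IsOpen V ∧ arc R ⊆ V ∧ DifferentiableOn ℂ f V ∧
    ∀ s ∈ V, 0 ≤ s.re → ‖Complex.exp (f s)‖ = ‖S s‖

/-- The contour integral of `f` along the arc of radius `R` from `-i R` to `i R`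
(counterclockwise). -/
noncomputable def arcIntegral (f : ℂ → ℂ) (R : ℝ) : ℂ :=
  ∫ θ in (-(Real.pi / 2))..(Real.pi / 2), f (circleMap 0 R θ) * (circleMap 0 R θ * Complex.I)

end BodeSensitivity

/-! In the open right half plane `log ‖S‖` has distributional Laplacian `2π ∑ d j δ_{p j}`: only
moduli matter, so the orders may be real, and the zeros of `g` lie on or to the left of the axis.
Test functions of the form `φ s = s.re * k s` vanish on the axis and have normal derivative `k`
there. For them Green's formula reads `∫ log ‖S‖ * Δφ = 2π ∑ d j * (p j).re * k (p j) - ∫ log ‖S (i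
y)‖ * k (i y) dy`.

Let `k` be a radial cutoff equal to `1` inside the disc of radius `R`, except in a thin annulus at
its rim. Then `Δφ` lives in that annulus, where `log ‖S‖` is the real part of the holomorphic branch
`f`. One more integration by parts turns `∫ f * Δφ` into a radial average of `2i ∫ f ds` over the
arcs in the annulus (`integral_mul_lap_re_mul`, `integral_mul_cauchyRiemann_radialCutoff`). As the
annulus shrinks, this gives the exact finite-radius identity `truncatedBodeIntegral_eq`. Letting `R
→ ∞` gives the theorem. Only admissible radii have a branch, but they are dense and the truncated
integral is continuous in `R`.

Green's formula for `log ‖S‖` is built in two stages. On compact sets off the exceptional points,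
`exists_log_norm_eq` writes `log ‖S‖` as finitely many logarithmic potentials
(`GreenFormula.log_norm_sub`) plus a uniformly convergent remainder of mass zero. An exceptional
point is then removed by a bump of radius `ε`. Since `φ` vanishes on the axis, the Laplacian of `φ *
bump` is only `O(1/ε)`, while the arc condition makes the integral of `|log ‖S‖|` over the half disc
`o(ε)`. For nonnegative `φ` the formula, and with it the summability of the pole sum, survives the
limit (`greenFormula_of_nonneg`). -/

namespace BodeSensitivity

/-- The open right half plane. -/
def rightHalfPlane : Set ℂ := {s | 0 < s.re}

lemma isOpen_rightHalfPlane : IsOpen rightHalfPlane :=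
  isOpen_lt continuous_const Complex.continuous_re

lemma measurableSet_rightHalfPlane : MeasurableSet rightHalfPlane :=
  isOpen_rightHalfPlane.measurableSet

/-! ### Partial derivatives and the Laplacian on the real plane -/

section Derivatives

variable {F : Type*} [NormedAddCommGroup F] [NormedSpace ℝ F]

/-- The partial derivative along the real axis. -/
noncomputable def dx (f : ℂ → F) (s : ℂ) : F := fderiv ℝ f s 1

/-- The partial derivative along the imaginary axis. -/
noncomputable def dy (f : ℂ → F) (s : ℂ) : F := fderiv ℝ f s Complex.I

/-- The Laplacian, as the sum of the iterated partial derivatives. -/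
noncomputable def lap (f : ℂ → F) (s : ℂ) : F := dx (dx f) s + dy (dy f) s

lemma contDiffAt_dx {f : ℂ → F} {s : ℂ} {n m : WithTop ℕ∞} (hf : ContDiffAt ℝ n f s)
    (h : m + 1 ≤ n) : ContDiffAt ℝ m (dx f) s :=
  (hf.fderiv_right h).clm_apply contDiffAt_const

lemma contDiffAt_dy {f : ℂ → F} {s : ℂ} {n m : WithTop ℕ∞} (hf : ContDiffAt ℝ n f s)
    (h : m + 1 ≤ n) : ContDiffAt ℝ m (dy f) s :=
  (hf.fderiv_right h).clm_apply contDiffAt_const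

lemma one_add_one_le_two : (1 : WithTop ℕ∞) + 1 ≤ 2 := by
  rw [one_add_one_eq_two]

lemma dx_eq_zero_of_notMem_tsupport {f : ℂ → F} {s : ℂ} (h : s ∉ tsupport f) : dx f s = 0 := by
  rw [dx, fderiv_of_notMem_tsupport ℝ h]; rfl

lemma dy_eq_zero_of_notMem_tsupport {f : ℂ → F} {s : ℂ} (h : s ∉ tsupport f) : dy f s = 0 := by
  rw [dy, fderiv_of_notMem_tsupport ℝ h]; rfl

lemma tsupport_dx_subset (f : ℂ → F) : tsupport (dx f) ⊆ tsupport f :=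
  closure_minimal (fun s hs => by
    by_contra h; exact hs (dx_eq_zero_of_notMem_tsupport h)) (isClosed_tsupport f)

lemma tsupport_dy_subset (f : ℂ → F) : tsupport (dy f) ⊆ tsupport f :=
  closure_minimal (fun s hs => by
    by_contra h; exact hs (dy_eq_zero_of_notMem_tsupport h)) (isClosed_tsupport f)

lemma lap_eq_zero_of_notMem_tsupport {f : ℂ → F} {s : ℂ} (h : s ∉ tsupport f) : lap f s = 0 := by
  rw [lap, dx_eq_zero_of_notMem_tsupport fun h' => h (tsupport_dx_subset f h'),
    dy_eq_zero_of_notMem_tsupport fun h' => h (tsupport_dy_subset f h'), add_zero]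

lemma dx_congr {f g : ℂ → F} {s : ℂ} (h : f =ᶠ[𝓝 s] g) : dx f =ᶠ[𝓝 s] dx g :=
  h.fderiv.mono fun z hz => by rw [dx, dx, hz]

lemma dy_congr {f g : ℂ → F} {s : ℂ} (h : f =ᶠ[𝓝 s] g) : dy f =ᶠ[𝓝 s] dy g :=
  h.fderiv.mono fun z hz => by rw [dy, dy, hz]

lemma hasDerivAt_re_line {f : ℂ → F} {x y : ℝ} (h : DifferentiableAt ℝ f ⟨x, y⟩) :
    HasDerivAt (fun t : ℝ => f ⟨t, y⟩) (dx f ⟨x, y⟩) x := by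
  have h1 : HasDerivAt (fun t : ℝ => (⟨t, y⟩ : ℂ)) 1 x := by
    have : (fun t : ℝ => (⟨t, y⟩ : ℂ)) = fun t : ℝ => (t : ℂ) + y * Complex.I := by
      ext t; rw [Complex.mk_eq_add_mul_I]
    rw [this]
    exact (Complex.ofRealCLM.hasDerivAt (x := x)).add_const _
  exact h.hasFDerivAt.comp_hasDerivAt x h1

lemma hasDerivAt_im_line {f : ℂ → F} {x y : ℝ} (h : DifferentiableAt ℝ f ⟨x, y⟩) :
    HasDerivAt (fun t : ℝ => f ⟨x, t⟩) (dy f ⟨x, y⟩) y := by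
  have h1 : HasDerivAt (fun t : ℝ => (⟨x, t⟩ : ℂ)) Complex.I y := by
    have : (fun t : ℝ => (⟨x, t⟩ : ℂ)) = fun t : ℝ => (x : ℂ) + t * Complex.I := by
      ext t; rw [Complex.mk_eq_add_mul_I]
    rw [this]
    simpa using ((Complex.ofRealCLM.hasDerivAt (x := y)).mul_const Complex.I).const_add (x : ℂ)
  exact h.hasFDerivAt.comp_hasDerivAt y h1

end Derivatives

/-! ### Integrals of partial derivatives over the right half plane -/

section HalfPlaneIntegrals

variable {E : Type*} [NormedAddCommGroup E]

lemma measurePreserving_mk :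
    MeasurePreserving Complex.measurableEquivRealProd.symm
      (((volume : Measure ℝ).restrict (Set.Ioi 0)).prod volume)
      (volume.restrict rightHalfPlane) := by
  have h := Complex.volume_preserving_equiv_real_prod.symm.restrict_preimage
    measurableSet_rightHalfPlane
  have h2 : Complex.measurableEquivRealProd.symm ⁻¹' rightHalfPlane = Set.Ioi 0 ×ˢ Set.univ := by
    ext p; simp [rightHalfPlane, Complex.measurableEquivRealProd_symm_apply]
  rw [h2, Measure.volume_eq_prod, ← Measure.prod_restrict, Measure.restrict_univ] at h
  exact h

lemma integrable_mk_iff {f : ℂ → E} :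
    Integrable (fun p : ℝ × ℝ => f ⟨p.1, p.2⟩)
      (((volume : Measure ℝ).restrict (Set.Ioi 0)).prod volume) ↔
      IntegrableOn f rightHalfPlane :=
  measurePreserving_mk.integrable_comp_emb (MeasurableEquiv.measurableEmbedding _)

/-- Continuity is asked for up to the axis but not beyond it, since `S` and its factors are
controlled only on the closed half plane; the support cut with that half plane is still compact. -/
lemma integrableOn_rightHalfPlane_of_continuousOn {f : ℂ → E}
    (hf : ∀ s, 0 ≤ s.re → ContinuousAt f s) (hc : HasCompactSupport f) :
    IntegrableOn f rightHalfPlane := by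
  have hK : IsCompact (tsupport f ∩ {s : ℂ | 0 ≤ s.re}) :=
    hc.inter_right (isClosed_le continuous_const Complex.continuous_re)
  have h1 : IntegrableOn f (tsupport f ∩ {s : ℂ | 0 ≤ s.re}) :=
    ContinuousOn.integrableOn_compact hK fun s hs => (hf s hs.2).continuousWithinAt
  refine h1.of_forall_sdiff_eq_zero measurableSet_rightHalfPlane fun s hs => ?_
  have h3 : s ∉ tsupport f := fun h => hs.2 ⟨h, (show 0 < s.re from hs.1).le⟩
  exact image_eq_zero_of_notMem_tsupport h3

lemma continuous_mk_left (y : ℝ) : Continuous fun t : ℝ => (⟨t, y⟩ : ℂ) := by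
  simp only [Complex.mk_eq_add_mul_I]; fun_prop

lemma exists_forall_eq_zero_of_hasCompactSupport {f : ℂ → E} (hc : HasCompactSupport f) :
    ∃ M > 0, ∀ s : ℂ, M < |s.re| ∨ M < |s.im| → f s = 0 := by
  obtain ⟨M, hM⟩ := hc.isBounded.subset_closedBall 0
  refine ⟨max M 1, by positivity, fun s hs => ?_⟩
  apply image_eq_zero_of_notMem_tsupport
  intro h
  have h1 : ‖s‖ ≤ M := by simpa using hM h
  have h2 := Complex.abs_re_le_norm s
  have h3 := Complex.abs_im_le_norm s
  have := le_max_left M 1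
  rcases hs with hs | hs <;> linarith

variable [NormedSpace ℝ E]

lemma setIntegral_rightHalfPlane (f : ℂ → E) :
    ∫ s in rightHalfPlane, f s =
      ∫ p : ℝ × ℝ, f ⟨p.1, p.2⟩ ∂(((volume : Measure ℝ).restrict (Set.Ioi 0)).prod volume) :=
  (measurePreserving_mk.integral_comp (MeasurableEquiv.measurableEmbedding _) f).symm

variable [CompleteSpace E] {f : ℂ → E}

/-- Fubini with horizontal lines inside: each half line contributes minus the value at its end point
on the axis. -/
theorem integral_dx (hf : ∀ s, 0 ≤ s.re → ContDiffAt ℝ 1 f s) (hc : HasCompactSupport f) :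
    IntegrableOn (dx f) rightHalfPlane ∧
      ∫ s in rightHalfPlane, dx f s = -∫ y : ℝ, f (y * Complex.I) := by
  have hi : IntegrableOn (dx f) rightHalfPlane :=
    integrableOn_rightHalfPlane_of_continuousOn
      (fun s hs => (contDiffAt_dx (m := 0) (hf s hs) (by simp)).continuousAt)
      (hc.mono' ((subset_tsupport _).trans (tsupport_dx_subset f)))
  refine ⟨hi, ?_⟩
  have hi' := integrable_mk_iff.2 hi
  rw [setIntegral_rightHalfPlane, integral_prod_symm _ hi', ← integral_neg]
  refine integral_congr_ae ?_
  filter_upwards [hi'.prod_left_ae] with y hy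
  obtain ⟨M, hM, hM0⟩ := exists_forall_eq_zero_of_hasCompactSupport hc
  have h := integral_Ioi_of_hasDerivAt_of_tendsto (f := fun t : ℝ => f ⟨t, y⟩) (a := 0) (m := 0)
    (((hf ⟨0, y⟩ le_rfl).continuousAt.comp (f := fun t : ℝ => (⟨t, y⟩ : ℂ))
      (continuous_mk_left y).continuousAt).continuousWithinAt)
    (fun x hx => hasDerivAt_re_line ((hf ⟨x, y⟩ (le_of_lt hx)).differentiableAt one_ne_zero)) hy ?_
  · rw [h, zero_sub]
    congr 2
    rw [Complex.mk_eq_add_mul_I]; simp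
  · refine tendsto_const_nhds.congr' ?_
    filter_upwards [eventually_gt_atTop M] with x hx
    exact (hM0 _ (Or.inl (lt_of_lt_of_le hx (le_abs_self _)))).symm

/-- Vertical lines never leave the half plane, so compact support leaves no boundary term. -/
theorem integral_dy (hf : ∀ s, 0 ≤ s.re → ContDiffAt ℝ 1 f s) (hc : HasCompactSupport f) :
    IntegrableOn (dy f) rightHalfPlane ∧ ∫ s in rightHalfPlane, dy f s = 0 := by
  have hi : IntegrableOn (dy f) rightHalfPlane :=
    integrableOn_rightHalfPlane_of_continuousOn
      (fun s hs => (contDiffAt_dy (m := 0) (hf s hs) (by simp)).continuousAt)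
      (hc.mono' ((subset_tsupport _).trans (tsupport_dy_subset f)))
  refine ⟨hi, ?_⟩
  have hi' := integrable_mk_iff.2 hi
  rw [setIntegral_rightHalfPlane, integral_prod _ hi']
  refine integral_eq_zero_of_ae ?_
  filter_upwards [hi'.prod_right_ae, ae_restrict_mem measurableSet_Ioi] with x hx hx0
  obtain ⟨M, hM, hM0⟩ := exists_forall_eq_zero_of_hasCompactSupport hc
  have h := integral_of_hasDerivAt_of_tendsto (f := fun t : ℝ => f ⟨x, t⟩) (m := 0) (n := 0)
    (fun y => hasDerivAt_im_line ((hf ⟨x, y⟩ (le_of_lt hx0)).differentiableAt one_ne_zero)) hx ?_ ?_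
  · simpa using h
  · refine tendsto_const_nhds.congr' ?_
    filter_upwards [eventually_lt_atBot (-M)] with y hy
    exact (hM0 _ (Or.inr (lt_of_lt_of_le (by linarith) (neg_le_abs _)))).symm
  · refine tendsto_const_nhds.congr' ?_
    filter_upwards [eventually_gt_atTop M] with y hy
    exact (hM0 _ (Or.inr (lt_of_lt_of_le hy (le_abs_self _)))).symm

end HalfPlaneIntegrals
end BodeSensitivity

/-! ### Test functions and Green's formula -/

namespace BodeSensitivity

/-- Twice continuously differentiable functions with compact support that vanish on the
imaginary axis. -/
structure IsTest (φ : ℂ → ℝ) : Prop where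
  contDiff : ContDiff ℝ 2 φ
  hasCompactSupport : HasCompactSupport φ
  eq_zero : ∀ s : ℂ, s.re = 0 → φ s = 0

/-- Green's formula in the right half plane for a function `u` whose Laplacian has mass `2 π m`
against the test function `φ`. -/
structure GreenFormula (φ u : ℂ → ℝ) (m : ℝ) : Prop where
  integrableOn : IntegrableOn (fun s => u s * lap φ s) rightHalfPlane
  integrable_axis : Integrable fun y : ℝ => u (y * Complex.I) * dx φ (y * Complex.I)
  eq : ∫ s in rightHalfPlane, u s * lap φ s =
    2 * Real.pi * m - ∫ y : ℝ, u (y * Complex.I) * dx φ (y * Complex.I)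

lemma isClosedEmbedding_axis :
    IsClosedEmbedding fun y : ℝ => (y : ℂ) * Complex.I := by
  have h : Isometry fun y : ℝ => (y : ℂ) * Complex.I := by
    refine Isometry.of_dist_eq fun x y => ?_
    rw [dist_eq_norm, ← sub_mul, norm_mul, Complex.norm_I, mul_one, ← Complex.ofReal_sub,
      Complex.norm_real, dist_eq_norm]
  exact h.isClosedEmbedding

lemma re_axis (y : ℝ) : ((y : ℂ) * Complex.I).re = 0 := by simp

section Test

variable {φ : ℂ → ℝ}

lemma IsTest.contDiff_dx (h : IsTest φ) : ContDiff ℝ 1 (dx φ) :=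
  contDiff_iff_contDiffAt.2 fun _ => contDiffAt_dx h.contDiff.contDiffAt one_add_one_le_two

lemma IsTest.contDiff_dy (h : IsTest φ) : ContDiff ℝ 1 (dy φ) :=
  contDiff_iff_contDiffAt.2 fun _ => contDiffAt_dy h.contDiff.contDiffAt one_add_one_le_two

lemma continuousAt_lap {u : ℂ → ℝ} {s : ℂ} (h : ContDiffAt ℝ 2 u s) : ContinuousAt (lap u) s :=
  (contDiffAt_dx (m := 0) (contDiffAt_dx h one_add_one_le_two) (by simp)).continuousAt.add
    (contDiffAt_dy (m := 0) (contDiffAt_dy h one_add_one_le_two) (by simp)).continuousAt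

lemma IsTest.continuous_lap (h : IsTest φ) : Continuous (lap φ) :=
  continuous_iff_continuousAt.2 fun _ => continuousAt_lap h.contDiff.contDiffAt

lemma tsupport_lap_subset (φ : ℂ → ℝ) : tsupport (lap φ) ⊆ tsupport φ :=
  closure_minimal (fun s hs => by
    by_contra h; exact hs (lap_eq_zero_of_notMem_tsupport h)) (isClosed_tsupport φ)

lemma IsTest.hasCompactSupport_lap (h : IsTest φ) : HasCompactSupport (lap φ) :=
  h.hasCompactSupport.mono' ((subset_tsupport _).trans (tsupport_lap_subset φ))

lemma IsTest.hasCompactSupport_dx (h : IsTest φ) : HasCompactSupport (dx φ) :=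
  h.hasCompactSupport.mono' ((subset_tsupport _).trans (tsupport_dx_subset φ))

lemma IsTest.axis_continuous (h : IsTest φ) : Continuous fun y : ℝ => dx φ (y * Complex.I) :=
  h.contDiff_dx.continuous.comp isClosedEmbedding_axis.continuous

lemma IsTest.axis_hasCompactSupport (h : IsTest φ) :
    HasCompactSupport fun y : ℝ => dx φ (y * Complex.I) :=
  h.hasCompactSupport_dx.comp_isClosedEmbedding isClosedEmbedding_axis

lemma contDiffAt_mul_of_tsupport {u ψ : ℂ → ℝ} {s : ℂ} {n : WithTop ℕ∞}
    (hu : s ∈ tsupport φ → ContDiffAt ℝ n u s) (hψ : ContDiffAt ℝ n ψ s)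
    (h : tsupport ψ ⊆ tsupport φ) : ContDiffAt ℝ n (fun z => u z * ψ z) s := by
  by_cases hs : s ∈ tsupport φ
  · exact (hu hs).mul hψ
  · have h0 : (fun z => u z * ψ z) =ᶠ[𝓝 s] fun _ => 0 := by
      filter_upwards [(isClosed_tsupport φ).isOpen_compl.mem_nhds hs] with z hz
      rw [image_eq_zero_of_notMem_tsupport fun h' => hz (h h'), mul_zero]
    exact contDiffAt_const.congr_of_eventuallyEq h0

lemma integrable_axis_of_continuousAt (hφ : IsTest φ) {u : ℂ → ℝ}
    (hu : ∀ s ∈ tsupport φ, 0 ≤ s.re → ContinuousAt u s) :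
    Integrable fun y : ℝ => u (y * Complex.I) * dx φ (y * Complex.I) := by
  have hc : Continuous fun y : ℝ => u (y * Complex.I) * dx φ (y * Complex.I) := by
    refine continuous_iff_continuousAt.2 fun y => ?_
    by_cases hs : (y * Complex.I : ℂ) ∈ tsupport φ
    · exact ((hu _ hs (re_axis y).ge).comp (f := fun y : ℝ => (y : ℂ) * Complex.I)
        isClosedEmbedding_axis.continuous.continuousAt).mul hφ.axis_continuous.continuousAt
    · have h0 : (fun y : ℝ => u (y * Complex.I) * dx φ (y * Complex.I)) =ᶠ[𝓝 y] fun _ => 0 := by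
        filter_upwards [isClosedEmbedding_axis.continuous.continuousAt.preimage_mem_nhds
          ((isClosed_tsupport φ).isOpen_compl.mem_nhds hs)] with z hz
        rw [dx_eq_zero_of_notMem_tsupport hz, mul_zero]
      exact continuousAt_const.congr h0.symm
  exact hc.integrable_of_hasCompactSupport hφ.axis_hasCompactSupport.mul_left

/-- Green's second identity: `u * Δφ - Δu * φ` is the divergence of `u ∇φ - φ ∇u`. Of the flux
through the axis only `u * dx φ` remains, because `φ` vanishes there. -/
theorem integral_mul_lap_of_contDiffAt (hφ : IsTest φ) {u : ℂ → ℝ}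
    (hu : ∀ s ∈ tsupport φ, 0 ≤ s.re → ContDiffAt ℝ 2 u s) :
    IntegrableOn (fun s => u s * lap φ s) rightHalfPlane ∧
    IntegrableOn (fun s => lap u s * φ s) rightHalfPlane ∧
    ∫ s in rightHalfPlane, u s * lap φ s = (∫ s in rightHalfPlane, lap u s * φ s) -
      ∫ y : ℝ, u (y * Complex.I) * dx φ (y * Complex.I) := by
  have hu1 : ∀ s ∈ tsupport φ, 0 ≤ s.re → ContDiffAt ℝ 1 u s := fun s hs h0 =>
    (hu s hs h0).of_le one_le_two
  have hi1 : IntegrableOn (fun s => u s * lap φ s) rightHalfPlane := by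
    refine integrableOn_rightHalfPlane_of_continuousOn (fun s hs => ?_)
      hφ.hasCompactSupport_lap.mul_left
    exact (contDiffAt_mul_of_tsupport (n := 0) (fun h => (hu1 s h hs).of_le zero_le_one)
      (contDiffAt_zero.2 ⟨_, univ_mem, hφ.continuous_lap.continuousOn⟩)
      (tsupport_lap_subset φ)).continuousAt
  have hi2 : IntegrableOn (fun s => lap u s * φ s) rightHalfPlane := by
    refine integrableOn_rightHalfPlane_of_continuousOn (fun s hs => ?_)
      hφ.hasCompactSupport.mul_left
    by_cases h : s ∈ tsupport φ
    · exact (continuousAt_lap (hu s h hs)).mul hφ.contDiff.continuous.continuousAt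
    · refine continuousAt_const (y := (0 : ℝ)) |>.congr ?_
      filter_upwards [(isClosed_tsupport φ).isOpen_compl.mem_nhds h] with z hz
      rw [image_eq_zero_of_notMem_tsupport hz, mul_zero]
  refine ⟨hi1, hi2, ?_⟩
  have hdx : ∀ s, 0 ≤ s.re →
      ContDiffAt ℝ 1 (fun z => u z * dx φ z - dx u z * φ z) s := fun s hs =>
    (contDiffAt_mul_of_tsupport (fun h => hu1 s h hs) hφ.contDiff_dx.contDiffAt
      (tsupport_dx_subset φ)).sub
    (contDiffAt_mul_of_tsupport (fun h => contDiffAt_dx (hu s h hs) one_add_one_le_two)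
      (hφ.contDiff.of_le one_le_two).contDiffAt subset_rfl)
  have hdy : ∀ s, 0 ≤ s.re →
      ContDiffAt ℝ 1 (fun z => u z * dy φ z - dy u z * φ z) s := fun s hs =>
    (contDiffAt_mul_of_tsupport (fun h => hu1 s h hs) hφ.contDiff_dy.contDiffAt
      (tsupport_dy_subset φ)).sub
    (contDiffAt_mul_of_tsupport (fun h => contDiffAt_dy (hu s h hs) one_add_one_le_two)
      (hφ.contDiff.of_le one_le_two).contDiffAt subset_rfl)
  have hcx : HasCompactSupport (fun z => u z * dx φ z - dx u z * φ z) :=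
    hφ.hasCompactSupport.mono' fun z hz => by
      by_contra h
      exact hz (by simp [dx_eq_zero_of_notMem_tsupport h, image_eq_zero_of_notMem_tsupport h])
  have hcy : HasCompactSupport (fun z => u z * dy φ z - dy u z * φ z) :=
    hφ.hasCompactSupport.mono' fun z hz => by
      by_contra h
      exact hz (by simp [dy_eq_zero_of_notMem_tsupport h, image_eq_zero_of_notMem_tsupport h])
  obtain ⟨ix, ex⟩ := integral_dx hdx hcx
  obtain ⟨iy, ey⟩ := integral_dy hdy hcy
  have key : ∀ s ∈ rightHalfPlane, u s * lap φ s - lap u s * φ s =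
      dx (fun z => u z * dx φ z - dx u z * φ z) s +
      dy (fun z => u z * dy φ z - dy u z * φ z) s := by
    intro s hs
    by_cases h : s ∈ tsupport φ
    · have hs' := hu s h (le_of_lt hs)
      have d0 := (hs'.differentiableAt two_ne_zero).hasFDerivAt
      have d1 := ((contDiffAt_dx hs' one_add_one_le_two).differentiableAt one_ne_zero).hasFDerivAt
      have d2 := ((contDiffAt_dy hs' one_add_one_le_two).differentiableAt one_ne_zero).hasFDerivAt
      have f0 := (hφ.contDiff.differentiable two_ne_zero s).hasFDerivAt
      have f1 := (hφ.contDiff_dx.differentiable one_ne_zero s).hasFDerivAt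
      have f2 := (hφ.contDiff_dy.differentiable one_ne_zero s).hasFDerivAt
      have e1 := ((d0.mul f1).sub (d1.mul f0)).fderiv
      have e2 := ((d0.mul f2).sub (d2.mul f0)).fderiv
      have e1' : dx (fun z => u z * dx φ z - dx u z * φ z) s = _ :=
        congrArg (fun T : ℂ →L[ℝ] ℝ => T 1) e1
      have e2' : dy (fun z => u z * dy φ z - dy u z * φ z) s = _ :=
        congrArg (fun T : ℂ →L[ℝ] ℝ => T Complex.I) e2
      rw [e1', e2']
      simp only [lap, sub_apply, add_apply, smul_apply, smul_eq_mul]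
      simp only [dx, dy]
      ring
    · rw [lap_eq_zero_of_notMem_tsupport h, image_eq_zero_of_notMem_tsupport h]
      have h0 : ∀ᶠ z in 𝓝 s, z ∉ tsupport φ := (isClosed_tsupport φ).isOpen_compl.mem_nhds h
      have e1 : (fun z => u z * dx φ z - dx u z * φ z) =ᶠ[𝓝 s] fun _ => 0 := h0.mono fun z hz => by
        simp [dx_eq_zero_of_notMem_tsupport hz, image_eq_zero_of_notMem_tsupport hz]
      have e2 : (fun z => u z * dy φ z - dy u z * φ z) =ᶠ[𝓝 s] fun _ => 0 := h0.mono fun z hz => by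
        simp [dy_eq_zero_of_notMem_tsupport hz, image_eq_zero_of_notMem_tsupport hz]
      rw [(dx_congr e1).eq_of_nhds, (dy_congr e2).eq_of_nhds]
      simp [dx, dy]
  have e := setIntegral_congr_fun (μ := volume) measurableSet_rightHalfPlane key
  rw [integral_sub hi1 hi2, integral_add ix iy, ex, ey] at e
  have e3 : ∫ y : ℝ, (u (y * Complex.I) * dx φ (y * Complex.I) -
      dx u (y * Complex.I) * φ (y * Complex.I)) =
      ∫ y : ℝ, u (y * Complex.I) * dx φ (y * Complex.I) := by
    congr 1; ext y; rw [hφ.eq_zero _ (re_axis y)]; ring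
  rw [e3] at e
  linarith

lemma lap_eq_laplacian {u : ℂ → ℝ} {s : ℂ} (h : ContDiffAt ℝ 2 u s) :
    lap u s = Laplacian.laplacian u s := by
  have h1 : DifferentiableAt ℝ (fderiv ℝ u) s :=
    (h.fderiv_right one_add_one_le_two).differentiableAt one_ne_zero
  have e (v : ℂ) : fderiv ℝ (fun z => fderiv ℝ u z v) s v = fderiv ℝ (fderiv ℝ u) s v v := by
    rw [fderiv_clm_apply h1 (differentiableAt_const v)]; simp
  rw [InnerProductSpace.laplacian_eq_iteratedFDeriv_complexPlane]
  simp only [iteratedFDeriv_two_apply, Matrix.cons_val_zero, Matrix.cons_val_one]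
  rw [← e, ← e]; rfl

/-- The logarithm of the modulus of a zero-free holomorphic function is harmonic, so the mass is
zero. -/
theorem GreenFormula.log_norm_of_analyticAt (hφ : IsTest φ) {h : ℂ → ℂ}
    (hh : ∀ s ∈ tsupport φ, 0 ≤ s.re → AnalyticAt ℂ h s ∧ h s ≠ 0) :
    GreenFormula φ (fun s => Real.log ‖h s‖) 0 := by
  have harm : ∀ s ∈ tsupport φ, 0 ≤ s.re →
      InnerProductSpace.HarmonicAt (fun s => Real.log ‖h s‖) s :=
    fun s hs h0 => (hh s hs h0).1.harmonicAt_log_norm (hh s hs h0).2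
  obtain ⟨h1, h2, h3⟩ := integral_mul_lap_of_contDiffAt hφ fun s hs h0 => (harm s hs h0).1
  refine ⟨h1, integrable_axis_of_continuousAt hφ
    fun s hs h0 => (harm s hs h0).1.continuousAt, ?_⟩
  rw [h3]
  have : ∫ s in rightHalfPlane, lap (fun s => Real.log ‖h s‖) s * φ s = 0 := by
    refine setIntegral_eq_zero_of_forall_eq_zero fun s hs => ?_
    by_cases hsφ : s ∈ tsupport φ
    · have := harm s hsφ (le_of_lt hs)
      rw [lap_eq_laplacian this.1, this.2.eq_of_nhds]; simp
    · rw [image_eq_zero_of_notMem_tsupport hsφ, mul_zero]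
  rw [this]; ring

lemma GreenFormula.add {u v : ℂ → ℝ} {m n : ℝ} (hu : GreenFormula φ u m)
    (hv : GreenFormula φ v n) : GreenFormula φ (fun s => u s + v s) (m + n) := by
  refine ⟨?_, ?_, ?_⟩
  · simp only [add_mul]; exact hu.integrableOn.add hv.integrableOn
  · simp only [add_mul]; exact hu.integrable_axis.add hv.integrable_axis
  · simp only [add_mul]
    rw [integral_add hu.integrableOn hv.integrableOn,
      integral_add hu.integrable_axis hv.integrable_axis, hu.eq, hv.eq]
    ring

lemma GreenFormula.const_mul {u : ℂ → ℝ} {m : ℝ} (c : ℝ) (hu : GreenFormula φ u m) :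
    GreenFormula φ (fun s => c * u s) (c * m) := by
  refine ⟨?_, ?_, ?_⟩
  · simp only [mul_assoc]; exact hu.integrableOn.const_mul c
  · simp only [mul_assoc]; exact hu.integrable_axis.const_mul c
  · simp only [mul_assoc]
    rw [integral_const_mul, integral_const_mul, hu.eq]
    ring

lemma GreenFormula.sum {κ : Type*} {u : κ → ℂ → ℝ} {m : κ → ℝ} (J : Finset κ)
    (h : ∀ j ∈ J, GreenFormula φ (u j) (m j)) :
    GreenFormula φ (fun s => ∑ j ∈ J, u j s) (∑ j ∈ J, m j) := by
  classical
  induction J using Finset.induction_on with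
  | empty => exact ⟨by simp, by simp, by simp⟩
  | insert a J ha ih =>
    simp only [Finset.sum_insert ha]
    exact (h a (Finset.mem_insert_self _ _)).add
      (ih fun j hj => h j (Finset.mem_insert_of_mem hj))

/-- A finite set is null both in the plane and on the axis. This absorbs the zeros, where `Real.log
0 = 0` breaks the additive formulas. -/
lemma GreenFormula.congr {u v : ℂ → ℝ} {m : ℝ} (hu : GreenFormula φ u m) {T : Set ℂ}
    (hT : T.Finite) (h : ∀ s ∈ tsupport φ, 0 ≤ s.re → s ∉ T → u s = v s) :
    GreenFormula φ v m := by
  have e1 : (fun s => u s * lap φ s) =ᵐ[volume.restrict rightHalfPlane]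
      fun s => v s * lap φ s := by
    filter_upwards [ae_restrict_mem measurableSet_rightHalfPlane,
      ae_restrict_of_ae (hT.countable.ae_notMem volume)] with s hs hsT
    by_cases hsφ : s ∈ tsupport φ
    · rw [h s hsφ (le_of_lt hs) hsT]
    · rw [lap_eq_zero_of_notMem_tsupport hsφ, mul_zero, mul_zero]
  have e2 : (fun y : ℝ => u (y * Complex.I) * dx φ (y * Complex.I)) =ᵐ[volume]
      fun y : ℝ => v (y * Complex.I) * dx φ (y * Complex.I) := by
    have hT' := (hT.preimage (isClosedEmbedding_axis.injective.injOn)).countable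
    filter_upwards [hT'.ae_notMem volume] with y hy
    by_cases hsφ : (y * Complex.I : ℂ) ∈ tsupport φ
    · rw [h _ hsφ (re_axis y).ge hy]
    · rw [dx_eq_zero_of_notMem_tsupport hsφ, mul_zero, mul_zero]
  exact ⟨hu.integrableOn.congr_fun_ae e1, hu.integrable_axis.congr e2,
    by rw [← integral_congr_ae e1, ← integral_congr_ae e2, hu.eq]⟩

end Test
end BodeSensitivity

/-! ### The logarithmic potential of a point -/

namespace BodeSensitivity

section LogarithmicPotential

lemma locallyIntegrable_log_sub (b : ℝ) : LocallyIntegrable fun y : ℝ => Real.log (y - b) := by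
  refine locallyIntegrable_iff.2 fun K hK => ?_
  obtain ⟨M, hM⟩ := hK.isBounded.subset_closedBall 0
  rw [Real.closedBall_eq_Icc] at hM
  rcases le_or_gt (0 - M) (0 + M) with h | h
  · have := (intervalIntegral.intervalIntegrable_log' (a := 0 - M - b) (b := 0 + M - b)).comp_sub_right b
    simp only [sub_add_cancel] at this
    exact ((intervalIntegrable_iff_integrableOn_Icc_of_le h).1 this).mono_set hM
  · rw [Set.Icc_eq_empty (not_le.2 h), Set.subset_empty_iff] at hM
    simp [hM]

lemma locallyIntegrable_log_im_sub (b : ℝ) :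
    LocallyIntegrable fun s : ℂ => Real.log (s.im - b) := by
  refine locallyIntegrable_iff.2 fun K hK => ?_
  obtain ⟨M, hM⟩ := hK.isBounded.subset_closedBall 0
  have h1 : K ⊆ Complex.measurableEquivRealProd ⁻¹' (Set.Icc (-M) M ×ˢ Set.Icc (-M) M) := by
    intro s hs
    have h2 : ‖s‖ ≤ M := by simpa using hM hs
    have := abs_le.1 ((Complex.abs_re_le_norm s).trans h2)
    have := abs_le.1 ((Complex.abs_im_le_norm s).trans h2)
    simp_all [Complex.measurableEquivRealProd_apply]
  refine IntegrableOn.mono_set ?_ h1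
  have h2 := (Complex.volume_preserving_equiv_real_prod.integrableOn_comp_preimage
    Complex.measurableEquivRealProd.measurableEmbedding
    (f := fun p : ℝ × ℝ => Real.log (p.2 - b)) (s := Set.Icc (-M) M ×ˢ Set.Icc (-M) M))
  refine h2.2 ?_
  rw [IntegrableOn, Measure.volume_eq_prod, ← Measure.prod_restrict]
  have h3 : IntegrableOn (fun y : ℝ => Real.log (y - b)) (Set.Icc (-M) M) :=
    (locallyIntegrable_log_sub b).integrableOn_isCompact isCompact_Icc
  exact h3.integrable.comp_snd _

/-- A locally integrable majorant of `log ‖s - a‖`. -/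
noncomputable def logMajorant (a s : ℂ) : ℝ := |Real.log (s.im - a.im)| + ‖s - a‖ ^ 2 + 1

lemma locallyIntegrable_logMajorant (a : ℂ) : LocallyIntegrable (logMajorant a) := by
  have h1 : LocallyIntegrable fun s : ℂ => |Real.log (s.im - a.im)| :=
    (locallyIntegrable_log_im_sub a.im).mono
      (by apply Measurable.aestronglyMeasurable; fun_prop) (ae_of_all _ fun s => by simp)
  have h2 : LocallyIntegrable fun s : ℂ => ‖s - a‖ ^ 2 + 1 := Continuous.locallyIntegrable (by fun_prop)
  refine (h1.add h2).congr (ae_of_all _ fun s => ?_)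
  simp [logMajorant, add_assoc]

lemma locallyIntegrable_logMajorant_axis (a : ℂ) :
    LocallyIntegrable fun y : ℝ => logMajorant a (y * Complex.I) := by
  have h1 : LocallyIntegrable fun y : ℝ => |Real.log (y - a.im)| :=
    (locallyIntegrable_log_sub a.im).mono
      (by apply Measurable.aestronglyMeasurable; fun_prop) (ae_of_all _ fun s => by simp)
  have h2 : LocallyIntegrable fun y : ℝ => ‖(y : ℂ) * Complex.I - a‖ ^ 2 + 1 :=
    Continuous.locallyIntegrable (by fun_prop)
  refine (h1.add h2).congr (ae_of_all _ fun s => ?_)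
  simp [logMajorant, add_assoc]

/-- Smooth approximations of `log ‖s - a‖`. -/
noncomputable def smoothLog (a : ℂ) (t : ℝ) (s : ℂ) : ℝ := Real.log (‖s - a‖ ^ 2 + t) / 2

/-- From below, `‖s - a‖ ≥ |s.im - a.im|` reduces the singularity to a one-variable logarithm, which
is locally integrable in the plane and along the axis alike. From above, `log x ≤ x - 1`. The bound
is uniform in `t` and includes `t = 0`, the potential itself. -/
lemma abs_smoothLog_le {a s : ℂ} (hs : s.im ≠ a.im) {t : ℝ} (h0 : 0 ≤ t) (h1 : t ≤ 1) :
    |smoothLog a t s| ≤ logMajorant a s := by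
  have hn : 0 < |s.im - a.im| := abs_pos.2 (sub_ne_zero.2 hs)
  have hle : |s.im - a.im| ≤ ‖s - a‖ := by simpa using Complex.abs_im_le_norm (s - a)
  have hpos : 0 < ‖s - a‖ ^ 2 + t := by have := hn.trans_le hle; positivity
  have hsq : 0 ≤ ‖s - a‖ ^ 2 := sq_nonneg _
  have hl : 0 ≤ |Real.log (s.im - a.im)| := abs_nonneg _
  rw [smoothLog, logMajorant, abs_le]
  constructor
  · have h2 : Real.log (|s.im - a.im| ^ 2) ≤ Real.log (‖s - a‖ ^ 2 + t) :=
      Real.log_le_log (by positivity) (by nlinarith [pow_le_pow_left₀ hn.le hle 2])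
    rw [Real.log_pow, Real.log_abs] at h2
    have := neg_abs_le (Real.log (s.im - a.im))
    push_cast at h2
    linarith
  · have := Real.log_le_sub_one_of_pos hpos
    linarith

lemma smoothLog_zero (a s : ℂ) : smoothLog a 0 s = Real.log ‖s - a‖ := by
  rw [smoothLog, add_zero, Real.log_pow]; push_cast; ring

lemma ae_im_ne (b : ℝ) : ∀ᵐ s : ℂ, s.im ≠ b := by
  have h : ∀ᵐ p : ℝ × ℝ, p.2 ≠ b := by
    rw [Measure.volume_eq_prod]
    exact Measure.quasiMeasurePreserving_snd.ae (Measure.ae_ne volume b)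
  exact Complex.volume_preserving_equiv_real_prod.quasiMeasurePreserving.ae h

lemma tendsto_smoothLog {a s : ℂ} (hs : s ≠ a) :
    Tendsto (fun c : ℝ => smoothLog a ((c ^ 2)⁻¹) s) atTop (𝓝 (Real.log ‖s - a‖)) := by
  rw [← smoothLog_zero]
  have h1 : Tendsto (fun c : ℝ => (c ^ 2)⁻¹) atTop (𝓝 0) :=
    tendsto_inv_atTop_zero.comp (tendsto_pow_atTop two_ne_zero)
  have h2 : ContinuousAt (fun t => smoothLog a t s) 0 := by
    unfold smoothLog
    refine (ContinuousAt.log (by fun_prop) ?_).div_const 2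
    have : 0 < ‖s - a‖ := norm_pos_iff.2 (sub_ne_zero.2 hs)
    positivity
  exact h2.tendsto.comp h1

lemma locallyIntegrable_log_norm_sub (a : ℂ) :
    LocallyIntegrable fun s : ℂ => Real.log ‖s - a‖ := by
  refine (locallyIntegrable_logMajorant a).mono
    (by apply Measurable.aestronglyMeasurable; fun_prop) ?_
  filter_upwards [ae_im_ne a.im] with s hs
  rw [← smoothLog_zero]
  exact (abs_smoothLog_le hs le_rfl zero_le_one).trans (le_abs_self _)

lemma locallyIntegrable_log_norm_sub_axis (a : ℂ) :
    LocallyIntegrable fun y : ℝ => Real.log ‖(y : ℂ) * Complex.I - a‖ := by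
  refine (locallyIntegrable_logMajorant_axis a).mono
    (by apply Measurable.aestronglyMeasurable; fun_prop) ?_
  filter_upwards [Measure.ae_ne volume a.im] with y hy
  rw [← smoothLog_zero]
  exact (abs_smoothLog_le (by simpa using hy) le_rfl zero_le_one).trans (le_abs_self _)

lemma norm_sq_eq_mk (a : ℂ) (x y : ℝ) :
    ‖(⟨x, y⟩ : ℂ) - a‖ ^ 2 = (x - a.re) ^ 2 + (y - a.im) ^ 2 := by
  rw [Complex.sq_norm, Complex.normSq_apply]; simp; ring

lemma contDiff_smoothLog (a : ℂ) {t : ℝ} (ht : 0 < t) : ContDiff ℝ 3 (smoothLog a t) := by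
  unfold smoothLog
  refine (ContDiff.log ?_ fun s => by positivity).div_const 2
  exact ((contDiff_id.sub contDiff_const).norm_sq ℝ).add contDiff_const

lemma dx_eq_of_hasDerivAt {f : ℂ → ℝ} {s : ℂ} {d : ℝ} (hf : DifferentiableAt ℝ f s)
    (h : HasDerivAt (fun t : ℝ => f ⟨t, s.im⟩) d s.re) : dx f s = d :=
  (hasDerivAt_re_line (x := s.re) (y := s.im) hf).unique h

lemma dy_eq_of_hasDerivAt {f : ℂ → ℝ} {s : ℂ} {d : ℝ} (hf : DifferentiableAt ℝ f s)
    (h : HasDerivAt (fun t : ℝ => f ⟨s.re, t⟩) d s.im) : dy f s = d :=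
  (hasDerivAt_im_line (x := s.re) (y := s.im) hf).unique h

/-- With `t = c⁻²` this is `2π c² ψ(c (s - a))` for `ψ s = π⁻¹ / (1 + ‖s‖ ^ 2) ^ 2`: an approximate
identity at `a`, up to the factor `2π`. -/
lemma lap_smoothLog (a : ℂ) {t : ℝ} (ht : 0 < t) (s : ℂ) :
    lap (smoothLog a t) s = 2 * t / (‖s - a‖ ^ 2 + t) ^ 2 := by
  have hc := contDiff_smoothLog a ht
  have hpos (s : ℂ) : (s.re - a.re) ^ 2 + (s.im - a.im) ^ 2 + t ≠ 0 := by positivity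
  have ex : dx (smoothLog a t) =
      fun s => (s.re - a.re) / ((s.re - a.re) ^ 2 + (s.im - a.im) ^ 2 + t) := by
    ext s
    refine dx_eq_of_hasDerivAt (hc.differentiable (by norm_num) s) ?_
    simp only [smoothLog, norm_sq_eq_mk]
    have h1 : HasDerivAt (fun x : ℝ => (x - a.re) ^ 2 + (s.im - a.im) ^ 2 + t)
        (2 * (s.re - a.re)) s.re := by
      simpa using ((((hasDerivAt_id s.re).sub_const a.re).pow 2).add_const ((s.im - a.im) ^ 2)).add_const t
    convert! (h1.log (hpos s)).div_const 2 using 1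
    ring
  have ey : dy (smoothLog a t) =
      fun s => (s.im - a.im) / ((s.re - a.re) ^ 2 + (s.im - a.im) ^ 2 + t) := by
    ext s
    refine dy_eq_of_hasDerivAt (hc.differentiable (by norm_num) s) ?_
    simp only [smoothLog, norm_sq_eq_mk]
    have h1 : HasDerivAt (fun x : ℝ => (s.re - a.re) ^ 2 + (x - a.im) ^ 2 + t)
        (2 * (s.im - a.im)) s.im := by
      simpa using ((((hasDerivAt_id s.im).sub_const a.im).pow 2).const_add ((s.re - a.re) ^ 2)).add_const t
    convert! (h1.log (hpos s)).div_const 2 using 1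
    ring
  have hdx : DifferentiableAt ℝ (dx (smoothLog a t)) s :=
    (contDiffAt_dx (m := 2) hc.contDiffAt (by norm_num)).differentiableAt two_ne_zero
  have hdy : DifferentiableAt ℝ (dy (smoothLog a t)) s :=
    (contDiffAt_dy (m := 2) hc.contDiffAt (by norm_num)).differentiableAt two_ne_zero
  have e1 : dx (dx (smoothLog a t)) s =
      (1 * ((s.re - a.re) ^ 2 + (s.im - a.im) ^ 2 + t) - (s.re - a.re) * (2 * (s.re - a.re))) /
        ((s.re - a.re) ^ 2 + (s.im - a.im) ^ 2 + t) ^ 2 := by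
    refine dx_eq_of_hasDerivAt hdx ?_
    simp only [ex]
    have h1 : HasDerivAt (fun x : ℝ => (x - a.re) ^ 2 + (s.im - a.im) ^ 2 + t)
        (2 * (s.re - a.re)) s.re := by
      simpa using ((((hasDerivAt_id s.re).sub_const a.re).pow 2).add_const ((s.im - a.im) ^ 2)).add_const t
    exact ((hasDerivAt_id s.re).sub_const a.re).div h1 (hpos s)
  have e2 : dy (dy (smoothLog a t)) s =
      (1 * ((s.re - a.re) ^ 2 + (s.im - a.im) ^ 2 + t) - (s.im - a.im) * (2 * (s.im - a.im))) /
        ((s.re - a.re) ^ 2 + (s.im - a.im) ^ 2 + t) ^ 2 := by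
    refine dy_eq_of_hasDerivAt hdy ?_
    simp only [ey]
    have h1 : HasDerivAt (fun x : ℝ => (s.re - a.re) ^ 2 + (x - a.im) ^ 2 + t)
        (2 * (s.im - a.im)) s.im := by
      simpa using ((((hasDerivAt_id s.im).sub_const a.im).pow 2).const_add ((s.re - a.re) ^ 2)).add_const t
    exact ((hasDerivAt_id s.im).sub_const a.im).div h1 (hpos s)
  have e3 := norm_sq_eq_mk a s.re s.im
  rw [lap, e1, e2, e3, ← add_div]
  congr 1
  ring

lemma integral_inv_one_add_norm_sq_sq :
    ∫ s : ℂ, Real.pi⁻¹ / (1 + ‖s‖ ^ 2) ^ 2 = 1 := by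
  have h := integral_fun_norm_addHaar (volume : Measure ℂ)
    (fun r : ℝ => Real.pi⁻¹ / (1 + r ^ 2) ^ 2)
  rw [h]
  have h2 : ∫ y in Set.Ioi (0 : ℝ), y ^ (Module.finrank ℝ ℂ - 1) • (Real.pi⁻¹ / (1 + y ^ 2) ^ 2) =
      0 - -(Real.pi⁻¹ / 2 / (1 + 0 ^ 2)) := by
    refine integral_Ioi_of_hasDerivAt_of_nonneg' (g := fun y : ℝ => -(Real.pi⁻¹ / 2 / (1 + y ^ 2)))
      (fun y _ => ?_) (fun y hy => ?_) ?_
    · have h3 : HasDerivAt (fun y : ℝ => 1 + y ^ 2) (2 * y) y := by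
        simpa using ((hasDerivAt_id y).pow 2).const_add 1
      convert! ((hasDerivAt_const y (Real.pi⁻¹ / 2)).div h3 (by positivity)).neg using 1
      simp only [Complex.finrank_real_complex, smul_eq_mul]
      field_simp
      ring
    · have : (0 : ℝ) < y := hy
      simp only [Complex.finrank_real_complex, smul_eq_mul]
      positivity
    · rw [← neg_zero]
      refine Tendsto.neg (Tendsto.div_atTop tendsto_const_nhds ?_)
      exact tendsto_atTop_add_const_left _ _ (tendsto_pow_atTop two_ne_zero)
  rw [h2]
  simp [Measure.real, Complex.volume_ball, Complex.finrank_real_complex]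
  field_simp

lemma tendsto_norm_sq_mul_inv :
    Tendsto (fun s : ℂ => ‖s‖ ^ Module.finrank ℝ ℂ * (Real.pi⁻¹ / (1 + ‖s‖ ^ 2) ^ 2))
      (Bornology.cobounded ℂ) (𝓝 0) := by
  have h1 : Tendsto (fun s : ℂ => Real.pi⁻¹ / (1 + ‖s‖ ^ 2)) (Bornology.cobounded ℂ) (𝓝 0) :=
    Tendsto.div_atTop tendsto_const_nhds (tendsto_atTop_add_const_left _ _
      ((tendsto_pow_atTop two_ne_zero).comp tendsto_norm_cobounded_atTop))
  refine squeeze_zero (fun s => by positivity) (fun s => ?_) h1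
  rw [Complex.finrank_real_complex, mul_div_assoc', div_le_div_iff₀ (by positivity) (by positivity)]
  have := Real.pi_pos
  have h3 : 0 < Real.pi⁻¹ := by positivity
  nlinarith [mul_nonneg h3.le (sq_nonneg ‖s‖), mul_nonneg h3.le (sq_nonneg (‖s‖^2))]

/-- Green's identity for `smoothLog`, in the limit. The indicator makes the formula valid for every
`a`; points on the axis or to its left carry no mass. -/
theorem GreenFormula.log_norm_sub {φ : ℂ → ℝ} (hφ : IsTest φ) (a : ℂ) :
    GreenFormula φ (fun s => Real.log ‖s - a‖) (rightHalfPlane.indicator φ a) := by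
  have h1 : IntegrableOn (fun s => Real.log ‖s - a‖ * lap φ s) rightHalfPlane :=
    ((locallyIntegrable_log_norm_sub a).integrable_smul_right_of_hasCompactSupport
      hφ.continuous_lap hφ.hasCompactSupport_lap).integrableOn
  have h2 : Integrable fun y : ℝ =>
      Real.log ‖(y : ℂ) * Complex.I - a‖ * dx φ (y * Complex.I) :=
    (locallyIntegrable_log_norm_sub_axis a).integrable_smul_right_of_hasCompactSupport
      hφ.axis_continuous hφ.axis_hasCompactSupport
  have b1 : IntegrableOn (fun s => logMajorant a s * |lap φ s|) rightHalfPlane :=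
    ((locallyIntegrable_logMajorant a).integrable_smul_right_of_hasCompactSupport
      hφ.continuous_lap.norm hφ.hasCompactSupport_lap.norm).integrableOn
  have b2 : Integrable fun y : ℝ => logMajorant a (y * Complex.I) * |dx φ (y * Complex.I)| :=
    (locallyIntegrable_logMajorant_axis a).integrable_smul_right_of_hasCompactSupport
      hφ.axis_continuous.norm hφ.axis_hasCompactSupport.norm
  refine ⟨h1, h2, ?_⟩
  have hsmall : ∀ᶠ c : ℝ in atTop, 0 < c ∧ 0 < (c ^ 2)⁻¹ ∧ (c ^ 2)⁻¹ ≤ 1 := by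
    filter_upwards [eventually_ge_atTop 1] with c hc
    have : 1 ≤ c ^ 2 := one_le_pow₀ hc
    exact ⟨by linarith, by positivity, inv_le_one_of_one_le₀ this⟩
  have t1 : Tendsto (fun c : ℝ => ∫ s in rightHalfPlane, smoothLog a ((c ^ 2)⁻¹) s * lap φ s) atTop
      (𝓝 (∫ s in rightHalfPlane, Real.log ‖s - a‖ * lap φ s)) := by
    refine tendsto_integral_filter_of_dominated_convergence _ ?_ ?_ b1 ?_
    · filter_upwards [hsmall] with c hc
      exact ((contDiff_smoothLog a hc.2.1).continuous.mul
        hφ.continuous_lap).aestronglyMeasurable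
    · filter_upwards [hsmall] with c hc
      filter_upwards [ae_restrict_of_ae (ae_im_ne a.im)] with s hs
      rw [norm_mul]
      exact mul_le_mul_of_nonneg_right (abs_smoothLog_le hs hc.2.1.le hc.2.2) (norm_nonneg _)
    · filter_upwards [ae_restrict_of_ae (ae_im_ne a.im)] with s hs
      exact (tendsto_smoothLog (fun h => hs (by rw [h]))).mul_const _
  have t2 : Tendsto (fun c : ℝ => ∫ y : ℝ, smoothLog a ((c ^ 2)⁻¹) (y * Complex.I) *
      dx φ (y * Complex.I)) atTop
      (𝓝 (∫ y : ℝ, Real.log ‖(y : ℂ) * Complex.I - a‖ * dx φ (y * Complex.I))) := by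
    refine tendsto_integral_filter_of_dominated_convergence _ ?_ ?_ b2 ?_
    · filter_upwards [hsmall] with c hc
      exact (((contDiff_smoothLog a hc.2.1).continuous.comp
        isClosedEmbedding_axis.continuous).mul hφ.axis_continuous).aestronglyMeasurable
    · filter_upwards [hsmall] with c hc
      filter_upwards [Measure.ae_ne volume a.im] with y hy
      rw [norm_mul]
      exact mul_le_mul_of_nonneg_right (abs_smoothLog_le (by simpa using hy) hc.2.1.le hc.2.2)
        (norm_nonneg _)
    · filter_upwards [Measure.ae_ne volume a.im] with y hy
      exact (tendsto_smoothLog (fun h => hy (by rw [← h]; simp))).mul_const _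
  -- Cutting `φ` off at the axis keeps it continuous because it vanishes there. Hence the
  -- approximate identity has a limit even for `a` on the axis, with no half masses.
  have hcont : Continuous (rightHalfPlane.indicator φ) := by
    refine hφ.contDiff.continuous.indicator fun s hs => hφ.eq_zero s ?_
    have := frontier_lt_subset_eq continuous_const Complex.continuous_re hs
    exact this.symm
  have hcs : HasCompactSupport (rightHalfPlane.indicator φ) :=
    hφ.hasCompactSupport.mono (Set.support_indicator.trans_subset Set.inter_subset_right)
  have t3 : Tendsto (fun c : ℝ => ∫ s in rightHalfPlane, lap (smoothLog a ((c ^ 2)⁻¹)) s * φ s)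
      atTop (𝓝 (2 * Real.pi * rightHalfPlane.indicator φ a)) := by
    have h := (tendsto_integral_comp_smul_smul_of_integrable' (μ := (volume : Measure ℂ))
      (φ := fun s : ℂ => Real.pi⁻¹ / (1 + ‖s‖ ^ 2) ^ 2) (fun s => by positivity)
      integral_inv_one_add_norm_sq_sq tendsto_norm_sq_mul_inv
      (hcont.integrable_of_hasCompactSupport hcs) (hcont.continuousAt (x := a))).const_mul
        (2 * Real.pi)
    refine h.congr' ?_
    filter_upwards [hsmall] with c hc
    rw [← integral_const_mul, ← integral_indicator measurableSet_rightHalfPlane]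
    congr 1
    ext s
    by_cases hs : s ∈ rightHalfPlane
    · rw [Set.indicator_of_mem hs, Set.indicator_of_mem hs, lap_smoothLog a hc.2.1, norm_smul,
        Complex.finrank_real_complex, norm_sub_rev a s]
      have := hc.1
      simp only [smul_eq_mul, Real.norm_eq_abs, mul_pow, sq_abs]
      have := Real.pi_pos
      field_simp
      ring
    · rw [Set.indicator_of_notMem hs, Set.indicator_of_notMem hs, smul_zero, mul_zero]
  refine tendsto_nhds_unique t1 ((t3.sub t2).congr' ?_)
  filter_upwards [hsmall] with c hc
  exact (integral_mul_lap_of_contDiffAt hφ fun s _ _ =>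
    ((contDiff_smoothLog a hc.2.1).of_le (by norm_num)).contDiffAt).2.2.symm

end LogarithmicPotential
end BodeSensitivity

/-! ### Uniformly convergent sums and logarithms of infinite products -/

namespace BodeSensitivity

section UniformSums

variable {φ : ℂ → ℝ}

lemma integrable_of_continuousOn_support (hφ : IsTest φ) {v : ℂ → ℝ}
    (hv : ContinuousOn v (tsupport φ ∩ {s : ℂ | 0 ≤ s.re})) :
    IntegrableOn (fun s => v s * lap φ s) rightHalfPlane ∧
      Integrable fun y : ℝ => v (y * Complex.I) * dx φ (y * Complex.I) := by
  have hK : IsCompact (tsupport φ ∩ {s : ℂ | 0 ≤ s.re}) :=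
    hφ.hasCompactSupport.inter_right (isClosed_le continuous_const Complex.continuous_re)
  constructor
  · have h1 : IntegrableOn (fun s => v s * lap φ s) (tsupport φ ∩ {s : ℂ | 0 ≤ s.re}) :=
      (hv.mul hφ.continuous_lap.continuousOn).integrableOn_compact hK
    refine h1.of_forall_sdiff_eq_zero measurableSet_rightHalfPlane fun s hs => ?_
    have h3 : s ∉ tsupport φ := fun h => hs.2 ⟨h, (show 0 < s.re from hs.1).le⟩
    rw [lap_eq_zero_of_notMem_tsupport h3, mul_zero]
  · have hK' := isClosedEmbedding_axis.isCompact_preimage hK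
    have h1 : IntegrableOn (fun y : ℝ => v (y * Complex.I) * dx φ (y * Complex.I))
        ((fun y : ℝ => (y : ℂ) * Complex.I) ⁻¹' (tsupport φ ∩ {s : ℂ | 0 ≤ s.re})) := by
      refine ContinuousOn.integrableOn_compact hK' ?_
      exact (hv.comp isClosedEmbedding_axis.continuous.continuousOn fun y hy => hy).mul
        hφ.axis_continuous.continuousOn
    refine (integrableOn_iff_integrable_of_support_subset fun y hy => ?_).1 h1
    refine ⟨?_, (re_axis y).ge⟩
    by_contra h
    exact hy (by simp only [dx_eq_zero_of_notMem_tsupport h, mul_zero])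

/-- Both integrals may be summed term by term, since `b j` times the integral of `|lap φ|`, or of
`|dx φ|` on the axis, is a summable bound. -/
theorem GreenFormula.tsum {κ : Type*} [Countable κ] (hφ : IsTest φ) {u : κ → ℂ → ℝ} {b : κ → ℝ}
    (hb : Summable b) (hub : ∀ j, ∀ s ∈ tsupport φ, 0 ≤ s.re → |u j s| ≤ b j)
    (hu : ∀ j, GreenFormula φ (u j) 0)
    (hc : ContinuousOn (fun s => ∑' j, u j s) (tsupport φ ∩ {s : ℂ | 0 ≤ s.re})) :
    GreenFormula φ (fun s => ∑' j, u j s) 0 := by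
  obtain ⟨i1, i2⟩ := integrable_of_continuousOn_support hφ hc
  refine ⟨i1, i2, ?_⟩
  have l1 : Integrable (lap φ) := hφ.continuous_lap.integrable_of_hasCompactSupport
    hφ.hasCompactSupport_lap
  have l2 : Integrable fun y : ℝ => dx φ (y * Complex.I) :=
    hφ.axis_continuous.integrable_of_hasCompactSupport hφ.axis_hasCompactSupport
  have s1 : HasSum (fun j => ∫ s in rightHalfPlane, u j s * lap φ s)
      (∫ s in rightHalfPlane, ∑' j, u j s * lap φ s) := by
    refine hasSum_integral_of_summable_integral_norm (fun j => (hu j).integrableOn) ?_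
    refine Summable.of_nonneg_of_le (fun j => integral_nonneg fun s => norm_nonneg _)
      (fun j => ?_) (hb.mul_right (∫ s in rightHalfPlane, |lap φ s|))
    rw [← integral_const_mul]
    refine setIntegral_mono_on (hu j).integrableOn.norm (l1.abs.const_mul _).integrableOn
      measurableSet_rightHalfPlane fun s hs => ?_
    rw [norm_mul]
    by_cases h : s ∈ tsupport φ
    · exact mul_le_mul_of_nonneg_right (hub j s h (le_of_lt hs)) (norm_nonneg _)
    · simp [lap_eq_zero_of_notMem_tsupport h]
  have s2 : HasSum (fun j => ∫ y : ℝ, u j (y * Complex.I) * dx φ (y * Complex.I))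
      (∫ y : ℝ, ∑' j, u j (y * Complex.I) * dx φ (y * Complex.I)) := by
    refine hasSum_integral_of_summable_integral_norm (fun j => (hu j).integrable_axis) ?_
    refine Summable.of_nonneg_of_le (fun j => integral_nonneg fun s => norm_nonneg _)
      (fun j => ?_) (hb.mul_right (∫ y : ℝ, |dx φ (y * Complex.I)|))
    rw [← integral_const_mul]
    refine integral_mono (hu j).integrable_axis.norm (l2.abs.const_mul _) fun y => ?_
    simp only [norm_mul]
    by_cases h : (y * Complex.I : ℂ) ∈ tsupport φ
    · exact mul_le_mul_of_nonneg_right (hub j _ h (re_axis y).ge) (norm_nonneg _)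
    · simp [dx_eq_zero_of_notMem_tsupport h]
  simp only [tsum_mul_right] at s1 s2
  have e : (fun j => ∫ s in rightHalfPlane, u j s * lap φ s) =
      fun j => -∫ y : ℝ, u j (y * Complex.I) * dx φ (y * Complex.I) := by
    ext j; rw [(hu j).eq]; ring
  rw [e] at s1
  rw [s1.unique s2.neg]; ring

end UniformSums

section Products

/-- The factors outside `J` lie within `1/2` of `1`, so they are nonzero and their principal
logarithms are summable; taking real parts makes the branch irrelevant. The factors in `J` may be
far from `1` and are split off as a finite product. -/
lemma log_norm_tprod {ι : Type*} {f : ι → ℂ} {u : ι → ℝ} (hu : Summable u)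
    (hf : ∀ j, ‖f j - 1‖ ≤ u j) (J : Finset ι) [DecidablePred (· ∈ J)]
    (hJ : ∀ j ∉ J, u j ≤ 1 / 2)
    (h0 : ∀ j ∈ J, f j ≠ 0) :
    ∏' j, f j ≠ 0 ∧ Real.log ‖∏' j, f j‖ =
      ∑ j ∈ J, Real.log ‖f j‖ + ∑' j, if j ∈ J then 0 else Real.log ‖f j‖ := by
  set f' : ι → ℂ := fun j => if j ∈ J then 1 else f j with hf'
  set a : ι → ℂ := fun j => if j ∈ J then f j else 1 with ha
  have hne (j : ι) : f' j ≠ 0 := by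
    by_cases h : j ∈ J
    · simp [hf', h]
    · simp only [hf', h, if_false]
      intro h1
      have := hf j
      rw [h1] at this
      have := hJ j h
      norm_num at *
      linarith
  have hsum : Summable fun j => Complex.log (f' j) := by
    have h1 : Summable fun j => f' j - 1 := by
      refine Summable.of_norm_bounded (g := u) hu fun j => ?_
      by_cases h : j ∈ J
      · simpa [hf', h] using (norm_nonneg _).trans (hf j)
      · simpa [hf', h] using hf j
    have := Complex.summable_log_one_add_of_summable h1
    simpa using this
  have hprod : HasProd f' (Complex.exp (∑' j, Complex.log (f' j))) :=
    Complex.hasProd_of_hasSum_log hne hsum.hasSum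
  have haprod : HasProd a (∏ j ∈ J, a j) := hasProd_prod_of_ne_finset_one fun j hj => by
    simp [ha, hj]
  have hmul := haprod.mul hprod
  have e1 : (fun j => a j * f' j) = f := by
    ext j; by_cases h : j ∈ J <;> simp [ha, hf', h]
  have e2 : ∏ j ∈ J, a j = ∏ j ∈ J, f j := Finset.prod_congr rfl fun j hj => by simp [ha, hj]
  rw [e1, e2] at hmul
  have hJ0 : ∏ j ∈ J, f j ≠ 0 := Finset.prod_ne_zero_iff.2 h0
  rw [hmul.tprod_eq]
  refine ⟨mul_ne_zero hJ0 (Complex.exp_ne_zero _), ?_⟩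
  rw [norm_mul, Real.log_mul (norm_ne_zero_iff.2 hJ0) (norm_ne_zero_iff.2 (Complex.exp_ne_zero _)),
    Complex.norm_exp, Real.log_exp, Complex.re_tsum hsum, norm_prod,
    Real.log_prod fun j hj => norm_ne_zero_iff.2 (h0 j hj)]
  congr 1
  refine tsum_congr fun j => ?_
  rw [Complex.log_re]
  by_cases h : j ∈ J <;> simp [hf', h]

lemma abs_log_norm_le {z : ℂ} {b : ℝ} (h : ‖z - 1‖ ≤ b) (hb : b ≤ 1 / 2) :
    |Real.log ‖z‖| ≤ 3 / 2 * b := by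
  have h1 := Complex.norm_log_one_add_half_le_self (h.trans hb)
  rw [add_sub_cancel] at h1
  rw [← Complex.log_re]
  exact (Complex.abs_re_le_norm _).trans (h1.trans (by linarith))

lemma IsCompact.finite_diff_of_mem_codiscreteWithin {K W : Set ℂ} (hK : IsCompact K)
    (hW : W ∈ codiscreteWithin K) : (K \ W).Finite := by
  rw [codiscreteWithin_iff_locallyFiniteComplementWithin] at hW
  choose! t ht hfin using hW
  obtain ⟨F, hF, hcov⟩ := hK.elim_nhds_subcover t ht
  refine (F.finite_toSet.biUnion fun x hx => hfin x (hF x hx)).subset fun z hz => ?_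
  obtain ⟨x, hx, hzx⟩ := Set.mem_iUnion₂.1 (hcov hz.1)
  exact Set.mem_iUnion₂.2 ⟨x, hx, hzx, hz⟩

end Products

end BodeSensitivity

/-! ### Local decomposition of `log ‖S‖` off the exceptional points -/

namespace BodeSensitivity

/-- The points of the closed right half plane off the exceptional points of the axis. -/
def regularPart (E : Set ℝ) : Set ℂ := {s | 0 ≤ s.re ∧ ∀ y ∈ E, s ≠ (y : ℂ) * Complex.I}

lemma rightHalfPlane_subset_regularPart (E : Set ℝ) : rightHalfPlane ⊆ regularPart E :=
  fun s hs => ⟨le_of_lt hs, fun y _ h => by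
    have : s.re = 0 := by rw [h]; simp
    exact absurd hs (by simp [rightHalfPlane, this])⟩

lemma factor_self (p : ℂ) {d : ℝ} (hd : 0 < d) (c : ℂ → ℂ) : factor p d c p = 0 := by
  rw [factor, sub_self, Complex.zero_cpow (by exact_mod_cast hd.ne'), zero_mul]

lemma log_norm_factor {p s : ℂ} (d : ℝ) {c : ℂ → ℂ} (hs : s ≠ p) (hc : c s ≠ 0) :
    factor p d c s ≠ 0 ∧
      Real.log ‖factor p d c s‖ = d * Real.log ‖s - p‖ + Real.log ‖c s‖ := by
  have h : 0 < ‖s - p‖ := norm_pos_iff.2 (sub_ne_zero.2 hs)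
  have h2 : 0 < ‖s - p‖ ^ d := Real.rpow_pos_of_pos h d
  have e : ‖factor p d c s‖ = ‖s - p‖ ^ d * ‖c s‖ := by
    rw [factor, norm_mul, Complex.norm_cpow_real]
  refine ⟨norm_ne_zero_iff.1 (by rw [e]; exact mul_ne_zero h2.ne' (norm_ne_zero_iff.2 hc)), ?_⟩
  rw [e, Real.log_mul h2.ne' (norm_ne_zero_iff.2 hc), Real.log_rpow h]

/-- A function holomorphic near a compact subset of the closed right half plane without zeros in
the open half plane splits off finitely many zeros there. -/
lemma exists_log_norm_eq_of_analyticOnNhd {g : ℂ → ℂ} {K : Set ℂ} (hK : IsCompact K)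
    (hre : ∀ s ∈ K, 0 ≤ s.re) (hg : AnalyticOnNhd ℂ g K) (h0 : ∀ s : ℂ, 0 < s.re → g s ≠ 0) :
    ∃ (T : Set ℂ) (D : Finset ℂ) (n : ℂ → ℝ) (h : ℂ → ℂ), T.Finite ∧ (∀ a ∈ D, a.re ≤ 0) ∧
      AnalyticOnNhd ℂ h K ∧ (∀ s ∈ K, h s ≠ 0) ∧ ∀ s ∈ K, s ∉ T → g s ≠ 0 ∧
        Real.log ‖g s‖ = ∑ a ∈ D, n a * Real.log ‖s - a‖ + Real.log ‖h s‖ := by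
  have hev : ∀ s ∈ K, ∀ᶠ z in 𝓝[≠] s, g z ≠ 0 := by
    intro s hs
    refine (hg s hs).eventually_eq_zero_or_eventually_ne_zero.resolve_left fun hz => ?_
    obtain ⟨ε, hε, hball⟩ := Metric.eventually_nhds_iff_ball.1 hz
    -- A shift to the right from a point of the closed half plane enters the open one, where `g` has
    -- no zeros; so `g` does not vanish identically near any point of `K`.
    refine h0 (s + (ε / 2 : ℝ)) ?_ (hball _ ?_)
    · have := hre s hs
      simp only [Complex.add_re, Complex.ofReal_re]; linarith
    · rw [mem_ball_iff_norm, add_sub_cancel_left, Complex.norm_real, Real.norm_of_nonneg (by linarith)]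
      linarith
  have hmer : MeromorphicOn g K := fun s hs => (hg s hs).meromorphicAt
  have hord : ∀ s : K, meromorphicOrderAt g s ≠ ⊤ := fun s =>
    (meromorphicOrderAt_ne_top_iff_eventually_ne_zero (hmer s s.2)).2 (hev s s.2)
  set Dv := MeromorphicOn.divisor g K with hDv
  have hfin : Dv.support.Finite := Dv.finiteSupport hK
  obtain ⟨h, hh, hh0, heq⟩ := MeromorphicOn.extract_zeros_poles hmer hord hfin
  have hlog := MeromorphicOn.extract_zeros_poles_log hh0 heq
  have hne : {s | g s ≠ 0} ∈ codiscreteWithin K := by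
    rw [mem_codiscreteWithin_iff_forall_mem_nhdsNE]
    intro s hs
    filter_upwards [hev s hs] with z hz using Or.inl hz
  have hT := IsCompact.finite_diff_of_mem_codiscreteWithin hK (inter_mem hlog hne)
  refine ⟨_, hfin.toFinset, fun a => Dv a, h, hT, ?_, hh, fun s hs => hh0 ⟨s, hs⟩, ?_⟩
  · intro a ha
    by_contra hlt
    push Not at hlt
    rw [Set.Finite.mem_toFinset, Function.mem_support] at ha
    apply ha
    by_cases haK : a ∈ K
    · rw [hDv, MeromorphicOn.divisor_apply hmer haK]
      have : meromorphicOrderAt g a = 0 := by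
        rw [(hg a haK).meromorphicOrderAt_eq, (hg a haK).analyticOrderAt_eq_zero.2 (h0 a hlt)]
        rfl
      rw [this]; rfl
    · exact Function.locallyFinsuppWithin.apply_eq_zero_of_notMem Dv haK
  · intro s hs hsT
    have hs' : s ∈ {x | (Real.log ‖g ·‖) x =
        (∑ᶠ u, (Dv u * Real.log ‖· - u‖) + (Real.log ‖h ·‖)) x} ∩ {s | g s ≠ 0} := by
      by_contra hn; exact hsT ⟨hs, hn⟩
    refine ⟨hs'.2, ?_⟩
    have h1 := hs'.1
    simp only [Set.mem_ofPred_eq, Pi.add_apply] at h1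
    rw [h1, finsum_eq_sum_of_support_subset (s := hfin.toFinset) _ ?_, Finset.sum_apply]
    intro u hu
    rw [Function.mem_support] at hu
    rw [Finset.mem_coe, Set.Finite.mem_toFinset, Function.mem_support]
    intro h2
    apply hu
    ext z
    simp [h2]

section Factorization

variable {ι : Type*} {S g : ℂ → ℂ} {p : ι → ℂ} {d : ι → ℝ} {c : ι → ℂ → ℂ} {E : Set ℝ} {U : Set ℂ}

namespace IsWeierstrassFactorization

lemma regularPart_subset (hS : IsWeierstrassFactorization S g p d c E U) : regularPart E ⊆ U :=
  fun s hs => hS.subset s hs.1 hs.2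

/-- The factor of `p j` vanishes at `p j`, so each pole in `K` forces `1 ≤ u j`, which summability
permits only finitely often. -/
lemma finite_poles (hS : IsWeierstrassFactorization S g p d c E U) {K : Set ℂ} (hK : IsCompact K)
    (hKU : K ⊆ U) : {j | p j ∈ K}.Finite := by
  obtain ⟨u, hu, hb⟩ := hS.normal_convergence K hKU hK
  have h := hu.tendsto_cofinite_zero.eventually (gt_mem_nhds one_pos)
  refine (Filter.eventually_cofinite.1 h).subset fun j hj => ?_
  have := hb j (p j) hj
  rw [factor_self _ (hS.order_pos j)] at this
  simpa using this

/-- The open half plane is exhausted by compact sets, each with finitely many poles. Countability of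
`ι` is what allows sums and integrals to be exchanged. -/
lemma countable_index (hS : IsWeierstrassFactorization S g p d c E U) : Countable ι := by
  have h : ∀ n : ℕ, {j | p j ∈ Metric.closedBall (0 : ℂ) n ∩ {s | 1 / ((n : ℝ) + 1) ≤ s.re}}.Finite := by
    intro n
    refine hS.finite_poles ((isCompact_closedBall _ _).inter_right
      (isClosed_le continuous_const Complex.continuous_re)) ?_
    refine (Set.inter_subset_right.trans fun s hs => ?_).trans
      ((rightHalfPlane_subset_regularPart E).trans hS.regularPart_subset)
    have : 0 < 1 / ((n : ℝ) + 1) := by positivity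
    exact lt_of_lt_of_le this hs
  rw [← Set.countable_univ_iff]
  refine (Set.countable_iUnion fun n => (h n).countable).mono fun j _ => ?_
  obtain ⟨n, hn⟩ := exists_nat_one_div_lt (hS.pole_re_pos j)
  obtain ⟨m, hm⟩ := exists_nat_ge ‖p j‖
  refine Set.mem_iUnion.2 ⟨max m n, ?_, ?_⟩
  · rw [mem_closedBall_zero_iff]
    exact hm.trans (by exact_mod_cast le_max_left m n)
  · refine le_trans ?_ hn.le
    exact one_div_le_one_div_of_le (by positivity) (by
      have : (n : ℝ) ≤ (max m n : ℕ) := by exact_mod_cast le_max_right m n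
      linarith)

/-- The singular part of `log ‖S‖` on `K` is a finite sum of potentials. The remainder `v` collects
the zero-free part of `g`, the convergence factors with index in `J`, and the logarithms of the
other factors of the product. `T` contains the points of `K` at which `S` may vanish. -/
theorem exists_log_norm_eq (hS : IsWeierstrassFactorization S g p d c E U) {K : Set ℂ}
    (hK : IsCompact K) (hKE : K ⊆ regularPart E) :
    ∃ (T : Set ℂ) (D : Finset ℂ) (n : ℂ → ℝ) (J : Finset ι) (v : ℂ → ℝ), T.Finite ∧
      (∀ a ∈ D, a.re ≤ 0) ∧ (∀ j, p j ∈ K → j ∈ J) ∧ ContinuousOn v K ∧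
      (∀ φ : ℂ → ℝ, IsTest φ → tsupport φ ∩ {s | 0 ≤ s.re} ⊆ K → GreenFormula φ v 0) ∧
      ∀ s ∈ K, s ∉ T → S s ≠ 0 ∧ Real.log ‖S s‖ =
        ∑ a ∈ D, n a * Real.log ‖s - a‖ + ∑ j ∈ J, d j * Real.log ‖s - p j‖ + v s := by
  classical
  have hKU := hKE.trans hS.regularPart_subset
  have hcount := hS.countable_index
  obtain ⟨T, D, n, h, hT, hD, hh, hh0, hgeq⟩ := exists_log_norm_eq_of_analyticOnNhd hK
    (fun s hs => (hKE hs).1) (fun s hs => hS.holomorphic.analyticAt (hS.isOpen.mem_nhds (hKU hs)))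
    hS.ne_zero
  obtain ⟨u, hu, hub⟩ := hS.normal_convergence K hKU hK
  -- `J` consists of the indices with `u j > 1/2`. It contains every pole in `K`, since there `1 ≤ u
  -- j`; it may contain others, which does no harm.
  have hJfin : {j | ¬ u j ≤ 1 / 2}.Finite := by
    have h := hu.tendsto_cofinite_zero.eventually (gt_mem_nhds (show (0 : ℝ) < 1 / 2 by norm_num))
    exact (Filter.eventually_cofinite.1 h).subset fun j hj h2 => hj h2.le
  set J := hJfin.toFinset with hJdef
  have hJ : ∀ j ∉ J, u j ≤ 1 / 2 := fun j hj => by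
    by_contra hn; exact hj (hJfin.mem_toFinset.2 hn)
  have hpJ : ∀ j, p j ∈ K → j ∈ J := fun j hj => by
    by_contra hn
    have h1 := hub j _ hj
    have h2 := hJ j hn
    rw [factor_self _ (hS.order_pos j)] at h1
    norm_num at h1
    linarith
  have hc : ∀ j, ∀ s ∈ K, AnalyticAt ℂ (c j) s ∧ c j s ≠ 0 := fun j s hs =>
    ⟨(hS.factor_holomorphic j).analyticAt (hS.isOpen.mem_nhds (hKU hs)),
      hS.factor_ne_zero j s (hKU hs)⟩
  have hlogc : ∀ j, ContinuousOn (fun s => Real.log ‖c j s‖) K := fun j s hs =>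
    ((hc j s hs).1.continuousAt.norm.log (norm_ne_zero_iff.2 (hc j s hs).2)).continuousWithinAt
  set w : ι → ℂ → ℝ := fun j s =>
    if j ∈ J then 0 else Real.log ‖factor (p j) (d j) (c j) s‖ with hw
  have hwb : ∀ j, ∀ s ∈ K, |w j s| ≤ 3 / 2 * u j := fun j s hs => by
    by_cases hj : j ∈ J
    · simpa [hw, hj] using (norm_nonneg _).trans (hub j s hs)
    · simpa only [hw, hj, if_false] using abs_log_norm_le (hub j s hs) (hJ j hj)
  have hweq : ∀ j ∉ J, ∀ s ∈ K, d j * Real.log ‖s - p j‖ + Real.log ‖c j s‖ = w j s :=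
    fun j hj s hs => by
      have hne : s ≠ p j := fun h => hj (hpJ j (h ▸ hs))
      simp only [hw, hj, if_false, (log_norm_factor (d j) hne (hc j s hs).2).2]
  have hwc : ∀ j, ContinuousOn (w j) K := fun j => by
    by_cases hj : j ∈ J
    · simpa [hw, hj] using continuousOn_const
    · refine ContinuousOn.congr ?_ fun s hs => (hweq j hj s hs).symm
      refine (continuousOn_const.mul (ContinuousOn.log (by fun_prop) fun s hs => ?_)).add (hlogc j)
      exact norm_ne_zero_iff.2 (sub_ne_zero.2 fun h => hj (hpJ j (h ▸ hs)))
  have hwsum : ContinuousOn (fun s => ∑' j, w j s) K :=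
    continuousOn_tsum hwc (hu.mul_left (3 / 2)) hwb
  refine ⟨T ∪ (J.image p : Finset ℂ), D, n, J,
    fun s => Real.log ‖h s‖ + ∑ j ∈ J, Real.log ‖c j s‖ + ∑' j, w j s,
    hT.union (Finset.finite_toSet _), hD, hpJ, ?_, ?_, ?_⟩
  · refine (ContinuousOn.add (fun s hs => ?_) (continuousOn_finsetSum _ fun j _ => hlogc j)).add
      hwsum
    exact ((hh s hs).continuousAt.norm.log (norm_ne_zero_iff.2 (hh0 s hs))).continuousWithinAt
  · intro φ hφ hφK
    have g1 := GreenFormula.log_norm_of_analyticAt hφ (h := h)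
      fun s hs h0 => ⟨hh s (hφK ⟨hs, h0⟩), hh0 s (hφK ⟨hs, h0⟩)⟩
    have g2 (j : ι) := GreenFormula.log_norm_of_analyticAt hφ (h := c j)
      fun s hs h0 => hc j s (hφK ⟨hs, h0⟩)
    have g3 := GreenFormula.sum J (u := fun j s => Real.log ‖c j s‖) (m := fun _ => 0)
      fun j _ => g2 j
    have g4 : GreenFormula φ (fun s => ∑' j, w j s) 0 := by
      refine GreenFormula.tsum hφ (hu.mul_left (3 / 2))
        (fun j s hs h0 => hwb j s (hφK ⟨hs, h0⟩)) (fun j => ?_) (hwsum.mono hφK)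
      by_cases hj : j ∈ J
      · have : w j = fun _ => 0 := by ext s; simp [hw, hj]
        rw [this]
        exact ⟨by simp, by simp, by simp⟩
      -- For `j ∉ J` the pole lies outside `K`, hence outside the support of `φ`, so its potential
      -- has mass zero against `φ`.
      · have hzero : rightHalfPlane.indicator φ (p j) = 0 := by
          rw [Set.indicator_of_mem (show p j ∈ rightHalfPlane from hS.pole_re_pos j)]
          by_contra hne
          exact hj (hpJ j (hφK ⟨subset_tsupport _ hne, (hS.pole_re_pos j).le⟩))
        have := ((GreenFormula.log_norm_sub hφ (p j)).const_mul (d j)).add (g2 j)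
        rw [hzero, mul_zero, add_zero] at this
        exact this.congr Set.finite_empty fun s hs h0 _ => hweq j hj s (hφK ⟨hs, h0⟩)
    simpa using (g1.add g3).add g4
  · intro s hs hsT
    have hsT1 : s ∉ T := fun h => hsT (Or.inl h)
    have hsp : ∀ j ∈ J, s ≠ p j := fun j hj h => hsT (Or.inr (by
      rw [h]; exact Finset.mem_coe.2 (Finset.mem_image_of_mem p hj)))
    obtain ⟨hg0, hg1⟩ := hgeq s hs hsT1
    obtain ⟨hp0, hp1⟩ := log_norm_tprod hu (fun j => hub j s hs) J hJ
      fun j hj => (log_norm_factor (d j) (hsp j hj) (hc j s hs).2).1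
    rw [hS.eq_prod s (hKE hs).1 (hKE hs).2]
    refine ⟨mul_ne_zero hg0 hp0, ?_⟩
    rw [norm_mul, Real.log_mul (norm_ne_zero_iff.2 hg0) (norm_ne_zero_iff.2 hp0), hg1, hp1]
    have e : ∑ j ∈ J, Real.log ‖factor (p j) (d j) (c j) s‖ =
        ∑ j ∈ J, d j * Real.log ‖s - p j‖ + ∑ j ∈ J, Real.log ‖c j s‖ := by
      rw [← Finset.sum_add_distrib]
      exact Finset.sum_congr rfl fun j hj => (log_norm_factor (d j) (hsp j hj) (hc j s hs).2).2
    rw [e]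
    ring

end IsWeierstrassFactorization
end Factorization
end BodeSensitivity

/-! ### Polar coordinates and the integrability of `log ‖S‖` -/

namespace BodeSensitivity

section Polar

lemma mem_rightHalfPlane_circleMap_iff {y r θ : ℝ} (hr : 0 < r) (hθ : θ ∈ Set.Ioo (-Real.pi) Real.pi) :
    circleMap ((y : ℂ) * Complex.I) r θ ∈ rightHalfPlane ↔
      θ ∈ Set.Ioo (-(Real.pi / 2)) (Real.pi / 2) := by
  have e : (circleMap ((y : ℂ) * Complex.I) r θ).re = r * Real.cos θ := by
    rw [circleMap, Complex.exp_mul_I]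
    simp [Complex.cos_ofReal_re, Complex.sin_ofReal_re]
  rw [rightHalfPlane, Set.mem_ofPred_eq, e, mul_pos_iff_of_pos_left hr]
  constructor
  · intro h
    by_contra hn
    rw [Set.mem_Ioo, not_and_or, not_lt, not_lt] at hn
    have : Real.cos θ ≤ 0 := by
      rcases hn with hn | hn
      · rw [← Real.cos_neg]
        exact Real.cos_nonpos_of_pi_div_two_le_of_le (by linarith) (by linarith [hθ.1])
      · exact Real.cos_nonpos_of_pi_div_two_le_of_le hn (by linarith [hθ.2])
    linarith
  · exact Real.cos_pos_of_mem_Ioo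

lemma circleMap_mem_closed {y r θ : ℝ} (hr : 0 ≤ r)
    (hθ : θ ∈ Set.Icc (-(Real.pi / 2)) (Real.pi / 2)) :
    0 ≤ (circleMap ((y : ℂ) * Complex.I) r θ).re := by
  have e : (circleMap ((y : ℂ) * Complex.I) r θ).re = r * Real.cos θ := by
    rw [circleMap, Complex.exp_mul_I]
    simp [Complex.cos_ofReal_re, Complex.sin_ofReal_re]
  rw [e]
  exact mul_nonneg hr (Real.cos_nonneg_of_mem_Icc hθ)

lemma polarCoord_symm_eq_circleMap (y : ℝ) (q : ℝ × ℝ) :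
    Complex.polarCoord.symm q + (y : ℂ) * Complex.I = circleMap ((y : ℂ) * Complex.I) q.1 q.2 := by
  rw [Complex.polarCoord_symm_apply, circleMap, Complex.exp_mul_I, Complex.ofReal_cos,
    Complex.ofReal_sin]
  ring

lemma target_inter_half : polarCoord.target ∩ {q : ℝ × ℝ |
    q.2 ∈ Set.Ioo (-(Real.pi / 2)) (Real.pi / 2)} =
    Set.Ioi 0 ×ˢ Set.Ioo (-(Real.pi / 2)) (Real.pi / 2) := by
  ext q
  have := Real.pi_pos
  simp only [polarCoord_target, Set.mem_inter_iff, Set.mem_prod, Set.mem_Ioi, Set.mem_Ioo,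
    Set.mem_ofPred_eq]
  constructor
  · rintro ⟨⟨h1, _⟩, h2⟩; exact ⟨h1, h2⟩
  · rintro ⟨h1, h2⟩; exact ⟨⟨h1, by constructor <;> linarith [h2.1, h2.2]⟩, h2⟩

/-- Centred at a point of the axis, the right half plane is a full product in polar coordinates. -/
lemma lintegral_rightHalfPlane_polar (y : ℝ) (F : ℂ → ENNReal) :
    ∫⁻ s in rightHalfPlane, F s =
      ∫⁻ q in Set.Ioi (0 : ℝ) ×ˢ Set.Ioo (-(Real.pi / 2)) (Real.pi / 2),
        ENNReal.ofReal q.1 * F (circleMap ((y : ℂ) * Complex.I) q.1 q.2) := by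
  have hA : MeasurableSet {q : ℝ × ℝ | q.2 ∈ Set.Ioo (-(Real.pi / 2)) (Real.pi / 2)} :=
    measurable_snd measurableSet_Ioo
  rw [← target_inter_half, Set.inter_comm, ← setLIntegral_indicator hA,
    ← lintegral_indicator measurableSet_rightHalfPlane,
    ← lintegral_add_right_eq_self _ ((y : ℂ) * Complex.I),
    ← Complex.lintegral_comp_polarCoord_symm]
  refine setLIntegral_congr_fun polarCoord.open_target.measurableSet fun q hq => ?_
  rw [polarCoord_target] at hq
  simp only [polarCoord_symm_eq_circleMap]
  by_cases h : q.2 ∈ Set.Ioo (-(Real.pi / 2)) (Real.pi / 2)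
  · rw [Set.indicator_of_mem ((mem_rightHalfPlane_circleMap_iff hq.1 hq.2).2 h),
      Set.indicator_of_mem (by exact h), smul_eq_mul]
  · rw [Set.indicator_of_notMem (fun h' => h ((mem_rightHalfPlane_circleMap_iff hq.1 hq.2).1 h')),
      Set.indicator_of_notMem (by exact h), smul_zero]

lemma setIntegral_rightHalfPlane_polar (F : ℂ → ℂ) :
    ∫ s in rightHalfPlane, F s =
      ∫ q in Set.Ioi (0 : ℝ) ×ˢ Set.Ioo (-(Real.pi / 2)) (Real.pi / 2),
        q.1 • F (circleMap 0 q.1 q.2) := by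
  have hA : MeasurableSet {q : ℝ × ℝ | q.2 ∈ Set.Ioo (-(Real.pi / 2)) (Real.pi / 2)} :=
    measurable_snd measurableSet_Ioo
  rw [← target_inter_half, ← setIntegral_indicator hA,
    ← integral_indicator measurableSet_rightHalfPlane,
    ← Complex.integral_comp_polarCoord_symm]
  refine setIntegral_congr_fun polarCoord.open_target.measurableSet fun q hq => ?_
  rw [polarCoord_target] at hq
  have e := polarCoord_symm_eq_circleMap 0 q
  have e0 : ((0 : ℝ) : ℂ) * Complex.I = 0 := by simp
  have hiff := mem_rightHalfPlane_circleMap_iff (y := 0) hq.1 hq.2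
  rw [e0] at e hiff
  rw [add_zero] at e
  simp only [e]
  by_cases h : q.2 ∈ Set.Ioo (-(Real.pi / 2)) (Real.pi / 2)
  · rw [Set.indicator_of_mem (hiff.2 h), Set.indicator_of_mem (by exact h)]
  · rw [Set.indicator_of_notMem (fun h' => h (hiff.1 h')),
      Set.indicator_of_notMem (by exact h), smul_zero]

end Polar

lemma isClosed_of_finite_inter_Icc {E : Set ℝ} (hE : ∀ R : ℝ, (E ∩ Set.Icc (-R) R).Finite) :
    IsClosed E := by
  refine isClosed_of_closure_subset fun y hy => ?_
  have hn : Set.Icc (-(|y| + 1)) (|y| + 1) ∈ 𝓝 y :=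
    Icc_mem_nhds (by linarith [neg_abs_le y]) (by linarith [le_abs_self y])
  have h1 : y ∈ closure (E ∩ Set.Icc (-(|y| + 1)) (|y| + 1)) := by
    rw [mem_closure_iff_nhds] at hy ⊢
    intro t ht
    obtain ⟨z, hz, hzE⟩ := hy _ (inter_mem ht hn)
    exact ⟨z, hz.1, hzE, hz.2⟩
  rw [(hE _).isClosed.closure_eq] at h1
  exact h1.1

lemma exists_closedBall_inter_subset_regularPart {E : Set ℝ} (hE : IsClosed E) {s : ℂ}
    (hs : s ∈ regularPart E) :
    ∃ r > 0, Metric.closedBall s r ∩ {z | 0 ≤ z.re} ⊆ regularPart E := by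
  have hcl : IsClosed ((fun y : ℝ => (y : ℂ) * Complex.I) '' E) :=
    isClosedEmbedding_axis.isClosedMap _ hE
  have hmem : s ∈ ((fun y : ℝ => (y : ℂ) * Complex.I) '' E)ᶜ := by
    rintro ⟨y, hy, rfl⟩; exact hs.2 y hy rfl
  obtain ⟨r, hr, hb⟩ := Metric.nhds_basis_closedBall.mem_iff.1 (hcl.isOpen_compl.mem_nhds hmem)
  exact ⟨r, hr, fun z hz => ⟨hz.2, fun y hy h => hb hz.1 ⟨y, hy, h.symm⟩⟩⟩

lemma isCompact_closedBall_inter (s : ℂ) (r : ℝ) :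
    IsCompact (Metric.closedBall s r ∩ {z : ℂ | 0 ≤ z.re}) :=
  (isCompact_closedBall s r).inter_right (isClosed_le continuous_const Complex.continuous_re)

section Factorization

variable {ι : Type*} {S g : ℂ → ℂ} {p : ι → ℂ} {d : ι → ℝ} {c : ι → ℂ → ℂ} {E : Set ℝ} {U : Set ℂ}

namespace IsWeierstrassFactorization

lemma isClosed_exceptional (hS : IsWeierstrassFactorization S g p d c E U) : IsClosed E :=
  isClosed_of_finite_inter_Icc hS.locallyFinite

/-- The case of test functions supported away from the exceptional points: only finitely many poles
meet the support, so the pole sum is finite. -/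
theorem greenFormula (hS : IsWeierstrassFactorization S g p d c E U) {φ : ℂ → ℝ} (hφ : IsTest φ)
    (hφE : tsupport φ ∩ {s | 0 ≤ s.re} ⊆ regularPart E) :
    Summable (fun j => d j * φ (p j)) ∧
      GreenFormula φ (fun s => Real.log ‖S s‖) (∑' j, d j * φ (p j)) := by
  obtain ⟨T, D, n, J, v, hT, hD, hJ, -, hv, heq⟩ := hS.exists_log_norm_eq
    (hφ.hasCompactSupport.inter_right (isClosed_le continuous_const Complex.continuous_re)) hφE
  have hJ0 : ∀ j ∉ J, d j * φ (p j) = 0 := fun j hj => by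
    by_contra hne
    exact hj (hJ j ⟨subset_tsupport _ (right_ne_zero_of_mul hne), (hS.pole_re_pos j).le⟩)
  refine ⟨summable_of_ne_finset_zero hJ0, ?_⟩
  have g1 := GreenFormula.sum D (u := fun a s => n a * Real.log ‖s - a‖)
    fun a _ => (GreenFormula.log_norm_sub hφ a).const_mul (n a)
  have g2 := GreenFormula.sum J (u := fun j s => d j * Real.log ‖s - p j‖)
    fun j _ => (GreenFormula.log_norm_sub hφ (p j)).const_mul (d j)
  have e1 : ∑ a ∈ D, n a * rightHalfPlane.indicator φ a = 0 := Finset.sum_eq_zero fun a ha => by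
    rw [Set.indicator_of_notMem (show a ∉ rightHalfPlane from not_lt.2 (hD a ha)), mul_zero]
  have e2 : ∑ j ∈ J, d j * rightHalfPlane.indicator φ (p j) = ∑' j, d j * φ (p j) := by
    rw [tsum_eq_sum hJ0]
    exact Finset.sum_congr rfl fun j _ => by
      rw [Set.indicator_of_mem (show p j ∈ rightHalfPlane from hS.pole_re_pos j)]
  have g3 := (g1.add g2).add (hv φ hφ subset_rfl)
  rw [e1, e2, zero_add, add_zero] at g3
  exact g3.congr hT fun s hs h0 hsT => ((heq s ⟨hs, h0⟩ hsT).2).symm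

lemma finite_zeros (hS : IsWeierstrassFactorization S g p d c E U) {K : Set ℂ} (hK : IsCompact K)
    (hKE : K ⊆ regularPart E) : {s ∈ K | S s = 0}.Finite := by
  obtain ⟨T, D, n, J, v, hT, -, -, -, -, heq⟩ := hS.exists_log_norm_eq hK hKE
  exact hT.subset fun s hs => by
    by_contra h
    exact (heq s hs.1 h).1 hs.2

lemma integrableOn_log_norm (hS : IsWeierstrassFactorization S g p d c E U) {K : Set ℂ}
    (hK : IsCompact K) (hKE : K ⊆ regularPart E) :
    IntegrableOn (fun s => Real.log ‖S s‖) K := by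
  obtain ⟨T, D, n, J, v, hT, -, -, hv, -, heq⟩ := hS.exists_log_norm_eq hK hKE
  have h : IntegrableOn (fun s => ∑ a ∈ D, n a * Real.log ‖s - a‖ +
      ∑ j ∈ J, d j * Real.log ‖s - p j‖ + v s) K := by
    refine ((integrable_finsetSum _ fun a _ => ?_).add
      (integrable_finsetSum _ fun j _ => ?_)).add (hv.integrableOn_compact hK)
    · exact ((locallyIntegrable_log_norm_sub a).integrableOn_isCompact hK).const_mul _
    · exact ((locallyIntegrable_log_norm_sub (p j)).integrableOn_isCompact hK).const_mul _
  refine h.congr_fun_ae ?_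
  filter_upwards [ae_restrict_mem hK.measurableSet,
    ae_restrict_of_ae (hT.countable.ae_notMem volume)] with s hs hsT
  exact (heq s hs hsT).2.symm

lemma integrableOn_log_norm_axis (hS : IsWeierstrassFactorization S g p d c E U) {K : Set ℂ}
    (hK : IsCompact K) (hKE : K ⊆ regularPart E) :
    IntegrableOn (fun y : ℝ => Real.log ‖S (y * Complex.I)‖)
      ((fun y : ℝ => (y : ℂ) * Complex.I) ⁻¹' K) := by
  obtain ⟨T, D, n, J, v, hT, -, -, hv, -, heq⟩ := hS.exists_log_norm_eq hK hKE
  have hK' := isClosedEmbedding_axis.isCompact_preimage hK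
  have h : IntegrableOn (fun y : ℝ => ∑ a ∈ D, n a * Real.log ‖(y : ℂ) * Complex.I - a‖ +
      ∑ j ∈ J, d j * Real.log ‖(y : ℂ) * Complex.I - p j‖ + v (y * Complex.I))
      ((fun y : ℝ => (y : ℂ) * Complex.I) ⁻¹' K) := by
    refine ((integrable_finsetSum _ fun a _ => ?_).add
      (integrable_finsetSum _ fun j _ => ?_)).add
      ((hv.comp isClosedEmbedding_axis.continuous.continuousOn
        fun y hy => hy).integrableOn_compact hK')
    · exact ((locallyIntegrable_log_norm_sub_axis a).integrableOn_isCompact hK').const_mul _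
    · exact ((locallyIntegrable_log_norm_sub_axis (p j)).integrableOn_isCompact hK').const_mul _
  refine h.congr_fun_ae ?_
  filter_upwards [ae_restrict_mem hK'.measurableSet, ae_restrict_of_ae ((hT.preimage
    (isClosedEmbedding_axis.injective.injOn)).countable.ae_notMem volume)] with s hs hsT
  exact (heq _ hs hsT).2.symm

lemma intervalIntegrable_log_norm_arc (hS : IsWeierstrassFactorization S g p d c E U) {z : ℂ}
    {r : ℝ} (hr : r ≠ 0) {α β : ℝ} (hαβ : α ≤ β)
    (hE : ∀ θ ∈ Set.Icc α β, circleMap z r θ ∈ regularPart E) :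
    IntervalIntegrable (fun θ => Real.log ‖S (circleMap z r θ)‖) volume α β := by
  have hK : IsCompact (circleMap z r '' Set.Icc α β) :=
    isCompact_Icc.image (continuous_circleMap z r)
  obtain ⟨T, D, n, J, v, hT, -, -, hv, -, heq⟩ := hS.exists_log_norm_eq hK
    (by rintro _ ⟨θ, hθ, rfl⟩; exact hE θ hθ)
  have hlog (a : ℂ) : IntervalIntegrable (fun θ => Real.log ‖circleMap z r θ - a‖) volume α β := by
    -- Integrability over a full circle passes to the arc by periodicity in the angle.
    have h1 : CircleIntegrable (fun w => Real.log ‖w - a‖) z r :=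
      circleIntegrable_log_norm_sub_const r
    have h2 : Function.Periodic (fun θ => Real.log ‖circleMap z r θ - a‖) (2 * Real.pi) :=
      fun θ => by simp only [periodic_circleMap z r θ]
    exact h2.intervalIntegrable₀ Real.two_pi_pos.ne' h1 α β
  have h : IntervalIntegrable (fun θ => ∑ a ∈ D, n a * Real.log ‖circleMap z r θ - a‖ +
      ∑ j ∈ J, d j * Real.log ‖circleMap z r θ - p j‖ + v (circleMap z r θ)) volume α β := by
    refine (IntervalIntegrable.add
      (intervalIntegrable_iff.2 (integrable_finsetSum _ fun a _ => ((hlog a).const_mul (n a)).def'))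
      (intervalIntegrable_iff.2 (integrable_finsetSum _ fun j _ =>
        ((hlog (p j)).const_mul (d j)).def'))).add ?_
    refine ContinuousOn.intervalIntegrable ?_
    rw [Set.uIcc_of_le hαβ]
    exact hv.comp (continuous_circleMap z r).continuousOn fun θ hθ => ⟨θ, hθ, rfl⟩
  refine h.congr_ae ?_
  filter_upwards [ae_restrict_mem measurableSet_uIoc, ae_restrict_of_ae
    ((hT.countable.preimage_circleMap z hr).ae_notMem volume)] with θ hθ hθT
  rw [Set.uIoc_of_le hαβ] at hθ
  exact (heq _ ⟨θ, Set.Ioc_subset_Icc_self hθ, rfl⟩ hθT).2.symm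

theorem locallyIntegrable_log_norm_axis (hS : IsWeierstrassFactorization S g p d c E U)
    (hE : ∀ y ∈ E, LogRegularAt S y) :
    LocallyIntegrable fun y : ℝ => Real.log ‖S (y * Complex.I)‖ := by
  intro y
  by_cases hy : y ∈ E
  · exact (hE y hy).1
  · have hreg : (y : ℂ) * Complex.I ∈ regularPart E := ⟨(re_axis y).ge, fun z hz h => by
      have := isClosedEmbedding_axis.injective h
      exact hy (this ▸ hz)⟩
    obtain ⟨r, hr, hsub⟩ := exists_closedBall_inter_subset_regularPart hS.isClosed_exceptional hreg
    refine ⟨_, ?_, hS.integrableOn_log_norm_axis (isCompact_closedBall_inter _ r) hsub⟩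
    filter_upwards [isClosedEmbedding_axis.continuous.continuousAt.preimage_mem_nhds
      (Metric.closedBall_mem_nhds _ hr)] with z hz
    exact ⟨hz, (re_axis z).ge⟩

/-- No measurability of `S` is assumed; it comes from local integrability, hence from the
factorization. -/
lemma aestronglyMeasurable_log_norm (hS : IsWeierstrassFactorization S g p d c E U) :
    AEStronglyMeasurable (fun s => Real.log ‖S s‖) (volume.restrict rightHalfPlane) := by
  refine LocallyIntegrableOn.aestronglyMeasurable fun s hs => ?_
  obtain ⟨r, hr, hsub⟩ := exists_closedBall_inter_subset_regularPart hS.isClosed_exceptional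
    (rightHalfPlane_subset_regularPart E hs)
  refine ⟨_, ?_, hS.integrableOn_log_norm (isCompact_closedBall_inter s r) hsub⟩
  refine mem_nhdsWithin_of_mem_nhds (inter_mem (Metric.closedBall_mem_nhds _ hr) ?_)
  exact mem_of_superset (isOpen_rightHalfPlane.mem_nhds hs) fun z hz => (show 0 < z.re from hz).le

/-- The area integral of `|log |S||` over small half discs around an exceptional point is of
smaller order than the radius. -/
theorem eventually_lintegral_half_disc_le (hS : IsWeierstrassFactorization S g p d c E U)
    (hE : ∀ y ∈ E, LogRegularAt S y) {y : ℝ} (hy : y ∈ E) {η : ℝ} (hη : 0 < η) :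
    ∀ᶠ ρ : ℝ in 𝓝[>] 0,
      ∫⁻ s in rightHalfPlane ∩ Metric.ball ((y : ℂ) * Complex.I) ρ, ‖Real.log ‖S s‖‖ₑ ≤
        ENNReal.ofReal (η * ρ) := by
  have h1 := (hE y hy).2.eventually (gt_mem_nhds hη)
  -- Exceptional points are isolated, so small arcs around `y * I` avoid all of them.
  have h2 : ∀ᶠ r : ℝ in 𝓝[>] 0, ∀ θ ∈ Set.Icc (-(Real.pi / 2)) (Real.pi / 2),
      circleMap ((y : ℂ) * Complex.I) r θ ∈ regularPart E := by
    have hfin : ((E ∩ Set.Icc (-(|y| + 1)) (|y| + 1)) \ {y}).Finite :=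
      (hS.locallyFinite _).subset Set.sdiff_subset
    have hn : ((E ∩ Set.Icc (-(|y| + 1)) (|y| + 1)) \ {y})ᶜ ∩
        Set.Icc (-(|y| + 1)) (|y| + 1) ∈ 𝓝 y :=
      inter_mem (hfin.isClosed.isOpen_compl.mem_nhds (by simp))
        (Icc_mem_nhds (by linarith [neg_abs_le y]) (by linarith [le_abs_self y]))
    obtain ⟨ε, hε, hball⟩ := Metric.mem_nhds_iff.1 hn
    filter_upwards [Ioo_mem_nhdsGT hε] with r hr θ hθ
    refine ⟨circleMap_mem_closed hr.1.le hθ, fun z hz h => ?_⟩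
    have hd : |z - y| = r := by
      have : ‖circleMap ((y : ℂ) * Complex.I) r θ - (y : ℂ) * Complex.I‖ = |r| := by simp
      rw [h, ← sub_mul, norm_mul, Complex.norm_I, mul_one, ← Complex.ofReal_sub,
        Complex.norm_real, Real.norm_eq_abs, abs_of_pos hr.1] at this
      exact this
    have hz2 := hball (show z ∈ Metric.ball y ε by
      rw [Metric.mem_ball, Real.dist_eq, hd]; exact hr.2)
    refine hz2.1 ⟨⟨hz, hz2.2⟩, fun hzy => ?_⟩
    rw [hzy, sub_self, abs_zero] at hd
    exact hr.1.ne hd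
  obtain ⟨ρ₀, hρ₀, hall⟩ := mem_nhdsGT_iff_exists_Ioo_subset.1 (h1.and h2)
  filter_upwards [Ioo_mem_nhdsGT hρ₀] with ρ hρ
  have hpi : -(Real.pi / 2) ≤ Real.pi / 2 := by linarith [Real.pi_pos]
  have key : ∀ r ∈ Set.Ioo 0 ρ, ∫⁻ θ in Set.Ioo (-(Real.pi / 2)) (Real.pi / 2),
      ENNReal.ofReal r * ‖Real.log ‖S (circleMap ((y : ℂ) * Complex.I) r θ)‖‖ₑ ≤
        ENNReal.ofReal η := by
    intro r hr
    obtain ⟨ha, hreg⟩ := hall ⟨hr.1, hr.2.trans hρ.2⟩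
    -- Integrability on the arc excludes the default value `0` of the Bochner integral, so the arc
    -- condition really bounds the `lintegral`.
    have hi := hS.intervalIntegrable_log_norm_arc hr.1.ne' hpi hreg
    have hi2 := (intervalIntegrable_iff_integrableOn_Ioo_of_le hpi).1 (hi.abs.mul_const r)
    rw [intervalIntegral.integral_of_le hpi, integral_Ioc_eq_integral_Ioo] at ha
    refine le_trans (le_of_eq ?_) (ENNReal.ofReal_le_ofReal ha.le)
    rw [ofReal_integral_eq_lintegral_ofReal hi2 (ae_of_all _ fun θ =>
      mul_nonneg (abs_nonneg _) hr.1.le)]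
    refine lintegral_congr fun θ => ?_
    rw [mul_comm, Real.enorm_eq_ofReal_abs, ENNReal.ofReal_mul (abs_nonneg _)]
  have hball : MeasurableSet (Metric.ball ((y : ℂ) * Complex.I) ρ) := measurableSet_ball
  rw [Set.inter_comm, ← setLIntegral_indicator hball, lintegral_rightHalfPlane_polar y,
    Measure.volume_eq_prod, ← Measure.prod_restrict]
  -- Only an upper bound is needed, and this direction of Tonelli requires no measurability. Each
  -- radius below `ρ` contributes at most `η`, and the others nothing, which gives `η * ρ`.
  refine (lintegral_prod_le _).trans ?_
  have hbound : ∀ r ∈ Set.Ioi (0 : ℝ), ∫⁻ θ in Set.Ioo (-(Real.pi / 2)) (Real.pi / 2),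
      ENNReal.ofReal r * (Metric.ball ((y : ℂ) * Complex.I) ρ).indicator
        (fun s => ‖Real.log ‖S s‖‖ₑ) (circleMap ((y : ℂ) * Complex.I) r θ) ≤
      (Set.Ioo 0 ρ).indicator (fun _ => ENNReal.ofReal η) r := by
    intro r hr
    have hr0 : (0 : ℝ) < r := hr
    by_cases hrρ : r < ρ
    · rw [Set.indicator_of_mem (show r ∈ Set.Ioo 0 ρ from ⟨hr, hrρ⟩)]
      refine le_trans (lintegral_mono fun θ => ?_) (key r ⟨hr, hrρ⟩)
      exact mul_le_mul_right (Set.indicator_le_self _ _ _) _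
    · have : ∀ θ, circleMap ((y : ℂ) * Complex.I) r θ ∉
          Metric.ball ((y : ℂ) * Complex.I) ρ := fun θ h => by
        rw [mem_ball_iff_norm] at h
        simp [abs_of_pos hr0] at h
        exact hrρ h
      simp [this]
  refine (setLIntegral_mono' measurableSet_Ioi hbound).trans ?_
  rw [setLIntegral_indicator measurableSet_Ioo, setLIntegral_const]
  refine (mul_le_mul_right (measure_mono Set.inter_subset_left) _).trans ?_
  rw [Real.volume_Ioo, sub_zero, ← ENNReal.ofReal_mul hη.le]

/-- At regular points this is the local decomposition, and at exceptional points the half disc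
estimate. Points to the left are harmless because the measure is restricted. -/
theorem locallyIntegrable_log_norm (hS : IsWeierstrassFactorization S g p d c E U)
    (hE : ∀ y ∈ E, LogRegularAt S y) :
    LocallyIntegrable (fun s => Real.log ‖S s‖) (volume.restrict rightHalfPlane) := by
  intro s
  rcases lt_or_ge s.re 0 with hs | hs
  · refine ⟨{z | z.re < 0}, (isOpen_lt Complex.continuous_re continuous_const).mem_nhds hs, ?_⟩
    rw [IntegrableOn, Measure.restrict_restrict
      (isOpen_lt Complex.continuous_re continuous_const).measurableSet]
    have : {z : ℂ | z.re < 0} ∩ rightHalfPlane = ∅ := by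
      ext z; simp only [Set.mem_inter_iff, rightHalfPlane, Set.mem_ofPred_eq,
        Set.mem_empty_iff_false, iff_false, not_and, not_lt]; exact le_of_lt
    simp [this]
  · by_cases hreg : s ∈ regularPart E
    · obtain ⟨r, hr, hsub⟩ := exists_closedBall_inter_subset_regularPart
        hS.isClosed_exceptional hreg
      refine ⟨Metric.closedBall s r, Metric.closedBall_mem_nhds _ hr, ?_⟩
      rw [IntegrableOn, Measure.restrict_restrict measurableSet_closedBall]
      exact (hS.integrableOn_log_norm (isCompact_closedBall_inter s r) hsub).mono_set
        (Set.inter_subset_inter_right _ fun z hz => (show 0 < z.re from hz).le)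
    · have : ∃ y ∈ E, s = (y : ℂ) * Complex.I := by
        by_contra! h; exact hreg ⟨hs, h⟩
      obtain ⟨y, hy, rfl⟩ := this
      obtain ⟨ρ, hle, hρ⟩ := ((hS.eventually_lintegral_half_disc_le hE hy one_pos).and
        self_mem_nhdsWithin).exists
      refine ⟨Metric.ball _ ρ, Metric.ball_mem_nhds _ hρ, ?_⟩
      rw [IntegrableOn, Measure.restrict_restrict measurableSet_ball, Set.inter_comm]
      refine ⟨hS.aestronglyMeasurable_log_norm.mono_measure
        (Measure.restrict_mono Set.inter_subset_left le_rfl), ?_⟩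
      exact hle.trans_lt ENNReal.ofReal_lt_top

end IsWeierstrassFactorization
end Factorization
end BodeSensitivity

/-! ### Bump functions around exceptional points -/

namespace BodeSensitivity

section Cutoff

lemma dx_mul {f h : ℂ → ℝ} {s : ℂ} (hf : DifferentiableAt ℝ f s) (hh : DifferentiableAt ℝ h s) :
    dx (fun z => f z * h z) s = f s * dx h s + h s * dx f s := by
  have e : dx (fun z => f z * h z) s = _ :=
    congrArg (fun T : ℂ →L[ℝ] ℝ => T 1) (hf.hasFDerivAt.mul hh.hasFDerivAt).fderiv
  rw [e]
  simp only [add_apply, smul_apply, smul_eq_mul]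
  rfl

lemma dy_mul {f h : ℂ → ℝ} {s : ℂ} (hf : DifferentiableAt ℝ f s) (hh : DifferentiableAt ℝ h s) :
    dy (fun z => f z * h z) s = f s * dy h s + h s * dy f s := by
  have e : dy (fun z => f z * h z) s = _ :=
    congrArg (fun T : ℂ →L[ℝ] ℝ => T Complex.I) (hf.hasFDerivAt.mul hh.hasFDerivAt).fderiv
  rw [e]
  simp only [add_apply, smul_apply, smul_eq_mul]
  rfl

lemma dx_add {f h : ℂ → ℝ} {s : ℂ} (hf : DifferentiableAt ℝ f s) (hh : DifferentiableAt ℝ h s) :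
    dx (fun z => f z + h z) s = dx f s + dx h s := by
  have e : dx (fun z => f z + h z) s = _ :=
    congrArg (fun T : ℂ →L[ℝ] ℝ => T 1) (hf.hasFDerivAt.add hh.hasFDerivAt).fderiv
  rw [e]; rfl

lemma dy_add {f h : ℂ → ℝ} {s : ℂ} (hf : DifferentiableAt ℝ f s) (hh : DifferentiableAt ℝ h s) :
    dy (fun z => f z + h z) s = dy f s + dy h s := by
  have e : dy (fun z => f z + h z) s = _ :=
    congrArg (fun T : ℂ →L[ℝ] ℝ => T Complex.I) (hf.hasFDerivAt.add hh.hasFDerivAt).fderiv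
  rw [e]; rfl

lemma contDiff_one_dx {f : ℂ → ℝ} (hf : ContDiff ℝ 2 f) : ContDiff ℝ 1 (dx f) :=
  contDiff_iff_contDiffAt.2 fun _ => contDiffAt_dx hf.contDiffAt one_add_one_le_two

lemma contDiff_one_dy {f : ℂ → ℝ} (hf : ContDiff ℝ 2 f) : ContDiff ℝ 1 (dy f) :=
  contDiff_iff_contDiffAt.2 fun _ => contDiffAt_dy hf.contDiffAt one_add_one_le_two

lemma continuous_lap_of_contDiff {f : ℂ → ℝ} (hf : ContDiff ℝ 2 f) : Continuous (lap f) :=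
  continuous_iff_continuousAt.2 fun _ => continuousAt_lap hf.contDiffAt

lemma lap_mul {f h : ℂ → ℝ} (hf : ContDiff ℝ 2 f) (hh : ContDiff ℝ 2 h) (s : ℂ) :
    lap (fun z => f z * h z) s =
      h s * lap f s + 2 * (dx f s * dx h s + dy f s * dy h s) + f s * lap h s := by
  have df := hf.differentiable two_ne_zero
  have dh := hh.differentiable two_ne_zero
  have dfx := (contDiff_one_dx hf).differentiable one_ne_zero
  have dfy := (contDiff_one_dy hf).differentiable one_ne_zero
  have dhx := (contDiff_one_dx hh).differentiable one_ne_zero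
  have dhy := (contDiff_one_dy hh).differentiable one_ne_zero
  have ex : dx (fun z => f z * h z) = fun z => f z * dx h z + h z * dx f z :=
    funext fun z => dx_mul (df z) (dh z)
  have ey : dy (fun z => f z * h z) = fun z => f z * dy h z + h z * dy f z :=
    funext fun z => dy_mul (df z) (dh z)
  rw [lap, ex, ey, dx_add ((df s).fun_mul (dhx s)) ((dh s).fun_mul (dfx s)),
    dy_add ((df s).fun_mul (dhy s)) ((dh s).fun_mul (dfy s)), dx_mul (df s) (dhx s), dx_mul (dh s) (dfx s),
    dy_mul (df s) (dhy s), dy_mul (dh s) (dfy s), lap, lap]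
  ring

lemma lap_sub {f h : ℂ → ℝ} (hf : ContDiff ℝ 2 f) (hh : ContDiff ℝ 2 h) (s : ℂ) :
    lap (fun z => f z - h z) s = lap f s - lap h s := by
  have e : (fun z => f z - h z) = fun z => f z + (fun _ => (-1 : ℝ)) z * h z := by
    ext z; ring
  have dx0 (a : ℝ) : dx (fun _ : ℂ => a) = fun _ => 0 := by ext z; simp [dx]
  have dy0 (a : ℝ) : dy (fun _ : ℂ => a) = fun _ => 0 := by ext z; simp [dy]
  have df := hf.differentiable two_ne_zero
  have hc : ContDiff ℝ 2 fun z => (fun _ => (-1 : ℝ)) z * h z := contDiff_const.mul hh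
  have dc := hc.differentiable two_ne_zero
  have ex : dx (fun z => f z + (fun _ => (-1 : ℝ)) z * h z) = fun z => dx f z +
      dx (fun z => (fun _ => (-1 : ℝ)) z * h z) z := funext fun z => dx_add (df z) (dc z)
  have ey : dy (fun z => f z + (fun _ => (-1 : ℝ)) z * h z) = fun z => dy f z +
      dy (fun z => (fun _ => (-1 : ℝ)) z * h z) z := funext fun z => dy_add (df z) (dc z)
  have el : lap (fun z => f z + (fun _ => (-1 : ℝ)) z * h z) s =
      lap f s + lap (fun z => (fun _ => (-1 : ℝ)) z * h z) s := by
    rw [lap, ex, ey, dx_add ((contDiff_one_dx hf).differentiable one_ne_zero s)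
      ((contDiff_one_dx hc).differentiable one_ne_zero s),
      dy_add ((contDiff_one_dy hf).differentiable one_ne_zero s)
      ((contDiff_one_dy hc).differentiable one_ne_zero s), lap, lap]
    ring
  rw [e, el, lap_mul contDiff_const hh]
  simp only [lap, dx0, dy0]
  ring

/-- The bump function around `q` of radii `ε` and `2 ε`. -/
noncomputable def bump (q : ℂ) (ε : ℝ) (s : ℂ) : ℝ :=
  (⟨1, 2, one_pos, one_lt_two⟩ : ContDiffBump (0 : ℂ)) (ε⁻¹ • (s - q))

lemma contDiff_bump (q : ℂ) (ε : ℝ) : ContDiff ℝ 2 (bump q ε) :=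
  (ContDiffBump.contDiff _).comp (f := fun s => ε⁻¹ • (s - q)) (by fun_prop)

lemma bump_nonneg (q : ℂ) (ε : ℝ) (s : ℂ) : 0 ≤ bump q ε s := ContDiffBump.nonneg _

lemma bump_le_one (q : ℂ) (ε : ℝ) (s : ℂ) : bump q ε s ≤ 1 := ContDiffBump.le_one _

lemma bump_eq_one {q s : ℂ} {ε : ℝ} (hε : 0 < ε) (h : ‖s - q‖ ≤ ε) : bump q ε s = 1 := by
  refine ContDiffBump.one_of_mem_closedBall _ ?_
  rw [mem_closedBall_zero_iff, norm_smul, norm_inv, Real.norm_of_nonneg hε.le]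
  exact inv_mul_le_one_of_le₀ h hε.le

lemma bump_eq_zero {q s : ℂ} {ε : ℝ} (hε : 0 < ε) (h : 2 * ε ≤ ‖s - q‖) : bump q ε s = 0 := by
  refine ContDiffBump.zero_of_le_dist _ ?_
  rw [dist_zero_right, norm_smul, norm_inv, Real.norm_of_nonneg hε.le, inv_mul_eq_div,
    le_div_iff₀ hε]
  exact h

lemma bump_eq_comp (q : ℂ) (ε : ℝ) : bump q ε = fun s => bump 0 1 (ε⁻¹ • (s - q)) := by
  ext s; simp [bump]

lemma fderiv_comp_affine {f : ℂ → ℝ} (hf : Differentiable ℝ f) (q : ℂ) (a : ℝ) (s v : ℂ) :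
    fderiv ℝ (fun s => f (a • (s - q))) s v = a * fderiv ℝ f (a • (s - q)) v := by
  have h1 : HasFDerivAt (fun s : ℂ => a • (s - q)) (a • ContinuousLinearMap.id ℝ ℂ) s :=
    ((hasFDerivAt_id s).sub_const q).const_smul a
  have h2 := ((hf (a • (s - q))).hasFDerivAt.comp s h1).fderiv
  have h3 : fderiv ℝ (fun s => f (a • (s - q))) s = _ := h2
  rw [h3]
  simp

lemma dx_bump (q : ℂ) (ε : ℝ) (s : ℂ) : dx (bump q ε) s = ε⁻¹ * dx (bump 0 1) (ε⁻¹ • (s - q)) := by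
  rw [bump_eq_comp, dx, fderiv_comp_affine ((contDiff_bump 0 1).differentiable two_ne_zero)]
  rfl

lemma dy_bump (q : ℂ) (ε : ℝ) (s : ℂ) : dy (bump q ε) s = ε⁻¹ * dy (bump 0 1) (ε⁻¹ • (s - q)) := by
  rw [bump_eq_comp, dy, fderiv_comp_affine ((contDiff_bump 0 1).differentiable two_ne_zero)]
  rfl

lemma lap_bump (q : ℂ) (ε : ℝ) (s : ℂ) :
    lap (bump q ε) s = (ε⁻¹) ^ 2 * lap (bump 0 1) (ε⁻¹ • (s - q)) := by
  have ex : dx (bump q ε) = fun s => ε⁻¹ * dx (bump 0 1) (ε⁻¹ • (s - q)) := funext (dx_bump q ε)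
  have ey : dy (bump q ε) = fun s => ε⁻¹ * dy (bump 0 1) (ε⁻¹ • (s - q)) := funext (dy_bump q ε)
  have hx := (contDiff_one_dx (contDiff_bump 0 1)).differentiable one_ne_zero
  have hy := (contDiff_one_dy (contDiff_bump 0 1)).differentiable one_ne_zero
  have haff (s : ℂ) : DifferentiableAt ℝ (fun s : ℂ => ε⁻¹ • (s - q)) s := by fun_prop
  have cx : DifferentiableAt ℝ (fun s => dx (bump 0 1) (ε⁻¹ • (s - q))) s := (hx _).comp s (haff s)
  have cy : DifferentiableAt ℝ (fun s => dy (bump 0 1) (ε⁻¹ • (s - q))) s := (hy _).comp s (haff s)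
  rw [lap, ex, ey, dx_mul (differentiableAt_const _) cx, dy_mul (differentiableAt_const _) cy, dx, dy, fderiv_comp_affine hx,
    fderiv_comp_affine hy, lap]
  simp only [dx, dy, fderiv_fun_const, Pi.zero_apply, zero_apply, mul_zero, add_zero]
  ring

lemma hasCompactSupport_bump (q : ℂ) {ε : ℝ} (hε : 0 < ε) : HasCompactSupport (bump q ε) :=
  HasCompactSupport.intro (isCompact_closedBall q (2 * ε)) fun s hs => by
    rw [mem_closedBall_iff_norm, not_le] at hs
    exact bump_eq_zero hε hs.le

lemma tsupport_bump_subset (q : ℂ) {ε : ℝ} (hε : 0 < ε) :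
    tsupport (bump q ε) ⊆ Metric.ball q (3 * ε) := by
  refine (closure_minimal (fun s hs => ?_) Metric.isClosed_closedBall).trans
    (Metric.closedBall_subset_ball (by linarith : 2 * ε < 3 * ε))
  by_contra h
  rw [mem_closedBall_iff_norm, not_le] at h
  exact hs (bump_eq_zero hε h.le)

lemma exists_bound_of_hasCompactSupport {f : ℂ → ℝ} (hf : Continuous f)
    (hc : HasCompactSupport f) : ∃ C, 0 ≤ C ∧ ∀ s, |f s| ≤ C := by
  obtain ⟨C, hC⟩ := hf.bounded_above_of_compact_support hc
  exact ⟨C, (norm_nonneg _).trans (hC 0), hC⟩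

variable {φ : ℂ → ℝ}

lemma IsTest.mul (hφ : IsTest φ) {χ : ℂ → ℝ} (hχ : ContDiff ℝ 2 χ) :
    IsTest fun s => φ s * χ s :=
  ⟨hφ.contDiff.mul hχ, hφ.hasCompactSupport.mul_right, fun s hs => by rw [hφ.eq_zero s hs, zero_mul]⟩

/-- `φ` is Lipschitz and vanishes on the axis, which is at distance `|s.re|` from `s`. -/
lemma IsTest.abs_le (hφ : IsTest φ) : ∃ C, 0 ≤ C ∧ ∀ s, |φ s| ≤ C * |s.re| := by
  obtain ⟨C, hC⟩ := hφ.contDiff.lipschitzWith_of_hasCompactSupport hφ.hasCompactSupport two_ne_zero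
  refine ⟨C, C.2, fun s => ?_⟩
  have h := hC.dist_le_mul s ((s.im : ℂ) * Complex.I)
  rw [hφ.eq_zero _ (re_axis _), Real.dist_eq, sub_zero, dist_eq_norm] at h
  have e : s - (s.im : ℂ) * Complex.I = (s.re : ℂ) := by
    rw [sub_eq_iff_eq_add, Complex.re_add_im]
  rwa [e, Complex.norm_real, Real.norm_eq_abs] at h

/-- The Laplacian of the bump is `O(ε⁻²)`, but it is multiplied by `φ = O(ε)`; the cross terms are
`O(ε⁻¹)`. The power of `ε` gained from the vanishing of `φ` on the axis is what the `o(ε)` half disc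
estimate needs. The radius `3 * ε` gives an open ball around the closed support. -/
lemma IsTest.abs_lap_mul_bump_le (hφ : IsTest φ) (y : ℝ) : ∃ C, 0 ≤ C ∧ ∀ ε, 0 < ε → ε ≤ 1 →
    ∀ s, |lap (fun z => φ z * bump (y * Complex.I) ε z) s| ≤
      (Metric.ball ((y : ℂ) * Complex.I) (3 * ε)).indicator (fun _ => C / ε) s := by
  obtain ⟨C, hC0, hC⟩ := hφ.abs_le
  obtain ⟨L, hL0, hL⟩ := exists_bound_of_hasCompactSupport hφ.continuous_lap hφ.hasCompactSupport_lap
  obtain ⟨X, hX0, hX⟩ := exists_bound_of_hasCompactSupport hφ.contDiff_dx.continuous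
    hφ.hasCompactSupport_dx
  obtain ⟨Y, hY0, hY⟩ := exists_bound_of_hasCompactSupport hφ.contDiff_dy.continuous
    (hφ.hasCompactSupport.mono' ((subset_tsupport _).trans (tsupport_dy_subset φ)))
  have hb := hasCompactSupport_bump 0 one_pos
  obtain ⟨L', hL0', hL'⟩ := exists_bound_of_hasCompactSupport (continuous_lap_of_contDiff (contDiff_bump 0 1))
    (hb.mono' ((subset_tsupport _).trans (tsupport_lap_subset _)))
  obtain ⟨X', hX0', hX'⟩ := exists_bound_of_hasCompactSupport (contDiff_one_dx (contDiff_bump 0 1)).continuous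
    (hb.mono' ((subset_tsupport _).trans (tsupport_dx_subset _)))
  obtain ⟨Y', hY0', hY'⟩ := exists_bound_of_hasCompactSupport (contDiff_one_dy (contDiff_bump 0 1)).continuous
    (hb.mono' ((subset_tsupport _).trans (tsupport_dy_subset _)))
  refine ⟨L + 2 * (X * X' + Y * Y') + 3 * C * L', by positivity, fun ε hε hε1 s => ?_⟩
  by_cases hs : s ∈ Metric.ball ((y : ℂ) * Complex.I) (3 * ε)
  · rw [Set.indicator_of_mem hs, lap_mul hφ.contDiff (contDiff_bump _ _), dx_bump, dy_bump, lap_bump]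
    have hre : |s.re| ≤ 3 * ε := by
      rw [mem_ball_iff_norm] at hs
      have := Complex.abs_re_le_norm (s - (y : ℂ) * Complex.I)
      rw [Complex.sub_re, re_axis, sub_zero] at this
      linarith
    set z := ε⁻¹ • (s - (y : ℂ) * Complex.I)
    have b1 : |bump (y * Complex.I) ε s * lap φ s| ≤ L / ε := by
      rw [abs_mul, abs_of_nonneg (bump_nonneg _ _ _)]
      calc _ ≤ 1 * L := mul_le_mul (bump_le_one _ _ _) (hL s) (abs_nonneg _) zero_le_one
        _ ≤ L / ε := by rw [one_mul, le_div_iff₀ hε]; nlinarith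
    have b2 : |dx φ s * (ε⁻¹ * dx (bump 0 1) z)| ≤ X * X' / ε := by
      have := mul_le_mul (hX s) (hX' z) (abs_nonneg _) hX0
      rw [mul_left_comm, abs_mul, abs_mul, abs_of_pos (inv_pos.2 hε), inv_mul_eq_div]
      gcongr
    have b3 : |dy φ s * (ε⁻¹ * dy (bump 0 1) z)| ≤ Y * Y' / ε := by
      have := mul_le_mul (hY s) (hY' z) (abs_nonneg _) hY0
      rw [mul_left_comm, abs_mul, abs_mul, abs_of_pos (inv_pos.2 hε), inv_mul_eq_div]
      gcongr
    have b4 : |φ s * (ε⁻¹ ^ 2 * lap (bump 0 1) z)| ≤ 3 * C * L' / ε := by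
      have h1 : |φ s| ≤ C * (3 * ε) := (hC s).trans (mul_le_mul_of_nonneg_left hre hC0)
      have := mul_le_mul h1 (hL' z) (abs_nonneg _) (by positivity)
      rw [mul_left_comm, abs_mul, abs_mul, abs_of_pos (by positivity : 0 < ε⁻¹ ^ 2)]
      calc ε⁻¹ ^ 2 * (|φ s| * |lap (bump 0 1) z|) ≤ ε⁻¹ ^ 2 * (C * (3 * ε) * L') := by gcongr
        _ = 3 * C * L' / ε := by field_simp
    have e : (L + 2 * (X * X' + Y * Y') + 3 * C * L') / ε =
        L / ε + 2 * (X * X' / ε + Y * Y' / ε) + 3 * C * L' / ε := by ring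
    rw [e]
    refine (abs_add_le _ _).trans (add_le_add ((abs_add_le _ _).trans (add_le_add b1 ?_)) b4)
    rw [abs_mul, abs_two]
    have := (abs_add_le _ _).trans (add_le_add b2 b3)
    linarith
  · rw [Set.indicator_of_notMem hs, lap_eq_zero_of_notMem_tsupport, abs_zero]
    intro h
    exact hs (tsupport_bump_subset _ hε (closure_mono (fun z hz => right_ne_zero_of_mul hz) h))

end Cutoff
end BodeSensitivity

/-! ### Green's formula across exceptional points -/

namespace BodeSensitivity

variable {ι : Type*} {S g : ℂ → ℂ} {p : ι → ℂ} {d : ι → ℝ} {c : ι → ℂ → ℂ} {E : Set ℝ} {U : Set ℂ}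
  {φ : ℂ → ℝ}

lemma contDiff_one_sub_bump (q : ℂ) (ε : ℝ) : ContDiff ℝ 2 fun s => 1 - bump q ε s :=
  contDiff_const.sub (contDiff_bump q ε)

namespace IsWeierstrassFactorization

lemma integrableOn_log_norm_mul_lap (hS : IsWeierstrassFactorization S g p d c E U)
    (hE : ∀ y ∈ E, LogRegularAt S y) (hφ : IsTest φ) :
    IntegrableOn (fun s => Real.log ‖S s‖ * lap φ s) rightHalfPlane :=
  (hS.locallyIntegrable_log_norm hE).integrable_smul_right_of_hasCompactSupport
    hφ.continuous_lap hφ.hasCompactSupport_lap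

lemma integrable_log_norm_mul_dx (hS : IsWeierstrassFactorization S g p d c E U)
    (hE : ∀ y ∈ E, LogRegularAt S y) (hφ : IsTest φ) :
    Integrable fun y : ℝ => Real.log ‖S (y * Complex.I)‖ * dx φ (y * Complex.I) :=
  (hS.locallyIntegrable_log_norm_axis hE).integrable_smul_right_of_hasCompactSupport
    hφ.axis_continuous hφ.axis_hasCompactSupport

/-- The error is at most `C / ε` times the integral of `|log ‖S‖|` over the half disc of radius `3 *
ε`, and that integral is `o(ε)`. -/
lemma tendsto_integral_lap_cutoff (hS : IsWeierstrassFactorization S g p d c E U)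
    (hE : ∀ y ∈ E, LogRegularAt S y) (hφ : IsTest φ) {y : ℝ} (hy : y ∈ E) :
    Tendsto (fun ε => ∫ s in rightHalfPlane, Real.log ‖S s‖ *
      lap (fun s => φ s * (1 - bump (y * Complex.I) ε s)) s) (𝓝[>] 0)
      (𝓝 (∫ s in rightHalfPlane, Real.log ‖S s‖ * lap φ s)) := by
  obtain ⟨C, hC0, hC⟩ := hφ.abs_lap_mul_bump_le y
  have hsplit (ε : ℝ) : ∫ s in rightHalfPlane, Real.log ‖S s‖ *
      lap (fun s => φ s * (1 - bump (y * Complex.I) ε s)) s =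
      (∫ s in rightHalfPlane, Real.log ‖S s‖ * lap φ s) - ∫ s in rightHalfPlane,
        Real.log ‖S s‖ * lap (fun s => φ s * bump (y * Complex.I) ε s) s := by
    have hb := hφ.mul (contDiff_bump (y * Complex.I) ε)
    rw [← integral_sub (hS.integrableOn_log_norm_mul_lap hE hφ)
      (hS.integrableOn_log_norm_mul_lap hE hb)]
    congr 1
    ext s
    rw [← mul_sub, ← lap_sub hφ.contDiff hb.contDiff]
    simp only [mul_sub, mul_one]
  have hsmall : Tendsto (fun ε => ∫ s in rightHalfPlane,
      Real.log ‖S s‖ * lap (fun s => φ s * bump (y * Complex.I) ε s) s) (𝓝[>] 0) (𝓝 0) := by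
    rw [Metric.tendsto_nhds]
    intro δ hδ
    -- The final bound is `3 * C * η`; the added `1` makes it strictly less than `δ` and covers `C =
    -- 0`.
    have hη : 0 < δ / (3 * C + 1) := by positivity
    have h3 : Tendsto (fun ε : ℝ => 3 * ε) (𝓝[>] 0) (𝓝[>] 0) := by
      refine tendsto_nhdsWithin_iff.2 ⟨?_, ?_⟩
      · have : Tendsto (fun ε : ℝ => 3 * ε) (𝓝 0) (𝓝 (3 * 0)) := tendsto_id.const_mul 3
        rw [mul_zero] at this
        exact this.mono_left nhdsWithin_le_nhds
      · filter_upwards [self_mem_nhdsWithin] with ε hε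
        exact mul_pos three_pos (show 0 < ε from hε)
    filter_upwards [h3.eventually (hS.eventually_lintegral_half_disc_le hE hy hη),
      Ioo_mem_nhdsGT one_pos] with ε hε hε1
    rw [dist_zero_right, ← ENNReal.ofReal_lt_ofReal_iff hδ, ofReal_norm]
    have hball : MeasurableSet (Metric.ball ((y : ℂ) * Complex.I) (3 * ε)) := measurableSet_ball
    calc ‖∫ s in rightHalfPlane,
          Real.log ‖S s‖ * lap (fun s => φ s * bump (y * Complex.I) ε s) s‖ₑ
        ≤ ∫⁻ s in rightHalfPlane,
          ‖Real.log ‖S s‖ * lap (fun s => φ s * bump (y * Complex.I) ε s) s‖ₑ :=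
          enorm_integral_le_lintegral_enorm _
      _ ≤ ∫⁻ s in rightHalfPlane, (Metric.ball ((y : ℂ) * Complex.I) (3 * ε)).indicator
          (fun s => ENNReal.ofReal (C / ε) * ‖Real.log ‖S s‖‖ₑ) s := by
          refine lintegral_mono fun s => ?_
          rw [enorm_mul, mul_comm, Real.enorm_eq_ofReal_abs (lap _ _)]
          have := hC ε hε1.1 hε1.2.le s
          by_cases hs : s ∈ Metric.ball ((y : ℂ) * Complex.I) (3 * ε)
          · rw [Set.indicator_of_mem hs] at this ⊢
            gcongr
          · rw [Set.indicator_of_notMem hs] at this ⊢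
            rw [ENNReal.ofReal_eq_zero.2 this, zero_mul]
      _ = ENNReal.ofReal (C / ε) * ∫⁻ s in rightHalfPlane ∩
          Metric.ball ((y : ℂ) * Complex.I) (3 * ε), ‖Real.log ‖S s‖‖ₑ := by
          rw [setLIntegral_indicator hball, Set.inter_comm,
            lintegral_const_mul' _ _ ENNReal.ofReal_ne_top]
      _ ≤ ENNReal.ofReal (C / ε) * ENNReal.ofReal (δ / (3 * C + 1) * (3 * ε)) := by gcongr
      _ = ENNReal.ofReal (3 * C * (δ / (3 * C + 1))) := by
          rw [← ENNReal.ofReal_mul (by have := hε1.1; positivity)]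
          congr 1
          have := hε1.1.ne'
          field_simp
      _ < ENNReal.ofReal δ := by
          rw [ENNReal.ofReal_lt_ofReal_iff hδ, mul_div_assoc', div_lt_iff₀ (by positivity)]
          nlinarith
  simp only [hsplit]
  simpa using tendsto_const_nhds.sub hsmall

/-- On the axis the derivative of the bump is multiplied by `φ = 0`, so the cutoff enters only as a
factor in `[0, 1]` and dominated convergence applies. -/
lemma tendsto_integral_axis_cutoff (hS : IsWeierstrassFactorization S g p d c E U)
    (hE : ∀ y ∈ E, LogRegularAt S y) (hφ : IsTest φ) (y : ℝ) :
    Tendsto (fun ε => ∫ t : ℝ, Real.log ‖S (t * Complex.I)‖ *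
      dx (fun s => φ s * (1 - bump (y * Complex.I) ε s)) (t * Complex.I)) (𝓝[>] 0)
      (𝓝 (∫ t : ℝ, Real.log ‖S (t * Complex.I)‖ * dx φ (t * Complex.I))) := by
  have hdx (ε t : ℝ) : dx (fun s => φ s * (1 - bump (y * Complex.I) ε s)) (t * Complex.I) =
      (1 - bump (y * Complex.I) ε (t * Complex.I)) * dx φ (t * Complex.I) := by
    rw [dx_mul (hφ.contDiff.differentiable two_ne_zero _)
      ((contDiff_one_sub_bump _ ε).differentiable two_ne_zero _), hφ.eq_zero _ (re_axis t)]
    ring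
  have hi := hS.integrable_log_norm_mul_dx hE hφ
  refine tendsto_integral_filter_of_dominated_convergence
    (fun t : ℝ => ‖Real.log ‖S (t * Complex.I)‖ * dx φ (t * Complex.I)‖) ?_ ?_ hi.norm ?_
  · exact Eventually.of_forall fun ε => (hS.integrable_log_norm_mul_dx hE
      (hφ.mul (contDiff_one_sub_bump _ ε))).aestronglyMeasurable
  · refine Eventually.of_forall fun ε => ae_of_all _ fun t => ?_
    rw [hdx, mul_left_comm, norm_mul]
    refine mul_le_of_le_one_left (norm_nonneg _) ?_
    rw [Real.norm_eq_abs, abs_le]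
    have h1 := bump_nonneg ((y : ℂ) * Complex.I) ε (t * Complex.I)
    have h2 := bump_le_one ((y : ℂ) * Complex.I) ε (t * Complex.I)
    constructor <;> linarith
  · filter_upwards [Measure.ae_ne volume y] with t ht
    have hpos : 0 < |t - y| := abs_pos.2 (sub_ne_zero.2 ht)
    refine tendsto_const_nhds.congr' ?_
    filter_upwards [Ioo_mem_nhdsGT (half_pos hpos)] with ε hε
    rw [hdx, bump_eq_zero hε.1, sub_zero, one_mul]
    rw [← sub_mul, norm_mul, Complex.norm_I, mul_one, ← Complex.ofReal_sub, Complex.norm_real,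
      Real.norm_eq_abs]
    linarith [hε.2]

/-- The two integrals converge as `ε → 0`, so the cut-off pole sums have a finite limit. As the
terms are nonnegative, this limit bounds every finite partial sum of the full series. Summability is
thus a consequence, and dominated convergence then identifies the limit with the full sum. -/
lemma greenFormula_of_cutoff (hS : IsWeierstrassFactorization S g p d c E U)
    (hE : ∀ y ∈ E, LogRegularAt S y) (hφ : IsTest φ) (hpos : ∀ s : ℂ, 0 ≤ s.re → 0 ≤ φ s)
    {y : ℝ} (hy : y ∈ E)
    (h : ∀ ε, 0 < ε → Summable (fun j => d j * (φ (p j) * (1 - bump (y * Complex.I) ε (p j)))) ∧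
      GreenFormula (fun s => φ s * (1 - bump (y * Complex.I) ε s)) (fun s => Real.log ‖S s‖)
        (∑' j, d j * (φ (p j) * (1 - bump (y * Complex.I) ε (p j))))) :
    Summable (fun j => d j * φ (p j)) ∧
      GreenFormula φ (fun s => Real.log ‖S s‖) (∑' j, d j * φ (p j)) := by
  have hterm (j : ι) : 0 ≤ d j * φ (p j) :=
    mul_nonneg (hS.order_pos j).le (hpos _ (hS.pole_re_pos j).le)
  have hle (ε : ℝ) (j : ι) : d j * (φ (p j) * (1 - bump (y * Complex.I) ε (p j))) ≤ d j * φ (p j) := by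
    rw [← mul_assoc]
    exact mul_le_of_le_one_right (hterm j) (by linarith [bump_nonneg (y * Complex.I) ε (p j)])
  have hnn (ε : ℝ) (j : ι) : 0 ≤ d j * (φ (p j) * (1 - bump (y * Complex.I) ε (p j))) := by
    rw [← mul_assoc]
    exact mul_nonneg (hterm j) (by linarith [bump_le_one (y * Complex.I) ε (p j)])
  have hpt (j : ι) : Tendsto (fun ε => d j * (φ (p j) * (1 - bump (y * Complex.I) ε (p j))))
      (𝓝[>] 0) (𝓝 (d j * φ (p j))) := by
    have hne : 0 < ‖p j - (y : ℂ) * Complex.I‖ := norm_pos_iff.2 (sub_ne_zero.2 fun h => by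
      have := hS.pole_re_pos j
      rw [h, re_axis] at this
      exact lt_irrefl _ this)
    refine tendsto_const_nhds.congr' ?_
    filter_upwards [Ioo_mem_nhdsGT (half_pos hne)] with ε hε
    rw [bump_eq_zero hε.1 (by linarith [hε.2]), sub_zero, mul_one]
  -- The value that Green's formula forces on the pole sum.
  set Λ : ℝ := ((∫ s in rightHalfPlane, Real.log ‖S s‖ * lap φ s) +
    ∫ t : ℝ, Real.log ‖S (t * Complex.I)‖ * dx φ (t * Complex.I)) / (2 * Real.pi) with hΛ
  have hlim : Tendsto (fun ε => ∑' j, d j * (φ (p j) * (1 - bump (y * Complex.I) ε (p j))))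
      (𝓝[>] 0) (𝓝 Λ) := by
    refine (((hS.tendsto_integral_lap_cutoff hE hφ hy).add
      (hS.tendsto_integral_axis_cutoff hE hφ y)).div_const (2 * Real.pi)).congr' ?_
    filter_upwards [self_mem_nhdsWithin] with ε hε
    rw [(h ε hε).2.eq, sub_add_cancel, mul_div_cancel_left₀ _ Real.two_pi_pos.ne']
  have hsum : Summable (fun j => d j * φ (p j)) := by
    refine summable_of_sum_le (c := Λ) hterm fun J => ?_
    refine le_of_tendsto_of_tendsto (tendsto_finsetSum J fun j _ => hpt j) hlim ?_
    filter_upwards [self_mem_nhdsWithin] with ε hε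
    exact (h ε hε).1.sum_le_tsum J fun j _ => hnn ε j
  have hlim' : Tendsto (fun ε => ∑' j, d j * (φ (p j) * (1 - bump (y * Complex.I) ε (p j))))
      (𝓝[>] 0) (𝓝 (∑' j, d j * φ (p j))) := by
    refine tendsto_tsum_of_dominated_convergence hsum hpt (Eventually.of_forall fun ε j => ?_)
    rw [Real.norm_of_nonneg (hnn ε j)]
    exact hle ε j
  refine ⟨hsum, hS.integrableOn_log_norm_mul_lap hE hφ, hS.integrable_log_norm_mul_dx hE hφ, ?_⟩
  rw [tendsto_nhds_unique hlim' hlim, hΛ, mul_div_cancel₀ _ Real.two_pi_pos.ne']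
  ring

/-- Green's formula for `log |S|` and nonnegative test functions that need not vanish near the
exceptional points. -/
theorem greenFormula_of_nonneg (hS : IsWeierstrassFactorization S g p d c E U)
    (hE : ∀ y ∈ E, LogRegularAt S y) (hφ : IsTest φ) (hpos : ∀ s : ℂ, 0 ≤ s.re → 0 ≤ φ s) :
    Summable (fun j => d j * φ (p j)) ∧
      GreenFormula φ (fun s => Real.log ‖S s‖) (∑' j, d j * φ (p j)) := by
  classical
  -- Induction on a finite set containing the exceptional points in the support. The factor `1 -
  -- bump` removes one of them and preserves nonnegativity, so the statement has to range over all
  -- `φ`.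
  have main : ∀ (F : Finset ℝ) (φ : ℂ → ℝ), IsTest φ → (∀ s : ℂ, 0 ≤ s.re → 0 ≤ φ s) →
      (∀ y ∈ E, (y : ℂ) * Complex.I ∈ tsupport φ → y ∈ F) →
      Summable (fun j => d j * φ (p j)) ∧
        GreenFormula φ (fun s => Real.log ‖S s‖) (∑' j, d j * φ (p j)) := by
    intro F
    induction F using Finset.induction_on with
    | empty =>
      intro φ hφ _ hF
      exact hS.greenFormula hφ fun s hs => ⟨hs.2, fun y hy h =>
        absurd (hF y hy (h ▸ hs.1)) (Finset.notMem_empty y)⟩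
    | insert y F _ ih =>
      intro φ hφ hpos hF
      by_cases hy : y ∈ E
      · refine hS.greenFormula_of_cutoff hE hφ hpos hy fun ε hε =>
          ih _ (hφ.mul (contDiff_one_sub_bump _ ε)) (fun s hs => mul_nonneg (hpos s hs)
            (by linarith [bump_le_one (y * Complex.I) ε s])) fun z hz hzs => ?_
        rcases Finset.mem_insert.1 (hF z hz (closure_mono
          (fun w hw => left_ne_zero_of_mul hw) hzs)) with rfl | h
        · exfalso
          have hcl : tsupport (fun s => φ s * (1 - bump (z * Complex.I) ε s)) ⊆
              (Metric.ball ((z : ℂ) * Complex.I) ε)ᶜ := by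
            refine closure_minimal (fun s hs hb => hs ?_) Metric.isOpen_ball.isClosed_compl
            rw [mem_ball_iff_norm] at hb
            simp only [bump_eq_one hε hb.le, sub_self, mul_zero]
          exact hcl hzs (Metric.mem_ball_self hε)
        · exact h
      · exact ih φ hφ hpos fun z hz hzs => (Finset.mem_insert.1 (hF z hz hzs)).resolve_left
          fun h => hy (h ▸ hz)
  obtain ⟨M, hM⟩ := hφ.hasCompactSupport.isBounded.subset_closedBall 0
  refine main (hS.locallyFinite M).toFinset φ hφ hpos fun y hy hys => ?_
  rw [Set.Finite.mem_toFinset]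
  have := hM hys
  rw [mem_closedBall_zero_iff, norm_mul, Complex.norm_I, mul_one, Complex.norm_real] at this
  exact ⟨hy, abs_le.1 this⟩

end IsWeierstrassFactorization
end BodeSensitivity

/-! ### Integration by parts against a holomorphic function -/

namespace BodeSensitivity

section HolomorphicGreen

lemma contDiffAt_complex_mul_of_tsupport {f w : ℂ → ℂ} {V K : Set ℂ} {s : ℂ} {n : WithTop ℕ∞}
    (hf : DifferentiableOn ℂ f V) (hV : IsOpen V) (hK : IsClosed K) (hw : ∀ z ∉ K, w z = 0)
    (hs : s ∈ K → s ∈ V) (hwc : ContDiffAt ℝ n w s) : ContDiffAt ℝ n (fun z => f z * w z) s := by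
  by_cases h : s ∈ K
  · have : ContDiffAt ℂ n f s := (hf.analyticAt (hV.mem_nhds (hs h))).contDiffAt
    exact this.restrict_scalars ℝ |>.mul hwc
  · have h0 : (fun z => f z * w z) =ᶠ[𝓝 s] fun _ => 0 := by
      filter_upwards [hK.isOpen_compl.mem_nhds h] with z hz
      rw [hw z hz, mul_zero]
    exact contDiffAt_const.congr_of_eventuallyEq h0

lemma dx_of_dx_comm {k : ℂ → ℝ} (hk : ContDiff ℝ 2 k) (s : ℂ) : dx (dy k) s = dy (dx k) s := by
  have h1 : DifferentiableAt ℝ (fderiv ℝ k) s :=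
    (hk.contDiffAt.fderiv_right one_add_one_le_two).differentiableAt one_ne_zero
  have hsymm : IsSymmSndFDerivAt ℝ k s := hk.contDiffAt.isSymmSndFDerivAt (by simp)
  have e1 : dx (dy k) s = fderiv ℝ (fderiv ℝ k) s 1 Complex.I := by
    change fderiv ℝ (fun z => fderiv ℝ k z Complex.I) s 1 = _
    rw [fderiv_clm_apply h1 (differentiableAt_const _)]; simp
  have e2 : dy (dx k) s = fderiv ℝ (fderiv ℝ k) s Complex.I 1 := by
    change fderiv ℝ (fun z => fderiv ℝ k z 1) s Complex.I = _
    rw [fderiv_clm_apply h1 (differentiableAt_const _)]; simp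
  rw [e1, e2, hsymm.eq]

lemma hasFDerivAt_re (s : ℂ) : HasFDerivAt (fun z : ℂ => z.re) Complex.reCLM s :=
  Complex.reCLM.hasFDerivAt

lemma lap_re_mul {k : ℂ → ℝ} (hk : ContDiff ℝ 2 k) (s : ℂ) :
    lap (fun z => z.re * k z) s = 2 * dx k s + s.re * lap k s := by
  have hre : ContDiff ℝ 2 fun z : ℂ => z.re := Complex.reCLM.contDiff
  have ex : dx (fun z : ℂ => z.re) = fun _ => 1 := by
    ext z; rw [dx, (hasFDerivAt_re z).fderiv]; simp
  have ey : dy (fun z : ℂ => z.re) = fun _ => 0 := by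
    ext z; rw [dy, (hasFDerivAt_re z).fderiv]; simp
  have el : lap (fun z : ℂ => z.re) s = 0 := by
    rw [lap, ex, ey]; simp [dx, dy]
  rw [lap_mul hre hk, el, ex, ey]
  ring

variable {f : ℂ → ℂ} {V K : Set ℂ} {k : ℂ → ℝ}

lemma lap_eq_zero_of_notMem (hK : IsClosed K) (hkx : ∀ s ∉ K, dx k s = 0)
    (hky : ∀ s ∉ K, dy k s = 0) : ∀ s ∉ K, lap k s = 0 := fun s hs => by
  have h0 : ∀ᶠ z in 𝓝 s, z ∉ K := hK.isOpen_compl.mem_nhds hs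
  have h1 : dx k =ᶠ[𝓝 s] fun _ => 0 := h0.mono hkx
  have h2 : dy k =ᶠ[𝓝 s] fun _ => 0 := h0.mono hky
  rw [lap, (dx_congr h1).eq_of_nhds, (dy_congr h2).eq_of_nhds]
  simp [dx, dy]

/-- Integration by parts that moves the Laplacian of `Re s * k s` to a Cauchy-Riemann derivative
of `k`. -/
theorem integral_mul_lap_re_mul (hf : DifferentiableOn ℂ f V) (hV : IsOpen V)
    (hk : ContDiff ℝ 2 k) (hc : HasCompactSupport k) (hK : IsClosed K)
    (hKV : ∀ s ∈ K, 0 ≤ s.re → s ∈ V) (hkx : ∀ s ∉ K, dx k s = 0) (hky : ∀ s ∉ K, dy k s = 0) :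
    IntegrableOn (fun s => f s * (lap (fun z => z.re * k z) s : ℝ)) rightHalfPlane ∧
    ∫ s in rightHalfPlane, f s * (lap (fun z => z.re * k z) s : ℝ) =
      ∫ s in rightHalfPlane, f s * (dx k s + Complex.I * dy k s) := by
  have hlap := lap_eq_zero_of_notMem hK hkx hky
  have cx := contDiff_one_dx hk
  have cy := contDiff_one_dy hk
  have cx' : ContDiff ℝ 1 fun s => ((dx k s : ℝ) : ℂ) := Complex.ofRealCLM.contDiff.comp cx
  have cy' : ContDiff ℝ 1 fun s => ((dy k s : ℝ) : ℂ) := Complex.ofRealCLM.contDiff.comp cy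
  have cl' : Continuous fun s => ((lap k s : ℝ) : ℂ) :=
    Complex.continuous_ofReal.comp (continuous_lap_of_contDiff hk)
  have cre : ContDiff ℝ 1 fun s : ℂ => (s.re : ℂ) :=
    Complex.ofRealCLM.contDiff.comp Complex.reCLM.contDiff
  -- Write `D = ∂x + i ∂y`. Then `D f = 0`, `D (Re s) = 1` and `D κ = Δk`, so `D (f * Re s * κ) = f
  -- * κ + f * Re s * Δk`. The integral of the left side vanishes because `Re s = 0` on the axis.
  -- Combined with `Δ(Re s * k) = 2 ∂x k + Re s * Δk` and `2 ∂x k - κ = D k`, this is the claim.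
  set κ : ℂ → ℂ := fun s => dx k s - Complex.I * dy k s with hκ
  have cκ : ContDiff ℝ 1 κ := cx'.sub (contDiff_const.mul cy')
  have hκ0 : ∀ s ∉ K, κ s = 0 := fun s hs => by simp [hκ, hkx s hs, hky s hs]
  have hsupp {w : ℂ → ℂ} (hw : ∀ s ∉ tsupport k, w s = 0) : HasCompactSupport fun s => f s * w s :=
    hc.mono' fun s hs => by
      by_contra h; exact hs (by simp only [hw s h, mul_zero])
  have tx : ∀ s ∉ tsupport k, dx k s = 0 := fun s hs => dx_eq_zero_of_notMem_tsupport hs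
  have ty : ∀ s ∉ tsupport k, dy k s = 0 := fun s hs => dy_eq_zero_of_notMem_tsupport hs
  have tl : ∀ s ∉ tsupport k, lap k s = 0 := fun s hs => lap_eq_zero_of_notMem_tsupport hs
  have int {w : ℂ → ℂ} (hwc : Continuous w) (h1 : ∀ s ∉ K, w s = 0)
      (h2 : ∀ s ∉ tsupport k, w s = 0) : IntegrableOn (fun s => f s * w s) rightHalfPlane :=
    integrableOn_rightHalfPlane_of_continuousOn (fun s hs =>
      (contDiffAt_complex_mul_of_tsupport (n := 0) hf hV hK h1 (fun h => hKV s h hs)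
        (contDiffAt_zero.2 ⟨_, univ_mem, hwc.continuousOn⟩)).continuousAt) (hsupp h2)
  have hP : ∀ s : ℂ, 0 ≤ s.re → ContDiffAt ℝ 1 (fun z => f z * (z.re * κ z)) s := fun s hs =>
    contDiffAt_complex_mul_of_tsupport hf hV hK (fun z hz => by rw [hκ0 z hz, mul_zero])
      (fun h => hKV s h hs) (cre.mul cκ).contDiffAt
  have hPc : HasCompactSupport fun z => f z * (z.re * κ z) :=
    hsupp fun s hs => by simp [hκ, tx s hs, ty s hs]
  obtain ⟨ix, ex⟩ := integral_dx hP hPc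
  obtain ⟨iy, ey⟩ := integral_dy hP hPc
  have i1 : IntegrableOn (fun s => f s * κ s) rightHalfPlane :=
    int cκ.continuous hκ0 fun s hs => by simp [hκ, tx s hs, ty s hs]
  have i2 : IntegrableOn (fun s => f s * (s.re * lap k s)) rightHalfPlane :=
    int (cre.continuous.mul cl') (fun s hs => by rw [hlap s hs]; simp)
      fun s hs => by rw [tl s hs]; simp
  have i3 : IntegrableOn (fun s => f s * (2 * dx k s)) rightHalfPlane :=
    int (continuous_const.mul cx'.continuous) (fun s hs => by rw [hkx s hs]; simp)
      fun s hs => by rw [tx s hs]; simp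
  have key : ∀ s ∈ rightHalfPlane, dx (fun z => f z * (z.re * κ z)) s +
      Complex.I * dy (fun z => f z * (z.re * κ z)) s = f s * κ s + f s * (s.re * lap k s) := by
    intro s hs
    by_cases h : s ∈ K
    · have hsV : s ∈ V := hKV s h (le_of_lt hs)
      have df : HasFDerivAt f (ContinuousLinearMap.restrictScalars ℝ (fderiv ℂ f s)) s :=
        ((hf s hsV).differentiableAt (hV.mem_nhds hsV)).hasFDerivAt.restrictScalars ℝ
      have dre : HasFDerivAt (fun z : ℂ => (z.re : ℂ)) (Complex.ofRealCLM.comp Complex.reCLM) s :=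
        (Complex.ofRealCLM.comp Complex.reCLM).hasFDerivAt
      have d1 : HasFDerivAt (fun z => ((dx k z : ℝ) : ℂ))
          (Complex.ofRealCLM.comp (fderiv ℝ (dx k) s)) s :=
        Complex.ofRealCLM.hasFDerivAt.comp s (cx.differentiable one_ne_zero s).hasFDerivAt
      have d2 : HasFDerivAt (fun z => ((dy k z : ℝ) : ℂ))
          (Complex.ofRealCLM.comp (fderiv ℝ (dy k) s)) s :=
        Complex.ofRealCLM.hasFDerivAt.comp s (cy.differentiable one_ne_zero s).hasFDerivAt
      have dP := (df.mul (dre.mul (d1.sub (d2.const_mul Complex.I)))).fderiv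
      have ex' : dx (fun z => f z * (z.re * κ z)) s = _ :=
        congrArg (fun T : ℂ →L[ℝ] ℂ => T 1) dP
      have ey' : dy (fun z => f z * (z.re * κ z)) s = _ :=
        congrArg (fun T : ℂ →L[ℝ] ℂ => T Complex.I) dP
      have hI : fderiv ℂ f s Complex.I = Complex.I * fderiv ℂ f s 1 := by
        rw [← smul_eq_mul, ← map_smul, smul_eq_mul, mul_one]
      have hcomm : fderiv ℝ (dy k) s 1 = fderiv ℝ (dx k) s Complex.I := dx_of_dx_comm hk s
      rw [ex', ey']
      simp only [add_apply, smul_apply, sub_apply, smul_eq_mul, ContinuousLinearMap.comp_apply,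
        ContinuousLinearMap.coe_restrictScalars', Complex.ofRealCLM_apply, Complex.reCLM_apply,
        Complex.one_re, Complex.I_re, hI, hcomm, lap, hκ, Complex.ofReal_add, Pi.sub_apply, Pi.mul_apply,
        Complex.ofReal_one, Complex.ofReal_zero]
      rw [show dx (dx k) s = fderiv ℝ (dx k) s 1 from rfl,
        show dy (dy k) s = fderiv ℝ (dy k) s Complex.I from rfl]
      -- Cauchy-Riemann and the symmetry of mixed derivatives have been substituted; what remains is
      -- `I ^ 2 = -1`.
      linear_combination ((s.re : ℂ) * ((dx k s : ℝ) - Complex.I * (dy k s : ℝ)) * fderiv ℂ f s 1 -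
        f s * s.re * (fderiv ℝ (dy k) s Complex.I : ℝ)) * Complex.I_sq
    · have h0 : (fun z => f z * (z.re * κ z)) =ᶠ[𝓝 s] fun _ => 0 := by
        filter_upwards [hK.isOpen_compl.mem_nhds h] with z hz
        rw [hκ0 z hz]; simp
      rw [(dx_congr h0).eq_of_nhds, (dy_congr h0).eq_of_nhds, hκ0 s h, hlap s h]
      simp [dx, dy]
  have e0 : ∫ s in rightHalfPlane, (f s * κ s + f s * (s.re * lap k s)) = 0 := by
    rw [← setIntegral_congr_fun measurableSet_rightHalfPlane key,
      integral_add ix (iy.const_mul _), integral_const_mul, ex, ey]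
    simp
  rw [integral_add i1 i2] at e0
  have elap : (fun s => f s * (lap (fun z => z.re * k z) s : ℝ)) =
      fun s => f s * (2 * dx k s) + f s * (s.re * lap k s) := by
    ext s; rw [lap_re_mul hk]; push_cast; ring
  rw [elap]
  refine ⟨i3.add i2, ?_⟩
  have e1 : (fun s => f s * (dx k s + Complex.I * dy k s)) =
      fun s => f s * (2 * dx k s) - f s * κ s := by
    ext s; simp only [hκ]; ring
  rw [e1, integral_add i3 i2, integral_sub i3 i1]
  linear_combination e0

end HolomorphicGreen
end BodeSensitivity

/-! ### Radial cutoffs and arc integrals -/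

namespace BodeSensitivity

section Radial

/-- A smooth radial function that is `1` where `‖s‖ ^ 2 ≤ R ^ 2 - δ` and `0` where `R ≤ ‖s‖`. -/
noncomputable def radialCutoff (R δ : ℝ) (s : ℂ) : ℝ :=
  Real.smoothTransition ((R ^ 2 - ‖s‖ ^ 2) / δ)

lemma radialCutoff_nonneg (R δ : ℝ) (s : ℂ) : 0 ≤ radialCutoff R δ s :=
  Real.smoothTransition.nonneg _

lemma radialCutoff_le_one (R δ : ℝ) (s : ℂ) : radialCutoff R δ s ≤ 1 :=
  Real.smoothTransition.le_one _

lemma radialCutoff_eq_one {R δ : ℝ} (hδ : 0 < δ) {s : ℂ} (h : ‖s‖ ^ 2 ≤ R ^ 2 - δ) :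
    radialCutoff R δ s = 1 :=
  Real.smoothTransition.one_of_one_le ((one_le_div hδ).2 (by linarith))

lemma radialCutoff_eq_zero {R δ : ℝ} (hR : 0 ≤ R) (hδ : 0 < δ) {s : ℂ} (h : R ≤ ‖s‖) :
    radialCutoff R δ s = 0 :=
  Real.smoothTransition.zero_of_nonpos
    (div_nonpos_of_nonpos_of_nonneg (by nlinarith) hδ.le)

lemma contDiff_radialCutoff (R δ : ℝ) : ContDiff ℝ 2 (radialCutoff R δ) :=
  Real.smoothTransition.contDiff.comp (f := fun s : ℂ => (R ^ 2 - ‖s‖ ^ 2) / δ)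
    ((contDiff_const.sub (contDiff_id.norm_sq ℝ)).div_const δ)

lemma hasCompactSupport_radialCutoff {R δ : ℝ} (hR : 0 ≤ R) (hδ : 0 < δ) :
    HasCompactSupport (radialCutoff R δ) :=
  HasCompactSupport.intro (isCompact_closedBall 0 R) fun s hs => by
    rw [mem_closedBall_zero_iff, not_le] at hs
    exact radialCutoff_eq_zero hR hδ hs.le

lemma isTest_re_mul {k : ℂ → ℝ} (hk : ContDiff ℝ 2 k) (hc : HasCompactSupport k) :
    IsTest fun s => s.re * k s :=
  ⟨Complex.reCLM.contDiff.mul hk, hc.mul_left, fun s hs => by rw [hs, zero_mul]⟩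

lemma dx_re_mul_axis {k : ℂ → ℝ} (hk : ContDiff ℝ 2 k) (y : ℝ) :
    dx (fun s : ℂ => s.re * k s) (y * Complex.I) = k (y * Complex.I) := by
  rw [dx_mul (hasFDerivAt_re _).differentiableAt (hk.differentiable two_ne_zero _), re_axis,
    show dx (fun s : ℂ => s.re) (y * Complex.I) = 1 by
      rw [dx, (hasFDerivAt_re _).fderiv]; simp]
  ring

lemma dx_radialCutoff (R δ : ℝ) (s : ℂ) : dx (radialCutoff R δ) s =
    deriv Real.smoothTransition ((R ^ 2 - ‖s‖ ^ 2) / δ) * (-(2 * s.re) / δ) := by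
  refine dx_eq_of_hasDerivAt ((contDiff_radialCutoff R δ).differentiable two_ne_zero s) ?_
  have e (x : ℝ) : ‖(⟨x, s.im⟩ : ℂ)‖ ^ 2 = x ^ 2 + s.im ^ 2 := by
    rw [Complex.sq_norm, Complex.normSq_apply]; ring
  have h : HasDerivAt (fun x : ℝ => (R ^ 2 - ‖(⟨x, s.im⟩ : ℂ)‖ ^ 2) / δ) (-(2 * s.re) / δ) s.re := by
    simp only [e]
    simpa using ((((hasDerivAt_id s.re).pow 2).add_const (s.im ^ 2)).const_sub (R ^ 2)).div_const δ
  exact (Real.smoothTransition.contDiff (n := 1)).differentiable one_ne_zero _ |>.hasDerivAt.comp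
    s.re h

lemma dy_radialCutoff (R δ : ℝ) (s : ℂ) : dy (radialCutoff R δ) s =
    deriv Real.smoothTransition ((R ^ 2 - ‖s‖ ^ 2) / δ) * (-(2 * s.im) / δ) := by
  refine dy_eq_of_hasDerivAt ((contDiff_radialCutoff R δ).differentiable two_ne_zero s) ?_
  have e (x : ℝ) : ‖(⟨s.re, x⟩ : ℂ)‖ ^ 2 = s.re ^ 2 + x ^ 2 := by
    rw [Complex.sq_norm, Complex.normSq_apply]; ring
  have h : HasDerivAt (fun x : ℝ => (R ^ 2 - ‖(⟨s.re, x⟩ : ℂ)‖ ^ 2) / δ) (-(2 * s.im) / δ) s.im := by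
    simp only [e]
    simpa using ((((hasDerivAt_id s.im).pow 2).const_add (s.re ^ 2)).const_sub (R ^ 2)).div_const δ
  exact (Real.smoothTransition.contDiff (n := 1)).differentiable one_ne_zero _ |>.hasDerivAt.comp
    s.im h

lemma deriv_smoothTransition_of_neg {x : ℝ} (hx : x < 0) : deriv Real.smoothTransition x = 0 := by
  have : Real.smoothTransition =ᶠ[𝓝 x] fun _ => 0 := by
    filter_upwards [Iio_mem_nhds hx] with z hz
    exact Real.smoothTransition.zero_of_nonpos (le_of_lt hz)
  rw [this.deriv_eq, deriv_const]

lemma deriv_smoothTransition_of_one_lt {x : ℝ} (hx : 1 < x) :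
    deriv Real.smoothTransition x = 0 := by
  have : Real.smoothTransition =ᶠ[𝓝 x] fun _ => 1 := by
    filter_upwards [Ioi_mem_nhds hx] with z hz
    exact Real.smoothTransition.one_of_one_le (le_of_lt hz)
  rw [this.deriv_eq, deriv_const]

lemma continuous_deriv_smoothTransition : Continuous (deriv Real.smoothTransition) :=
  (Real.smoothTransition.contDiff (n := 1)).continuous_deriv le_rfl

lemma exists_bound_deriv_smoothTransition :
    ∃ B, 0 ≤ B ∧ ∀ x, |deriv Real.smoothTransition x| ≤ B := by
  obtain ⟨B, hB⟩ := isCompact_Icc.exists_bound_of_continuousOn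
    (continuous_deriv_smoothTransition.continuousOn (s := Set.Icc 0 1))
  refine ⟨B, (norm_nonneg _).trans (hB 0 (by simp)), fun x => ?_⟩
  by_cases hx : x ∈ Set.Icc (0 : ℝ) 1
  · exact hB x hx
  · have h0 : 0 ≤ B := (norm_nonneg _).trans (hB 0 (by simp))
    rw [Set.mem_Icc, not_and_or, not_le, not_le] at hx
    rcases hx with hx | hx
    · rwa [deriv_smoothTransition_of_neg hx, abs_zero]
    · rwa [deriv_smoothTransition_of_one_lt hx, abs_zero]

lemma deriv_smoothTransition_radial_eq_zero {R δ r r₀ : ℝ} (hR : 0 < R) (hδ : 0 < δ)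
    (hr₀ : r₀ ^ 2 = R ^ 2 - δ) (hr0 : 0 ≤ r) (hr : r ∉ Set.Icc r₀ R) :
    deriv Real.smoothTransition ((R ^ 2 - r ^ 2) / δ) = 0 := by
  rw [Set.mem_Icc, not_and_or, not_le, not_le] at hr
  rcases hr with hr | hr
  · refine deriv_smoothTransition_of_one_lt ((one_lt_div hδ).2 ?_)
    nlinarith
  · refine deriv_smoothTransition_of_neg (div_neg_of_neg_of_pos ?_ hδ)
    nlinarith

/-- The part of the half plane between two radii, both included. -/
def halfAnnulus (r₀ R : ℝ) : Set ℂ := {s | 0 ≤ s.re ∧ r₀ ≤ ‖s‖ ∧ ‖s‖ ≤ R}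

lemma circleMap_mem_halfAnnulus {r₀ R r θ : ℝ} (hr₀ : 0 ≤ r₀) (hr : r ∈ Set.Icc r₀ R)
    (hθ : θ ∈ Set.Icc (-(Real.pi / 2)) (Real.pi / 2)) : circleMap 0 r θ ∈ halfAnnulus r₀ R := by
  have h0 : 0 ≤ r := hr₀.trans hr.1
  have h := circleMap_mem_closed (y := 0) h0 hθ
  rw [Complex.ofReal_zero, zero_mul] at h
  refine ⟨h, ?_⟩
  rw [norm_circleMap_zero, abs_of_nonneg h0]
  exact hr

variable {f : ℂ → ℂ}

/-- For a function of `‖s‖ ^ 2` the operator `∂x + i ∂y` yields a radial factor times `s`. On an arc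
`ds = i s dθ`, so `s dθ = -i ds`, and the factor `-2 / δ` becomes `2i / δ`. -/
lemma integral_mul_cauchyRiemann_radialCutoff {R δ r₀ : ℝ} (hR : 0 < R) (hδ : 0 < δ) (hr₀ : 0 < r₀)
    (hr₀' : r₀ ^ 2 = R ^ 2 - δ) (hf : ContinuousOn f (halfAnnulus r₀ R)) :
    ∫ s in rightHalfPlane, f s * (dx (radialCutoff R δ) s + Complex.I * dy (radialCutoff R δ) s) =
      ∫ r in Set.Icc r₀ R, ((deriv Real.smoothTransition ((R ^ 2 - r ^ 2) / δ) * r / δ : ℝ) : ℂ) *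
        (2 * Complex.I * arcIntegral f r) := by
  have hpi : -(Real.pi / 2) ≤ Real.pi / 2 := by linarith [Real.pi_pos]
  have e1 (s : ℂ) : f s * (dx (radialCutoff R δ) s + Complex.I * dy (radialCutoff R δ) s) =
      (deriv Real.smoothTransition ((R ^ 2 - ‖s‖ ^ 2) / δ) : ℝ) * (-2 / δ) * (f s * s) := by
    rw [dx_radialCutoff, dy_radialCutoff]
    push_cast
    linear_combination (f s * (deriv Real.smoothTransition ((R ^ 2 - ‖s‖ ^ 2) / δ) : ℝ) *
      (-2 / (δ : ℂ))) * Complex.re_add_im s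
  simp only [e1]
  rw [setIntegral_rightHalfPlane_polar]
  set G : ℝ × ℝ → ℂ := fun q => q.1 • ((deriv Real.smoothTransition
    ((R ^ 2 - ‖circleMap 0 q.1 q.2‖ ^ 2) / δ) : ℝ) * (-2 / (δ : ℂ)) *
      (f (circleMap 0 q.1 q.2) * circleMap 0 q.1 q.2)) with hG
  have hcm : Continuous fun q : ℝ × ℝ => circleMap 0 q.1 q.2 := by
    simp only [circleMap]; fun_prop
  have hzero : ∀ q ∈ Set.Ioi (0 : ℝ) ×ˢ Set.Ioo (-(Real.pi / 2)) (Real.pi / 2),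
      q ∉ Set.Icc r₀ R ×ˢ Set.Ioo (-(Real.pi / 2)) (Real.pi / 2) → G q = 0 := by
    rintro ⟨r, θ⟩ ⟨hr, hθ⟩ hn
    have hrn : r ∉ Set.Icc r₀ R := fun h => hn ⟨h, hθ⟩
    have hr0 : 0 < r := hr
    simp only [hG, norm_circleMap_zero, sq_abs]
    rw [deriv_smoothTransition_radial_eq_zero hR hδ hr₀' hr0.le hrn]
    simp
  rw [setIntegral_eq_of_subset_of_forall_sdiff_eq_zero
    (measurableSet_Ioi.prod measurableSet_Ioo)
    (Set.prod_mono (fun r hr => lt_of_lt_of_le hr₀ hr.1) subset_rfl)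
    (fun q hq => hzero q hq.1 hq.2)]
  have hGc : ContinuousOn G (Set.Icc r₀ R ×ˢ Set.Icc (-(Real.pi / 2)) (Real.pi / 2)) := by
    have h1 : ContinuousOn (fun q : ℝ × ℝ => f (circleMap 0 q.1 q.2))
        (Set.Icc r₀ R ×ˢ Set.Icc (-(Real.pi / 2)) (Real.pi / 2)) :=
      hf.comp hcm.continuousOn fun q hq => circleMap_mem_halfAnnulus hr₀.le hq.1 hq.2
    have h2 : Continuous fun q : ℝ × ℝ => ((deriv Real.smoothTransition
        ((R ^ 2 - ‖circleMap 0 q.1 q.2‖ ^ 2) / δ) : ℝ) : ℂ) * (-2 / (δ : ℂ)) := by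
      refine (Complex.continuous_ofReal.comp (continuous_deriv_smoothTransition.comp
        (g := deriv Real.smoothTransition) ?_)).mul continuous_const
      fun_prop
    exact continuous_fst.continuousOn.smul (h2.continuousOn.mul (h1.mul hcm.continuousOn))
  have hGi : IntegrableOn G (Set.Icc r₀ R ×ˢ Set.Ioo (-(Real.pi / 2)) (Real.pi / 2)) :=
    (hGc.integrableOn_compact (isCompact_Icc.prod isCompact_Icc)).mono_set
      (Set.prod_mono subset_rfl Set.Ioo_subset_Icc_self)
  rw [Measure.volume_eq_prod] at hGi ⊢
  rw [setIntegral_prod _ hGi]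
  refine setIntegral_congr_fun measurableSet_Icc fun r hr => ?_
  have hr0 : 0 < r := hr₀.trans_le hr.1
  simp only [arcIntegral, hG]
  rw [intervalIntegral.integral_of_le hpi, integral_Ioc_eq_integral_Ioo, ← integral_const_mul,
    ← integral_const_mul]
  congr 1
  ext θ
  rw [norm_circleMap_zero, sq_abs, Complex.real_smul]
  push_cast
  linear_combination (-2 * (r : ℂ) * (deriv Real.smoothTransition ((R ^ 2 - r ^ 2) / δ) : ℝ) / δ *
    (f (circleMap 0 r θ) * circleMap 0 r θ)) * Complex.I_sq

lemma continuousOn_arcIntegral {r₀ R : ℝ} (hr₀ : 0 ≤ r₀) (hR : r₀ ≤ R)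
    (hf : ContinuousOn f (halfAnnulus r₀ R)) :
    ContinuousOn (fun r => arcIntegral f r) (Set.Icc r₀ R) := by
  have hpi : -(Real.pi / 2) ≤ Real.pi / 2 := by linarith [Real.pi_pos]
  -- Clamping radius and angle makes the integrand continuous on the whole plane without changing it
  -- where it is used.
  set P : ℝ × ℝ → ℂ := fun q => circleMap 0 (Set.projIcc r₀ R hR q.1)
    (Set.projIcc (-(Real.pi / 2)) (Real.pi / 2) hpi q.2) with hP
  have hPc : Continuous P := by
    simp only [hP, circleMap]
    have h1 : Continuous fun q : ℝ × ℝ => (Set.projIcc r₀ R hR q.1 : ℝ) :=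
      continuous_subtype_val.comp (continuous_projIcc.comp continuous_fst)
    have h2 : Continuous fun q : ℝ × ℝ =>
        (Set.projIcc (-(Real.pi / 2)) (Real.pi / 2) hpi q.2 : ℝ) :=
      continuous_subtype_val.comp (continuous_projIcc.comp continuous_snd)
    fun_prop
  have hPm (q : ℝ × ℝ) : P q ∈ halfAnnulus r₀ R :=
    circleMap_mem_halfAnnulus hr₀ (Subtype.mem _) (Subtype.mem _)
  have hF : Continuous fun q => f (P q) * (P q * Complex.I) :=
    (hf.comp_continuous hPc hPm).mul (hPc.mul continuous_const)
  have h : Continuous fun r => ∫ θ in (-(Real.pi / 2))..(Real.pi / 2),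
      f (P (r, θ)) * (P (r, θ) * Complex.I) :=
    intervalIntegral.continuous_parametric_intervalIntegral_of_continuous' hF _ _
  refine h.continuousOn.congr fun r hr => ?_
  refine intervalIntegral.integral_congr fun θ hθ => ?_
  rw [Set.uIcc_of_le hpi] at hθ
  simp only [hP, Set.projIcc_of_mem hR hr, Set.projIcc_of_mem hpi hθ]

end Radial
end BodeSensitivity

/-! ### Shrinking the annulus: the identity at a finite radius -/

namespace BodeSensitivity

section RadialLimit

/-- The total weight is `1/2`, not `1`: the weight is the derivative of minus half the cutoff. -/
lemma integral_deriv_smoothTransition_radial {R δ r₀ : ℝ} (hδ : 0 < δ)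
    (hr₀' : r₀ ^ 2 = R ^ 2 - δ) :
    ∫ r in r₀..R, deriv Real.smoothTransition ((R ^ 2 - r ^ 2) / δ) * r / δ = 1 / 2 := by
  have h : ∀ r ∈ Set.uIcc r₀ R, HasDerivAt
      (fun r : ℝ => -Real.smoothTransition ((R ^ 2 - r ^ 2) / δ) / 2)
      (deriv Real.smoothTransition ((R ^ 2 - r ^ 2) / δ) * r / δ) r := fun r _ => by
    have h1 : HasDerivAt (fun r : ℝ => (R ^ 2 - r ^ 2) / δ) (-(2 * r) / δ) r := by
      simpa using (((hasDerivAt_id r).pow 2).const_sub (R ^ 2)).div_const δ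
    have h2 := ((Real.smoothTransition.contDiff (n := 1)).differentiable one_ne_zero
      ((R ^ 2 - r ^ 2) / δ)).hasDerivAt.comp r h1
    convert! h2.neg.div_const 2 using 1
    ring
  rw [intervalIntegral.integral_eq_sub_of_hasDerivAt h]
  · rw [hr₀', sub_self, zero_div, sub_sub_cancel, div_self hδ.ne']
    norm_num
  · refine Continuous.intervalIntegrable ?_ _ _
    have := continuous_deriv_smoothTransition.comp
      (f := fun r : ℝ => (R ^ 2 - r ^ 2) / δ) (by fun_prop)
    exact (this.mul continuous_id).div_const δ

/-- The weight concentrates at `r = R`. It is at most `B * r / δ` in absolute value, and the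
integral of `r` over the shell is `δ / 2`, so its total variation stays bounded as `δ → 0`. -/
lemma tendsto_radial_average {b : ℝ → ℝ} {r₁ R : ℝ} (hr₁ : 0 < r₁) (hR : r₁ < R)
    (hb : ContinuousOn b (Set.Icc r₁ R)) :
    Tendsto (fun δ => ∫ r in Set.Icc √(R ^ 2 - δ) R,
      deriv Real.smoothTransition ((R ^ 2 - r ^ 2) / δ) * r / δ * b r) (𝓝[>] 0)
      (𝓝 (b R / 2)) := by
  obtain ⟨B, hB0, hB⟩ := exists_bound_deriv_smoothTransition
  have hR0 : 0 < R := hr₁.trans hR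
  rw [Metric.tendsto_nhds]
  intro ε hε
  have hη : 0 < ε / (B + 1) := by positivity
  have hcont := (hb R ⟨hR.le, le_rfl⟩).eventually (Metric.ball_mem_nhds (b R) hη)
  rw [eventually_nhdsWithin_iff, Metric.eventually_nhds_iff_ball] at hcont
  obtain ⟨η, hη0, hclose⟩ := hcont
  have hsq : Tendsto (fun δ : ℝ => √(R ^ 2 - δ)) (𝓝[>] 0) (𝓝 R) := by
    have : ContinuousAt (fun δ : ℝ => √(R ^ 2 - δ)) 0 := by fun_prop
    have h := this.tendsto
    simp only [sub_zero, Real.sqrt_sq hR0.le] at h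
    exact h.mono_left nhdsWithin_le_nhds
  filter_upwards [hsq.eventually (lt_mem_nhds hR), hsq.eventually
    (lt_mem_nhds (show R - η < R by linarith)), Ioo_mem_nhdsGT (show 0 < R ^ 2 by positivity)]
    with δ h1 h2 h3
  set r₀ := √(R ^ 2 - δ) with hr₀
  have hr₀' : r₀ ^ 2 = R ^ 2 - δ := Real.sq_sqrt (by linarith [h3.2])
  have hδ : 0 < δ := h3.1
  have hr₀R : r₀ ≤ R := by
    refine Real.sqrt_le_iff.2 ⟨hR0.le, by linarith⟩
  have hW : Continuous fun r : ℝ => deriv Real.smoothTransition ((R ^ 2 - r ^ 2) / δ) * r / δ := by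
    have := continuous_deriv_smoothTransition.comp
      (f := fun r : ℝ => (R ^ 2 - r ^ 2) / δ) (by fun_prop)
    exact (this.mul continuous_id).div_const δ
  have hbi : IntervalIntegrable
      (fun r => deriv Real.smoothTransition ((R ^ 2 - r ^ 2) / δ) * r / δ * b r) volume r₀ R := by
    refine ContinuousOn.intervalIntegrable ?_
    rw [Set.uIcc_of_le hr₀R]
    exact hW.continuousOn.mul (hb.mono (Set.Icc_subset_Icc_left h1.le))
  rw [integral_Icc_eq_integral_Ioc, ← intervalIntegral.integral_of_le hr₀R, dist_eq_norm]
  have e : (∫ r in r₀..R, deriv Real.smoothTransition ((R ^ 2 - r ^ 2) / δ) * r / δ * b r) -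
      b R / 2 = ∫ r in r₀..R,
        deriv Real.smoothTransition ((R ^ 2 - r ^ 2) / δ) * r / δ * (b r - b R) := by
    have hbc : IntervalIntegrable
        (fun r => deriv Real.smoothTransition ((R ^ 2 - r ^ 2) / δ) * r / δ * b R) volume r₀ R :=
      (hW.mul continuous_const).intervalIntegrable _ _
    simp only [mul_sub]
    rw [intervalIntegral.integral_sub hbi hbc,
      intervalIntegral.integral_mul_const, integral_deriv_smoothTransition_radial hδ hr₀']
    ring
  rw [e]
  have hbound : ‖∫ r in r₀..R,
      deriv Real.smoothTransition ((R ^ 2 - r ^ 2) / δ) * r / δ * (b r - b R)‖ ≤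
      ∫ r in r₀..R, B * (ε / (B + 1)) / δ * r := by
    refine intervalIntegral.norm_integral_le_of_norm_le hr₀R (ae_of_all _ fun r hr => ?_)
      (Continuous.intervalIntegrable (by fun_prop) _ _)
    have hr0 : 0 ≤ r := (Real.sqrt_nonneg _).trans hr.1.le
    have hd := hclose r (by
      rw [Metric.mem_ball, Real.dist_eq, abs_lt]; constructor <;> linarith [hr.1, hr.2])
      ⟨(h1.trans hr.1).le, hr.2⟩
    rw [Real.dist_eq] at hd
    rw [norm_mul, Real.norm_eq_abs, Real.norm_eq_abs, abs_div, abs_mul, abs_of_nonneg hr0,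
      abs_of_pos hδ]
    calc _ ≤ B * r / δ * (ε / (B + 1)) := by gcongr; exact hB _
      _ = B * (ε / (B + 1)) / δ * r := by ring
  refine hbound.trans_lt ?_
  rw [intervalIntegral.integral_const_mul, integral_id, hr₀', sub_sub_cancel]
  have : B * (ε / (B + 1)) / δ * (δ / 2) = B * ε / (2 * (B + 1)) := by field_simp
  rw [this, div_lt_iff₀ (by positivity)]
  nlinarith

end RadialLimit

lemma isCompact_arc (R : ℝ) : IsCompact (arc R) := by
  have : arc R = Metric.sphere 0 R ∩ {s : ℂ | 0 ≤ s.re} := by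
    ext s; simp [arc]
  rw [this]
  exact (isCompact_sphere 0 R).inter_right (isClosed_le continuous_const Complex.continuous_re)

lemma exists_halfAnnulus_subset {R : ℝ} (hR : 0 < R) {V : Set ℂ} (hV : IsOpen V)
    (harc : arc R ⊆ V) : ∃ r₁, 0 < r₁ ∧ r₁ < R ∧ halfAnnulus r₁ R ⊆ V := by
  obtain ⟨ε, hε, hsub⟩ := (isCompact_arc R).exists_thickening_subset_open hV harc
  refine ⟨max (R / 2) (R - ε / 2), lt_max_of_lt_left (by linarith),
    max_lt (by linarith) (by linarith), fun s hs => hsub ?_⟩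
  have h1 := (le_max_left _ _).trans hs.2.1
  have h2 := (le_max_right _ _).trans hs.2.1
  have hs0 : 0 < ‖s‖ := by linarith
  rw [Metric.mem_thickening_iff]
  -- Radial projection gives a point of the arc at distance `R - ‖s‖`, without leaving the closed
  -- half plane.
  refine ⟨(R / ‖s‖ : ℝ) • s, ⟨?_, ?_⟩, ?_⟩
  · rw [norm_smul, Real.norm_of_nonneg (by positivity), div_mul_cancel₀ _ hs0.ne']
  · rw [Complex.smul_re]; exact smul_nonneg (by positivity) hs.1
  · have e : s - (R / ‖s‖ : ℝ) • s = (1 - R / ‖s‖ : ℝ) • s := by rw [sub_smul, one_smul]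
    rw [dist_eq_norm, e, norm_smul, Real.norm_eq_abs, abs_sub_comm, abs_of_nonneg, sub_mul,
      div_mul_cancel₀ _ hs0.ne', one_mul]
    · linarith
    · rw [sub_nonneg, one_le_div hs0]; exact hs.2.2

variable {ι : Type*} {S g : ℂ → ℂ} {p : ι → ℂ} {d : ι → ℝ} {c : ι → ℂ → ℂ} {E : Set ℝ} {U : Set ℂ}

namespace IsWeierstrassFactorization

/-- A bounded region may contain infinitely many poles, clustering at exceptional points, so this is
not automatic; it comes from Green's formula. The cutoff of radius `R + 1` with `δ = 1` equals `1`
on the disc of radius `R`. -/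
lemma summable_of_norm_lt (hS : IsWeierstrassFactorization S g p d c E U)
    (hE : ∀ y ∈ E, LogRegularAt S y) {R : ℝ} (hR : 0 < R) :
    Summable fun j => {s : ℂ | ‖s‖ < R}.indicator (fun s => d j * s.re) (p j) := by
  have hR1 : 0 ≤ R + 1 := by linarith
  have h := (hS.greenFormula_of_nonneg hE (isTest_re_mul (contDiff_radialCutoff (R + 1) 1)
    (hasCompactSupport_radialCutoff hR1 one_pos))
    fun s hs => mul_nonneg hs (radialCutoff_nonneg _ _ _)).1
  have hterm (j : ι) : 0 ≤ d j * (p j).re := mul_nonneg (hS.order_pos j).le (hS.pole_re_pos j).le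
  refine Summable.of_nonneg_of_le (fun j => ?_) (fun j => ?_) h
  · exact Set.indicator_apply_nonneg fun _ => hterm j
  · refine Set.indicator_le' (f := fun s => d j * s.re) (g := fun s => |d j| * (|s.re| *
      radialCutoff (R + 1) 1 s)) ?_ ?_ (p j) |>.trans (le_of_eq ?_)
    · intro s hs
      rw [radialCutoff_eq_one one_pos, mul_one, ← abs_mul]
      · exact le_abs_self _
      · have : ‖s‖ ^ 2 ≤ R ^ 2 := pow_le_pow_left₀ (norm_nonneg _) (le_of_lt hs) 2
        nlinarith
    · intro s _
      exact mul_nonneg (abs_nonneg _) (mul_nonneg (abs_nonneg _) (radialCutoff_nonneg _ _ _))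
    · simp only [abs_of_pos (hS.order_pos j), abs_of_pos (hS.pole_re_pos j)]

/-- The Laplacian of the test function is supported in the annulus covered by `V`, so `log ‖S‖` can
be replaced by `Re f` although no branch exists further inside. -/
lemma greenFormula_radialCutoff (hS : IsWeierstrassFactorization S g p d c E U)
    (hE : ∀ y ∈ E, LogRegularAt S y) {R : ℝ} (hR : 0 < R) {f : ℂ → ℂ} {V : Set ℂ} (hV : IsOpen V)
    (hf : DifferentiableOn ℂ f V) (hfS : ∀ s ∈ V, 0 ≤ s.re → ‖Complex.exp (f s)‖ = ‖S s‖) {r₁ : ℝ}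
    (hr₁ : 0 < r₁) (hr₁V : halfAnnulus r₁ R ⊆ V) {δ : ℝ} (hδ : 0 < δ) (hδ' : r₁ ^ 2 ≤ R ^ 2 - δ) :
    ∫ r in Set.Icc √(R ^ 2 - δ) R, deriv Real.smoothTransition ((R ^ 2 - r ^ 2) / δ) * r / δ *
      (2 * Complex.I * arcIntegral f r).re =
      2 * Real.pi * (∑' j, d j * ((p j).re * radialCutoff R δ (p j))) -
        ∫ y : ℝ, Real.log ‖S (y * Complex.I)‖ * radialCutoff R δ (y * Complex.I) := by
  have hk := contDiff_radialCutoff R δ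
  have hc := hasCompactSupport_radialCutoff hR.le hδ
  have hG := (hS.greenFormula_of_nonneg hE (isTest_re_mul hk hc)
    fun s hs => mul_nonneg hs (radialCutoff_nonneg _ _ _)).2.eq
  simp only [dx_re_mul_axis hk] at hG
  rw [← hG]
  set r₀ := √(R ^ 2 - δ) with hr₀
  have hr₁₀ : r₁ ≤ r₀ := Real.le_sqrt_of_sq_le hδ'
  have hr₀0 : 0 < r₀ := hr₁.trans_le hr₁₀
  have hr₀' : r₀ ^ 2 = R ^ 2 - δ := Real.sq_sqrt (by nlinarith)
  set K : Set ℂ := {s | ‖s‖ ∈ Set.Icc r₀ R} with hKdef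
  have hK : IsClosed K := isClosed_Icc.preimage continuous_norm
  have hKV : ∀ s ∈ K, 0 ≤ s.re → s ∈ V := fun s hs h0 =>
    hr₁V ⟨h0, hr₁₀.trans hs.1, hs.2⟩
  have hkx : ∀ s ∉ K, dx (radialCutoff R δ) s = 0 := fun s hs => by
    rw [dx_radialCutoff, deriv_smoothTransition_radial_eq_zero hR hδ hr₀' (norm_nonneg s) hs,
      zero_mul]
  have hky : ∀ s ∉ K, dy (radialCutoff R δ) s = 0 := fun s hs => by
    rw [dy_radialCutoff, deriv_smoothTransition_radial_eq_zero hR hδ hr₀' (norm_nonneg s) hs,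
      zero_mul]
  obtain ⟨hi, he⟩ := integral_mul_lap_re_mul hf hV hk hc hK hKV hkx hky
  have hfc : ContinuousOn f (halfAnnulus r₀ R) :=
    hf.continuousOn.mono fun s hs => hKV s hs.2 hs.1
  rw [integral_mul_cauchyRiemann_radialCutoff hR hδ hr₀0 hr₀' hfc] at he
  have hre : ∀ s ∈ rightHalfPlane, Real.log ‖S s‖ * lap (fun s => s.re * radialCutoff R δ s) s =
      (f s * (lap (fun z => z.re * radialCutoff R δ z) s : ℝ)).re := by
    intro s hs
    by_cases h : s ∈ K
    · rw [Complex.re_mul_ofReal, ← hfS s (hKV s h (le_of_lt hs)) (le_of_lt hs), Complex.norm_exp,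
        Real.log_exp]
    · rw [lap_re_mul hk, hkx s h, lap_eq_zero_of_notMem hK hkx hky s h]
      simp
  have hire := integral_re hi
  have hcont : ContinuousOn (fun r : ℝ =>
      ((deriv Real.smoothTransition ((R ^ 2 - r ^ 2) / δ) * r / δ : ℝ) : ℂ) *
        (2 * Complex.I * arcIntegral f r)) (Set.Icc r₀ R) := by
    have h1 : Continuous fun r : ℝ =>
        deriv Real.smoothTransition ((R ^ 2 - r ^ 2) / δ) * r / δ := by
      have := continuous_deriv_smoothTransition.comp
        (f := fun r : ℝ => (R ^ 2 - r ^ 2) / δ) (by fun_prop)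
      exact (this.mul continuous_id).div_const δ
    refine (Complex.continuous_ofReal.comp h1).continuousOn.mul (continuousOn_const.mul ?_)
    refine continuousOn_arcIntegral hr₀0.le ?_ hfc
    exact Real.sqrt_le_iff.2 ⟨hR.le, by linarith⟩
  have hire2 := integral_re (hcont.integrableOn_compact (μ := volume) isCompact_Icc)
  simp only [RCLike.re_to_complex, Complex.re_ofReal_mul] at hire hire2
  rw [setIntegral_congr_fun measurableSet_rightHalfPlane hre, hire, he, hire2]

/-- The Bode integral over `[-R, R]` in terms of the poles of modulus less than `R` and of a branch
of the logarithm along the arc of radius `R`. -/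
theorem truncatedBodeIntegral_eq (hS : IsWeierstrassFactorization S g p d c E U)
    (hE : ∀ y ∈ E, LogRegularAt S y) {R : ℝ} (hR : 0 < R) {f : ℂ → ℂ} (hf : IsLogBranch S R f) :
    truncatedBodeIntegral S R =
      4 * Real.pi * (∑' j, {s : ℂ | ‖s‖ < R}.indicator (fun s => d j * s.re) (p j)) -
        (2 * Complex.I * arcIntegral f R).re := by
  obtain ⟨V, hV, harc, hfd, hfS⟩ := hf
  obtain ⟨r₁, hr₁, hr₁R, hr₁V⟩ := exists_halfAnnulus_subset hR hV harc
  have hcts : ContinuousOn (fun r => (2 * Complex.I * arcIntegral f r).re) (Set.Icc r₁ R) :=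
    Complex.continuous_re.comp_continuousOn (continuousOn_const.mul
      (continuousOn_arcIntegral hr₁.le hr₁R.le (hfd.continuousOn.mono hr₁V)))
  have l1 := tendsto_radial_average hr₁ hr₁R hcts
  have hterm (j : ι) : 0 ≤ d j * (p j).re := mul_nonneg (hS.order_pos j).le (hS.pole_re_pos j).le
  have hnear {s : ℂ} (hs : ‖s‖ < R) : ∀ᶠ δ in 𝓝[>] (0 : ℝ), radialCutoff R δ s = 1 := by
    have : 0 < R ^ 2 - ‖s‖ ^ 2 := by nlinarith [norm_nonneg s]
    filter_upwards [Ioo_mem_nhdsGT this] with δ hδ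
    exact radialCutoff_eq_one hδ.1 (by linarith [hδ.2])
  have l2 : Tendsto (fun δ => ∑' j, d j * ((p j).re * radialCutoff R δ (p j))) (𝓝[>] 0)
      (𝓝 (∑' j, {s : ℂ | ‖s‖ < R}.indicator (fun s => d j * s.re) (p j))) := by
    refine tendsto_tsum_of_dominated_convergence (hS.summable_of_norm_lt hE hR) (fun j => ?_) ?_
    · by_cases h : ‖p j‖ < R
      · rw [Set.indicator_of_mem (show p j ∈ {s : ℂ | ‖s‖ < R} from h)]
        refine tendsto_const_nhds.congr' ((hnear h).mono fun δ hδ => ?_)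
        simp only [hδ, mul_one]
      · rw [Set.indicator_of_notMem (show p j ∉ {s : ℂ | ‖s‖ < R} from h)]
        refine tendsto_const_nhds.congr' ?_
        filter_upwards [self_mem_nhdsWithin] with δ hδ
        rw [radialCutoff_eq_zero hR.le hδ (not_lt.1 h), mul_zero, mul_zero]
    · filter_upwards [self_mem_nhdsWithin] with δ hδ j
      rw [← mul_assoc, Real.norm_of_nonneg (mul_nonneg (hterm j) (radialCutoff_nonneg _ _ _))]
      by_cases h : ‖p j‖ < R
      · rw [Set.indicator_of_mem (show p j ∈ {s : ℂ | ‖s‖ < R} from h)]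
        exact mul_le_of_le_one_right (hterm j) (radialCutoff_le_one _ _ _)
      · rw [Set.indicator_of_notMem (show p j ∉ {s : ℂ | ‖s‖ < R} from h),
          radialCutoff_eq_zero hR.le hδ (not_lt.1 h), mul_zero]
  have hloc := hS.locallyIntegrable_log_norm_axis hE
  have hi : IntegrableOn (fun y : ℝ => Real.log ‖S (y * Complex.I)‖) (Set.Ioo (-R) R) :=
    (hloc.integrableOn_isCompact isCompact_Icc).mono_set Set.Ioo_subset_Icc_self
  have hnorm (y : ℝ) : ‖(y : ℂ) * Complex.I‖ < R ↔ y ∈ Set.Ioo (-R) R := by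
    rw [norm_mul, Complex.norm_I, mul_one, Complex.norm_real, Real.norm_eq_abs, abs_lt, Set.mem_Ioo]
  have l3 : Tendsto (fun δ => ∫ y : ℝ, Real.log ‖S (y * Complex.I)‖ *
      radialCutoff R δ (y * Complex.I)) (𝓝[>] 0)
      (𝓝 (∫ y in Set.Ioo (-R) R, Real.log ‖S (y * Complex.I)‖)) := by
    have hI := hi.integrable_indicator measurableSet_Ioo
    rw [← integral_indicator measurableSet_Ioo]
    refine tendsto_integral_filter_of_dominated_convergence _ ?_ ?_ hI.norm ?_
    · refine Eventually.of_forall fun δ => hloc.aestronglyMeasurable.mul ?_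
      exact ((contDiff_radialCutoff R δ).continuous.comp
        isClosedEmbedding_axis.continuous).aestronglyMeasurable
    · filter_upwards [self_mem_nhdsWithin] with δ hδ
      refine ae_of_all _ fun y => ?_
      by_cases h : y ∈ Set.Ioo (-R) R
      · rw [Set.indicator_of_mem h, norm_mul,
          Real.norm_of_nonneg (radialCutoff_nonneg R δ (y * Complex.I))]
        exact mul_le_of_le_one_right (norm_nonneg _) (radialCutoff_le_one _ _ _)
      · rw [Set.indicator_of_notMem h,
          radialCutoff_eq_zero hR.le hδ (not_lt.1 fun h' => h ((hnorm y).1 h')), mul_zero]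
    · refine ae_of_all _ fun y => ?_
      by_cases h : y ∈ Set.Ioo (-R) R
      · rw [Set.indicator_of_mem h]
        refine tendsto_const_nhds.congr' ((hnear ((hnorm y).2 h)).mono fun δ hδ => ?_)
        simp only [hδ, mul_one]
      · rw [Set.indicator_of_notMem h]
        refine tendsto_const_nhds.congr' ?_
        filter_upwards [self_mem_nhdsWithin] with δ hδ
        rw [radialCutoff_eq_zero hR.le hδ (not_lt.1 fun h' => h ((hnorm y).1 h')), mul_zero]
  -- `δ → 0` in the cutoff identity. The cutoff vanishes on `‖s‖ = R`, so the limits involve the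
  -- open disc and the open interval. The weight `1/2` is undone by the factor `2` from `log ‖S‖ ^ 2
  -- = 2 log ‖S‖`.
  have hlim := tendsto_nhds_unique_of_eventuallyEq l1 ((l2.const_mul (2 * Real.pi)).sub l3) (by
    filter_upwards [Ioo_mem_nhdsGT (show 0 < R ^ 2 - r₁ ^ 2 by nlinarith)] with δ hδ
    exact hS.greenFormula_radialCutoff hE hR hV hfd hfS hr₁ hr₁V hδ.1 (by linarith [hδ.2]))
  have htr : truncatedBodeIntegral S R =
      2 * ∫ y in Set.Ioo (-R) R, Real.log ‖S (y * Complex.I)‖ := by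
    rw [truncatedBodeIntegral, intervalIntegral.integral_of_le (by linarith),
      integral_Ioc_eq_integral_Ioo, ← integral_const_mul]
    congr 1
    ext y
    rw [Real.log_pow]; norm_num
  rw [htr]
  linarith

end IsWeierstrassFactorization
end BodeSensitivity

/-! ### Passage to infinite radius -/

namespace BodeSensitivity

variable {ι : Type*} {S g : ℂ → ℂ} {p : ι → ℂ} {d : ι → ℝ} {c : ι → ℂ → ℂ} {E : Set ℝ} {U : Set ℂ}

namespace IsWeierstrassFactorization

lemma countable_exceptional (hS : IsWeierstrassFactorization S g p d c E U) : E.Countable := by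
  have : E ⊆ ⋃ n : ℕ, E ∩ Set.Icc (-(n : ℝ)) n := fun y hy => by
    obtain ⟨n, hn⟩ := exists_nat_ge |y|
    exact Set.mem_iUnion.2 ⟨n, hy, abs_le.1 hn⟩
  exact (Set.countable_iUnion fun n : ℕ => (hS.locallyFinite n).countable).mono this

/-- The regular part is covered by countably many compact half balls (Lindelöf), each with finitely
many zeros. -/
lemma countable_zeros (hS : IsWeierstrassFactorization S g p d c E U) :
    {s ∈ regularPart E | S s = 0}.Countable := by
  have key : ∀ s ∈ regularPart E, ∃ r > 0,
      Metric.closedBall s r ∩ {s : ℂ | 0 ≤ s.re} ⊆ regularPart E := fun s hs =>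
    exists_closedBall_inter_subset_regularPart hS.isClosed_exceptional hs
  choose! r hr hsub using key
  obtain ⟨t, ht, htc, hcov⟩ := TopologicalSpace.countable_cover_nhdsWithin
    (s := regularPart E) (f := fun s => Metric.closedBall s (r s))
    fun s hs => mem_nhdsWithin_of_mem_nhds (Metric.closedBall_mem_nhds s (hr s hs))
  refine (htc.biUnion fun s hs => (hS.finite_zeros (isCompact_closedBall_inter s (r s))
    (hsub s (ht hs))).countable).mono fun z hz => ?_
  obtain ⟨s, hs, hzs⟩ := Set.mem_iUnion₂.1 (hcov hz.1)
  exact Set.mem_iUnion₂.2 ⟨s, hs, ⟨hzs, hz.1.1⟩, hz.2⟩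

/-- Beyond the sign condition, a radius can fail only if it is `±y` with `y ∈ E` or the modulus of a
regular zero: countably many values, whose complement is dense. -/
lemma exists_mem_admissibleRadii (hS : IsWeierstrassFactorization S g p d c E U) {a b : ℝ}
    (ha : 0 ≤ a) (hab : a < b) : ∃ R ∈ admissibleRadii S E, a < R ∧ R < b := by
  have hc : (E ∪ Neg.neg '' E ∪ norm '' {s ∈ regularPart E | S s = 0}).Countable :=
    (hS.countable_exceptional.union (hS.countable_exceptional.image _)).union
      (hS.countable_zeros.image _)
  obtain ⟨R, hR, hab⟩ := (hc.dense_compl ℝ).exists_between hab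
  simp only [Set.mem_compl_iff, Set.mem_union, not_or] at hR
  refine ⟨R, ⟨ha.trans_lt hab.1, hR.1.1, fun h => hR.1.2 ⟨_, h, neg_neg R⟩, fun s hs h0 =>
    hR.2 ⟨s, ⟨⟨hs.2, fun y hy hsy => ?_⟩, h0⟩, hs.1⟩⟩, hab⟩
  have hy' : |y| = R := by
    rw [← hs.1, hsy, norm_mul, Complex.norm_I, mul_one, Complex.norm_real, Real.norm_eq_abs]
  rcases abs_choice y with h | h
  · exact hR.1.1 (by rwa [← hy', h])
  · exact hR.1.2 ⟨y, hy, by rw [← h, hy']⟩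

lemma intervalIntegrable_log_sq (hS : IsWeierstrassFactorization S g p d c E U)
    (hE : ∀ y ∈ E, LogRegularAt S y) (a b : ℝ) :
    IntervalIntegrable (fun w : ℝ => Real.log (‖S ((w : ℂ) * Complex.I)‖ ^ 2)) volume a b := by
  simp only [Real.log_pow]
  rw [intervalIntegrable_iff]
  exact (((hS.locallyIntegrable_log_norm_axis hE).integrableOn_isCompact
    isCompact_uIcc).mono_set Set.uIoc_subset_uIcc).const_mul _

lemma continuous_truncatedBodeIntegral (hS : IsWeierstrassFactorization S g p d c E U)
    (hE : ∀ y ∈ E, LogRegularAt S y) : Continuous (truncatedBodeIntegral S) := by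
  have hi := hS.intervalIntegrable_log_sq hE
  have hc := intervalIntegral.continuous_primitive hi 0
  have : truncatedBodeIntegral S = fun R =>
      (∫ w in (0 : ℝ)..R, Real.log (‖S ((w : ℂ) * Complex.I)‖ ^ 2)) -
        ∫ w in (0 : ℝ)..(-R), Real.log (‖S ((w : ℂ) * Complex.I)‖ ^ 2) := by
    ext R
    rw [truncatedBodeIntegral, intervalIntegral.integral_interval_sub_left (hi _ _) (hi _ _)]
  rw [this]
  exact hc.sub (hc.comp continuous_neg)

end IsWeierstrassFactorization

/-- A continuous function has the limits along `atTop` that it has along the points of a set which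
meets every interval far out. -/
lemma tendsto_atTop_of_tendsto_inf_principal {T : ℝ → ℝ} (hT : Continuous T) {D : Set ℝ}
    (hD : ∀ a b : ℝ, 0 ≤ a → a < b → ∃ R ∈ D, a < R ∧ R < b) {F : Filter ℝ} {κ : Type*}
    {q : κ → Prop} {s : κ → Set ℝ} (hF : F.HasBasis q s) (hs : ∀ i, q i → IsClosed (s i))
    (h : Tendsto T (atTop ⊓ 𝓟 D) F) : Tendsto T atTop F := by
  rw [hF.tendsto_right_iff] at h ⊢
  intro i hi
  obtain ⟨a, ha⟩ := eventually_atTop.1 (eventually_inf_principal.1 (h i hi))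
  filter_upwards [eventually_ge_atTop (max a 0)] with R hR
  -- Every large `R` is a limit of points of `D` beyond `a`, and closed basis sets of `F` survive
  -- this closure.
  have hcl : R ∈ closure {x | x ∈ D ∧ a ≤ x} := Metric.mem_closure_iff.2 fun ε hε => by
    obtain ⟨x, hx, h1, h2⟩ := hD R (R + ε) ((le_max_right _ _).trans hR) (by linarith)
    refine ⟨x, ⟨hx, ((le_max_left _ _).trans hR).trans h1.le⟩, ?_⟩
    rw [Real.dist_eq, abs_lt]; constructor <;> linarith
  have := map_mem_closure hT hcl fun x hx => ha x hx.2 hx.1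
  rwa [(hs i hi).closure_eq] at this

section PartialSums

variable {a : ι → ℝ}

lemma tendsto_tsum_indicator_norm_lt (ha : ∀ j, 0 ≤ a j) (hs : Summable a) (p : ι → ℂ) :
    Tendsto (fun R : ℝ => ∑' j, {j | ‖p j‖ < R}.indicator a j) atTop (𝓝 (∑' j, a j)) := by
  refine tendsto_tsum_of_dominated_convergence hs (fun j => ?_) (Eventually.of_forall fun R j => ?_)
  · refine tendsto_const_nhds.congr' ?_
    filter_upwards [eventually_gt_atTop ‖p j‖] with R hR
    exact (Set.indicator_of_mem (s := {j | ‖p j‖ < R}) hR a).symm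
  · rw [Real.norm_of_nonneg (Set.indicator_nonneg (fun i _ => ha i) j)]
    exact Set.indicator_le_self' (fun i _ => ha i) j

/-- Summability at each finite radius is essential: otherwise `tsum` would be the default value `0`
instead of an upper bound for finite partial sums. -/
lemma tendsto_tsum_indicator_norm_lt_atTop (ha : ∀ j, 0 ≤ a j) (hs : ¬ Summable a) {p : ι → ℂ}
    (hR : ∀ R : ℝ, 0 < R → Summable fun j => {j | ‖p j‖ < R}.indicator a j) :
    Tendsto (fun R : ℝ => ∑' j, {j | ‖p j‖ < R}.indicator a j) atTop atTop := by
  refine tendsto_atTop.2 fun C => ?_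
  obtain ⟨J, hJ⟩ : ∃ J : Finset ι, C < ∑ j ∈ J, a j := by
    by_contra! h
    exact hs (summable_of_sum_le ha h)
  have hall : ∀ᶠ R : ℝ in atTop, ∀ j ∈ J, ‖p j‖ < R :=
    (Finset.eventually_all J).2 fun j _ => eventually_gt_atTop _
  filter_upwards [hall, eventually_gt_atTop 0] with R h1 h2
  refine hJ.le.trans ?_
  rw [← Finset.sum_congr rfl fun j hj =>
    Set.indicator_of_mem (s := {j | ‖p j‖ < R}) (h1 j hj) a]
  exact (hR R h2).sum_le_tsum J fun j _ => Set.indicator_nonneg (fun i _ => ha i) j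

end PartialSums

end BodeSensitivity

theorem corollary1 {ι : Type*} (S g : ℂ → ℂ) (p : ι → ℂ) (d : ι → ℝ) (c : ι → ℂ → ℂ)
    (E : Set ℝ) (U : Set ℂ)
    (hS : BodeSensitivity.IsWeierstrassFactorization S g p d c E U)
    (hE : ∀ y ∈ E, BodeSensitivity.LogRegularAt S y)
    (logS : ℝ → ℂ → ℂ)
    (hlog : ∀ R ∈ BodeSensitivity.admissibleRadii S E,
      BodeSensitivity.IsLogBranch S R (logS R))
    (A : ℝ)
    (hA : Tendsto (fun R : ℝ => (2 * Complex.I * BodeSensitivity.arcIntegral (logS R) R).re)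
      (atTop ⊓ 𝓟 (BodeSensitivity.admissibleRadii S E)) (𝓝 A)) :
    (∀ R : ℝ, IntervalIntegrable
      (fun w : ℝ => Real.log (‖S ((w : ℂ) * Complex.I)‖ ^ 2)) volume (-R) R) ∧
    (Summable (fun j => d j * (p j).re) →
      BodeSensitivity.HasBodeIntegral S (4 * Real.pi * ∑' j, d j * (p j).re - A)) ∧
    (¬ Summable (fun j => d j * (p j).re) →
      Tendsto (BodeSensitivity.truncatedBodeIntegral S) atTop atTop) := by
  have ha (j : ι) : 0 ≤ d j * (p j).re := mul_nonneg (hS.order_pos j).le (hS.pole_re_pos j).le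
  have hind (R : ℝ) (j : ι) : {s : ℂ | ‖s‖ < R}.indicator (fun s => d j * s.re) (p j) =
      {j | ‖p j‖ < R}.indicator (fun j => d j * (p j).re) j := rfl
  have hsum (R : ℝ) (hR : 0 < R) :
      Summable fun j => {j | ‖p j‖ < R}.indicator (fun j => d j * (p j).re) j := by
    simpa only [hind] using hS.summable_of_norm_lt hE hR
  have heq : ∀ R ∈ BodeSensitivity.admissibleRadii S E,
      4 * Real.pi * (∑' j, {j | ‖p j‖ < R}.indicator (fun j => d j * (p j).re) j) -
        (2 * Complex.I * BodeSensitivity.arcIntegral (logS R) R).re =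
      BodeSensitivity.truncatedBodeIntegral S R := fun R hR => by
    rw [hS.truncatedBodeIntegral_eq hE hR.1 (hlog R hR)]
    simp only [hind]
  have heq' := eventually_inf_principal.2
    (Eventually.of_forall (f := atTop) heq)
  have hcont := hS.continuous_truncatedBodeIntegral hE
  refine ⟨fun R => hS.intervalIntegrable_log_sq hE _ _, fun h => ?_, fun h => ?_⟩
  -- The finite-radius identity is available only at admissible radii; continuity of the truncated
  -- integral extends the limit to all `R`.
  · refine BodeSensitivity.tendsto_atTop_of_tendsto_inf_principal hcont
      (fun a b => hS.exists_mem_admissibleRadii) Metric.nhds_basis_closedBall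
      (fun _ _ => Metric.isClosed_closedBall) (Tendsto.congr' heq' ?_)
    exact (((BodeSensitivity.tendsto_tsum_indicator_norm_lt ha h p).const_mul _).mono_left
      inf_le_left).sub hA
  · refine BodeSensitivity.tendsto_atTop_of_tendsto_inf_principal hcont
      (fun a b => hS.exists_mem_admissibleRadii) atTop_basis
      (fun _ _ => isClosed_Ici) (Tendsto.congr' heq' ?_)
    have h1 := (BodeSensitivity.tendsto_tsum_indicator_norm_lt_atTop ha h hsum).const_mul_atTop
      (show 0 < 4 * Real.pi by positivity)
    simpa only [sub_eq_add_neg] using (h1.mono_left inf_le_left).atTop_add hA.neg
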